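/- A definition of volume $\mu$ assigns to every normed space $V$ of finite dimension $n$ a norm $\mu_V$ on the line $\Lambda^nV$ such that (i) for Euclidean $V$ it is the norm induced by Lebesgue measure, (ii) $\Lambda^nf$ does not increase the norm when $f:V\to W$ (with $\dim W=n$) is linear and does not increase distances, and (iii) $V\mapsto(\Lambda^nV,\mu_V)$ is continuous with respect to the Banach–Mazur distance. Its dual $\mu^*$ is given by $(\mu^*)_V:=(\mu_{V^*})^*$. For linearly independent $v_1,\dots,v_{n-1}\in V$ put $\mu_{n-1}(v_1\wedge\dots\wedge v_{n-1}):=\mu_W(v_1\wedge\dots\wedge v_{n-1})$, where $W$ is the span of the $v_i$ with the induced norm (and $0$ if they are dependent); $\mu$ is called convex if $\mu_{n-1}$ is a norm on $\Lambda^{n-1}V$ for every normed space $V$ of finite dimension $n\ge1$. The norm $\mu_V$ determines a Lebesgue measure on $V$, which is used for all volumes and (dual) mixed volumes in $V$; on the dual space $V^*$ one uses the Lebesgue measure determined by $(\mu^*)_{V^*}$. If $\mu$ is convex, the isoperimetrix $\mathbb I_\mu B$ of a normed space with unit ball $B$ is the unique centrally symmetric compact convex body with $\int_{\partial K}\mu_{n-1}=n\,V(K[n-1],\mathbb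 I_\mu B)$ for all compact convex bodies $K$, where $V(K[n-1],L)=\frac1n\frac{d}{d\varepsilon}\big|_{0^+}\mathrm{vol}(K+\varepsilon L)$ is the mixed volume. A star body $S\subset V$ is a compact set, star-shaped about $0$ and with $0$ in its interior, whose radial function $\rho_S(x)=\max\{t\ge0: tx\in S\}$ is continuous on $V\setminus\{0\}$; it is smooth if $\rho_S$ is smooth there. The dual mixed volume is $\tilde V(S_1,\dots,S_n)=\frac1n\int_\Sigma\rho_{S_1}\cdots\rho_{S_n}\,i_v\Omega$, where $\Omega$ is a volume form with the given Lebesgue measure and $\Sigma$ is a hypersurface in the homology class of a sphere around $0$. For a smooth star body $S$ let $\tilde A_\mu(S)=\int_{\partial S}\tilde\mu_{n-1}$, where $\tilde\mu_{n-1}$ is, at $p\in\partial S$, the density $\mu_W$ on $W=V/\mathbb R p\cong T_p\partial S$ with the quotient norm. Theorem. Let $\mu$ be a definition of volume and let $V$ be a normed space of finite dimension $n\ge1$ with unit ball $B$. There exists a star body $\tilde{\mathbb I}_\mu B\subset V$, the dual isoperimetrix, such that: 1. $\tilde A_\mu(S)=n\,\tilde V(S[n-1],\tilde{\mathbb I}_\mu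 B)$ for all smooth star bodies $S\subset V$. 2. $\tilde A_\mu$ extends by continuity in the radial topology (uniform convergence of radial functions on a sphere) to all star bodies, and among all star bodies of a given volume $r>0$ the dilate of $\tilde{\mathbb I}_\mu B$ of volume $r$ has maximal surface area $\tilde A_\mu$. 3. If the dual definition of volume $\mu^*$ is convex, then $\tilde{\mathbb I}_\mu B=(\mathbb I_{\mu^*}B^\circ)^\circ$, where $\mathbb I_{\mu^*}B^\circ\subset V^*$ is the isoperimetrix, with respect to $\mu^*$, of the dual normed space (with unit ball $B^\circ$); in particular this isoperimetrix exists and is unique. -/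

import Mathlib

open MeasureTheory Module Filter Topology
open scoped Pointwise ContDiff

universe u

noncomputable section

/-! ### Definitions of volume -/

/-- The pairing between `Λⁿ V*` and `Λⁿ V`, with
`⟨ξ₁ ∧ … ∧ ξₙ, v₁ ∧ … ∧ vₙ⟩ = det (ξⱼ (vᵢ))`. -/
def wedgePairing (n : ℕ) (E : Type u) [NormedAddCommGroup E] [NormedSpace ℝ E] :
    ⋀[ℝ]^n (StrongDual ℝ E) →ₗ[ℝ] Dual ℝ (⋀[ℝ]^n E) :=
  (exteriorPower.pairingDual ℝ E n).comp
    (exteriorPower.map n (ContinuousLinearMap.coeLM ℝ : (E →L[ℝ] ℝ) →ₗ[ℝ] (E →ₗ[ℝ] ℝ)))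

/-- A definition of volume: a norm on `Λⁿ E` for every normed space `E` of finite dimension `n`,
which is the one induced by Lebesgue measure when `E` is Euclidean, which does not increase under
linear maps that do not increase distances, and which is continuous with respect to the
Banach-Mazur distance. -/
structure DefinitionOfVolume where
  /-- the norm on the line `Λⁿ E` -/
  norm : ∀ {n : ℕ} (E : Type u) [NormedAddCommGroup E] [NormedSpace ℝ E] [FiniteDimensional ℝ E],
    finrank ℝ E = n → Seminorm ℝ (⋀[ℝ]^n E)
  definite : ∀ {n : ℕ} (E : Type u) [NormedAddCommGroup E] [NormedSpace ℝ E]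
    [FiniteDimensional ℝ E] (hE : finrank ℝ E = n) (a : ⋀[ℝ]^n E), norm E hE a = 0 → a = 0
  euclidean : ∀ {n : ℕ} (E : Type u) [NormedAddCommGroup E] [InnerProductSpace ℝ E]
    [FiniteDimensional ℝ E] (hE : finrank ℝ E = n) (b : OrthonormalBasis (Fin n) ℝ E),
    norm E hE (exteriorPower.ιMulti ℝ n b) = 1
  mono : ∀ {n : ℕ} (E F : Type u) [NormedAddCommGroup E] [NormedSpace ℝ E] [FiniteDimensional ℝ E]
    [NormedAddCommGroup F] [NormedSpace ℝ F] [FiniteDimensional ℝ F]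
    (hE : finrank ℝ E = n) (hF : finrank ℝ F = n) (f : E →ₗ[ℝ] F), (∀ x, ‖f x‖ ≤ ‖x‖) →
    ∀ a : ⋀[ℝ]^n E, norm F hF (exteriorPower.map n f a) ≤ norm E hE a
  continuous : ∀ {n : ℕ} (E : Type u) [NormedAddCommGroup E] [NormedSpace ℝ E]
    [FiniteDimensional ℝ E] (hE : finrank ℝ E = n) (ε : ℝ), 0 < ε → ∃ δ : ℝ, 0 < δ ∧
    ∀ (F : Type u) [NormedAddCommGroup F] [NormedSpace ℝ F] [FiniteDimensional ℝ F]
      (hF : finrank ℝ F = n) (f : E ≃ₗ[ℝ] F),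
      (∀ x, ‖f x‖ ≤ (1 + δ) * ‖x‖) → (∀ x, ‖x‖ ≤ (1 + δ) * ‖f x‖) →
      ∀ a : ⋀[ℝ]^n E,
        |norm F hF (exteriorPower.map n (f : E →ₗ[ℝ] F) a) - norm E hE a| ≤ ε * norm E hE a

/-! Facts needed for the dual definition of volume. -/

theorem finrank_strongDual_eq {n : ℕ} (E : Type u) [NormedAddCommGroup E] [NormedSpace ℝ E]
    [FiniteDimensional ℝ E] (hE : finrank ℝ E = n) : finrank ℝ (StrongDual ℝ E) = n := by
  rw [← hE, ← Subspace.dual_finrank_eq (K := ℝ) (V := E)]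
  exact (LinearMap.toContinuousLinearMap : (E →ₗ[ℝ] ℝ) ≃ₗ[ℝ] E →L[ℝ] ℝ).finrank_eq.symm

theorem finrank_exteriorPower_top {n : ℕ} (E : Type u) [NormedAddCommGroup E] [NormedSpace ℝ E]
    [FiniteDimensional ℝ E] (hE : finrank ℝ E = n) : finrank ℝ (⋀[ℝ]^n E) = 1 := by
  rw [exteriorPower.finrank_eq, hE, Nat.choose_self]

theorem wedgePairing_ιMulti {n : ℕ} (E : Type u) [NormedAddCommGroup E] [NormedSpace ℝ E]
    (ξ : Fin n → StrongDual ℝ E) (v : Fin n → E) :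
    wedgePairing n E (exteriorPower.ιMulti ℝ n ξ) (exteriorPower.ιMulti ℝ n v) =
      Matrix.det (Matrix.of fun i j => ξ j (v i)) := by
  simp [wedgePairing, exteriorPower.map_apply_ιMulti]

/-- The pairing is natural: the transpose of `Λⁿ f` is `Λⁿ` of the transpose of `f`. -/
theorem wedgePairing_map {n : ℕ} (E F : Type u) [NormedAddCommGroup E] [NormedSpace ℝ E]
    [NormedAddCommGroup F] [NormedSpace ℝ F] (f : E →L[ℝ] F)
    (f' : StrongDual ℝ F →ₗ[ℝ] StrongDual ℝ E) (hf : ∀ ξ x, f' ξ x = ξ (f x))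
    (b : ⋀[ℝ]^n (StrongDual ℝ F)) (a : ⋀[ℝ]^n E) :
    wedgePairing n F b (exteriorPower.map n (f : E →ₗ[ℝ] F) a) =
      wedgePairing n E (exteriorPower.map n f' b) a := by
  suffices h : (LinearMap.lcomp ℝ ℝ (exteriorPower.map n (f : E →ₗ[ℝ] F))).comp
      (wedgePairing n F) = (wedgePairing n E).comp (exteriorPower.map n f') by
    exact LinearMap.congr_fun (LinearMap.congr_fun h b) a
  apply exteriorPower.linearMap_ext
  ext ξ : 1
  apply exteriorPower.linearMap_ext
  ext v
  simp [exteriorPower.map_apply_ιMulti, wedgePairing_ιMulti, hf]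

/-- A non-degenerate seminorm on the line `Λⁿ E*` has a unit vector, and this vector computes the
dual norm. -/
theorem exists_unit_wedge {n : ℕ} (E : Type u) [NormedAddCommGroup E] [NormedSpace ℝ E]
    [FiniteDimensional ℝ E] (hE : finrank ℝ E = n) (N : Seminorm ℝ (⋀[ℝ]^n (StrongDual ℝ E)))
    (hN : ∀ b, N b = 0 → b = 0) :
    ∃ b₀, N b₀ = 1 ∧ (∀ b, ∃ c : ℝ, b = c • b₀) ∧ ∀ a : ⋀[ℝ]^n E,
      IsLUB {r : ℝ | ∃ b, N b ≤ 1 ∧ r = |wedgePairing n E b a|} |wedgePairing n E b₀ a| := by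
  obtain ⟨b₁, hb₁, hspan⟩ := finrank_eq_one_iff'.mp
    (finrank_exteriorPower_top (StrongDual ℝ E) (finrank_strongDual_eq E hE))
  have hN₁ : N b₁ ≠ 0 := fun h => hb₁ (hN _ h)
  have hpos : 0 < N b₁ := lt_of_le_of_ne (apply_nonneg N b₁) hN₁.symm
  have hunit : N ((N b₁)⁻¹ • b₁) = 1 := by
    rw [map_smul_eq_mul, Real.norm_of_nonneg (inv_nonneg.2 hpos.le), inv_mul_cancel₀ hN₁]
  have hsp : ∀ b, ∃ c : ℝ, b = c • ((N b₁)⁻¹ • b₁) := fun b => by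
    obtain ⟨c, hc⟩ := hspan b
    exact ⟨c * N b₁, by rw [smul_smul, mul_assoc, mul_inv_cancel₀ hN₁, mul_one, hc]⟩
  refine ⟨(N b₁)⁻¹ • b₁, hunit, hsp, fun a => ?_⟩
  generalize (N b₁)⁻¹ • b₁ = b₀ at hunit hsp
  refine ⟨?_, fun r hr => hr ⟨b₀, hunit.le, rfl⟩⟩
  rintro r ⟨b, hb, rfl⟩
  obtain ⟨c, rfl⟩ := hsp b
  rw [map_smul_eq_mul, hunit, mul_one, Real.norm_eq_abs] at hb
  simp only [map_smul, LinearMap.smul_apply, smul_eq_mul, abs_mul]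
  exact mul_le_of_le_one_left (abs_nonneg _) hb

/-- The norm on `Λⁿ E` dual to a norm `N` on `Λⁿ E*`:
`a ↦ sup {|⟨b, a⟩| : b ∈ Λⁿ E*, N b ≤ 1}`. -/
def dualWedgeNorm {n : ℕ} (E : Type u) [NormedAddCommGroup E] [NormedSpace ℝ E]
    [FiniteDimensional ℝ E] (hE : finrank ℝ E = n) (N : Seminorm ℝ (⋀[ℝ]^n (StrongDual ℝ E)))
    (hN : ∀ b, N b = 0 → b = 0) : Seminorm ℝ (⋀[ℝ]^n E) :=
  Seminorm.of (fun a => sSup {r : ℝ | ∃ b, N b ≤ 1 ∧ r = |wedgePairing n E b a|})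
    (by
      obtain ⟨b₀, hb₀, -, hlub⟩ := exists_unit_wedge E hE N hN
      have hne : ∀ a, {r : ℝ | ∃ b, N b ≤ 1 ∧ r = |wedgePairing n E b a|}.Nonempty :=
        fun a => ⟨_, b₀, hb₀.le, rfl⟩
      intro a a'
      rw [(hlub _).csSup_eq (hne _), (hlub _).csSup_eq (hne _), (hlub _).csSup_eq (hne _), map_add]
      exact abs_add_le _ _)
    (by
      obtain ⟨b₀, hb₀, -, hlub⟩ := exists_unit_wedge E hE N hN
      have hne : ∀ a, {r : ℝ | ∃ b, N b ≤ 1 ∧ r = |wedgePairing n E b a|}.Nonempty :=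
        fun a => ⟨_, b₀, hb₀.le, rfl⟩
      intro c a
      rw [(hlub _).csSup_eq (hne _), (hlub _).csSup_eq (hne _), map_smul, smul_eq_mul, abs_mul,
        Real.norm_eq_abs])

theorem dualWedgeNorm_eq {n : ℕ} (E : Type u) [NormedAddCommGroup E] [NormedSpace ℝ E]
    [FiniteDimensional ℝ E] (hE : finrank ℝ E = n) (N : Seminorm ℝ (⋀[ℝ]^n (StrongDual ℝ E)))
    (hN : ∀ b, N b = 0 → b = 0) (b₀ : ⋀[ℝ]^n (StrongDual ℝ E)) (a : ⋀[ℝ]^n E)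
    (h : IsLUB {r : ℝ | ∃ b, N b ≤ 1 ∧ r = |wedgePairing n E b a|} |wedgePairing n E b₀ a|) :
    dualWedgeNorm E hE N hN a = |wedgePairing n E b₀ a| :=
  h.csSup_eq ⟨_, 0, by simp, rfl⟩

/-- The pairing between `Λⁿ E*` and `Λⁿ E` is non-degenerate. -/
theorem eq_zero_of_wedgePairing {n : ℕ} (E : Type u) [NormedAddCommGroup E] [NormedSpace ℝ E]
    [FiniteDimensional ℝ E] (hE : finrank ℝ E = n) (a : ⋀[ℝ]^n E)
    (h : ∀ b, wedgePairing n E b a = 0) : a = 0 := by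
  let e : Basis (Fin n) ℝ E := (finBasis ℝ E).reindex (finCongr hE)
  let ξ : Fin n → StrongDual ℝ E := fun i => LinearMap.toContinuousLinearMap (e.coord i)
  have h1 : wedgePairing n E (exteriorPower.ιMulti ℝ n ξ) (exteriorPower.ιMulti ℝ n e) = 1 := by
    rw [wedgePairing_ιMulti, ← Matrix.det_one (n := Fin n)]
    congr 1
    ext i j
    simp [ξ, Matrix.one_apply, Finsupp.single_apply]
  have hne : exteriorPower.ιMulti ℝ n e ≠ 0 := by
    intro h0
    rw [h0, map_zero] at h1
    exact zero_ne_one h1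
  obtain ⟨c, rfl⟩ := (finrank_eq_one_iff_of_nonzero' _ hne).mp
    (finrank_exteriorPower_top E hE) a
  have := h (exteriorPower.ιMulti ℝ n ξ)
  rw [map_smul, h1, smul_eq_mul, mul_one] at this
  rw [this, zero_smul]

theorem exteriorPower_map_smul {n : ℕ} (E F : Type u) [AddCommGroup E] [Module ℝ E]
    [AddCommGroup F] [Module ℝ F] (c : ℝ) (f : E →ₗ[ℝ] F) (a : ⋀[ℝ]^n E) :
    exteriorPower.map n (c • f) a = c ^ n • exteriorPower.map n f a := by
  suffices h : exteriorPower.map n (c • f) = c ^ n • exteriorPower.map n f from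
    LinearMap.congr_fun h a
  apply exteriorPower.linearMap_ext
  ext1 v
  have := (exteriorPower.ιMulti ℝ n (M := F)).map_smul_univ (fun _ => c) (fun i => f (v i))
  simp only [Finset.prod_const, Finset.card_univ, Fintype.card_fin] at this
  simpa [exteriorPower.map_apply_ιMulti, Function.comp_def] using this

/-- Continuity with respect to the Banach-Mazur distance follows from monotonicity. -/
theorem continuous_of_mono
    (norm : ∀ {n : ℕ} (E : Type u) [NormedAddCommGroup E] [NormedSpace ℝ E]
      [FiniteDimensional ℝ E], finrank ℝ E = n → Seminorm ℝ (⋀[ℝ]^n E))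
    (mono : ∀ {n : ℕ} (E F : Type u) [NormedAddCommGroup E] [NormedSpace ℝ E]
      [FiniteDimensional ℝ E] [NormedAddCommGroup F] [NormedSpace ℝ F] [FiniteDimensional ℝ F]
      (hE : finrank ℝ E = n) (hF : finrank ℝ F = n) (f : E →ₗ[ℝ] F), (∀ x, ‖f x‖ ≤ ‖x‖) →
      ∀ a : ⋀[ℝ]^n E, norm F hF (exteriorPower.map n f a) ≤ norm E hE a)
    {n : ℕ} (E : Type u) [NormedAddCommGroup E] [NormedSpace ℝ E]
    [FiniteDimensional ℝ E] (hE : finrank ℝ E = n) (ε : ℝ) (hε : 0 < ε) :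
    ∃ δ : ℝ, 0 < δ ∧
    ∀ (F : Type u) [NormedAddCommGroup F] [NormedSpace ℝ F] [FiniteDimensional ℝ F]
      (hF : finrank ℝ F = n) (f : E ≃ₗ[ℝ] F),
      (∀ x, ‖f x‖ ≤ (1 + δ) * ‖x‖) → (∀ x, ‖x‖ ≤ (1 + δ) * ‖f x‖) →
      ∀ a : ⋀[ℝ]^n E,
        |norm F hF (exteriorPower.map n (f : E →ₗ[ℝ] F) a) - norm E hE a| ≤ ε * norm E hE a := by
  obtain ⟨δ, hδ, hδε⟩ : ∃ δ : ℝ, 0 < δ ∧ (1 + δ) ^ n < 1 + ε := by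
    have hc : Tendsto (fun δ : ℝ => (1 + δ) ^ n) (𝓝[>] 0) (𝓝 ((1 + 0) ^ n)) :=
      ((by fun_prop : Continuous fun δ : ℝ => (1 + δ) ^ n).tendsto 0).mono_left
        nhdsWithin_le_nhds
    have h1 := hc.eventually (gt_mem_nhds (by simpa using hε : (1 + (0 : ℝ)) ^ n < 1 + ε))
    obtain ⟨δ, h, h'⟩ := (h1.and self_mem_nhdsWithin).exists
    exact ⟨δ, h', h⟩
  refine ⟨δ, hδ, fun F _ _ _ hF f hf hf' a => ?_⟩
  have hδ1 : 0 < 1 + δ := by linarith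
  have key : ∀ (G H : Type u) [NormedAddCommGroup G] [NormedSpace ℝ G] [FiniteDimensional ℝ G]
      [NormedAddCommGroup H] [NormedSpace ℝ H] [FiniteDimensional ℝ H]
      (hG : finrank ℝ G = n) (hH : finrank ℝ H = n) (g : G →ₗ[ℝ] H),
      (∀ x, ‖g x‖ ≤ (1 + δ) * ‖x‖) → ∀ a : ⋀[ℝ]^n G,
        norm H hH (exteriorPower.map n g a) ≤ (1 + δ) ^ n * norm G hG a := by
    intro G H _ _ _ _ _ _ hG hH g hg a
    have h1 := mono G H hG hH ((1 + δ)⁻¹ • g) (fun x => by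
      rw [LinearMap.smul_apply, norm_smul, Real.norm_of_nonneg (inv_nonneg.2 hδ1.le),
        inv_mul_le_iff₀ hδ1]
      exact hg x) a
    rw [exteriorPower_map_smul, map_smul_eq_mul, Real.norm_of_nonneg (by positivity),
      inv_pow, inv_mul_le_iff₀ (by positivity)] at h1
    exact h1
  have h1 := key E F hE hF f hf a
  have h2 := key F E hF hE f.symm (fun y => by simpa using hf' (f.symm y))
    (exteriorPower.map n (f : E →ₗ[ℝ] F) a)
  have h3 : exteriorPower.map n (f.symm : F →ₗ[ℝ] E) (exteriorPower.map n (f : E →ₗ[ℝ] F) a)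
      = a := by
    have h4 := exteriorPower.map_comp (n := n) (f : E →ₗ[ℝ] F) (f.symm : F →ₗ[ℝ] E)
    have h5 : (f.symm : F →ₗ[ℝ] E) ∘ₗ (f : E →ₗ[ℝ] F) = LinearMap.id := by ext; simp
    rw [h5, exteriorPower.map_id] at h4
    exact (LinearMap.congr_fun h4 a).symm
  rw [h3] at h2
  have hNa : 0 ≤ norm E hE a := apply_nonneg _ _
  have hNb : 0 ≤ norm F hF (exteriorPower.map n (f : E →ₗ[ℝ] F) a) := apply_nonneg _ _
  rw [abs_le]
  constructor
  · have h4 : norm E hE a ≤ (1 + ε) * norm F hF (exteriorPower.map n (f : E →ₗ[ℝ] F) a) :=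
      h2.trans (mul_le_mul_of_nonneg_right hδε.le hNb)
    by_contra hcon
    have h5 : norm F hF (exteriorPower.map n (f : E →ₗ[ℝ] F) a) < (1 - ε) * norm E hE a := by
      linarith
    have h6 : (1 + ε) * norm F hF (exteriorPower.map n (f : E →ₗ[ℝ] F) a)
        < (1 + ε) * ((1 - ε) * norm E hE a) := mul_lt_mul_of_pos_left h5 (by linarith)
    nlinarith [mul_nonneg (mul_self_nonneg ε) hNa]
  · have := h1.trans (mul_le_mul_of_nonneg_right hδε.le hNa)
    linarith

namespace DefinitionOfVolume

/-- The dual definition of volume: the norm on `Λⁿ E` is the dual of the norm which the given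
definition of volume puts on `Λⁿ E*`, where `E*` is the dual normed space. -/
def dual (μ : DefinitionOfVolume.{u}) : DefinitionOfVolume.{u} :=
  have hmono : ∀ {n : ℕ} (E F : Type u) [NormedAddCommGroup E] [NormedSpace ℝ E]
      [FiniteDimensional ℝ E] [NormedAddCommGroup F] [NormedSpace ℝ F] [FiniteDimensional ℝ F]
      (hE : finrank ℝ E = n) (hF : finrank ℝ F = n) (f : E →ₗ[ℝ] F), (∀ x, ‖f x‖ ≤ ‖x‖) →
      ∀ a : ⋀[ℝ]^n E,
        dualWedgeNorm F hF (μ.norm (StrongDual ℝ F) (finrank_strongDual_eq F hF))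
          (μ.definite _ _) (exteriorPower.map n f a) ≤
        dualWedgeNorm E hE (μ.norm (StrongDual ℝ E) (finrank_strongDual_eq E hE))
          (μ.definite _ _) a := by
    intro n E F _ _ _ _ _ _ hE hF f hf a
    obtain ⟨b₀, hb₀, -, hlub⟩ := exists_unit_wedge F hF
      (μ.norm (StrongDual ℝ F) (finrank_strongDual_eq F hF)) (μ.definite _ _)
    obtain ⟨b₁, hb₁, -, hlub₁⟩ := exists_unit_wedge E hE
      (μ.norm (StrongDual ℝ E) (finrank_strongDual_eq E hE)) (μ.definite _ _)
    rw [dualWedgeNorm_eq _ _ _ _ _ _ (hlub _), dualWedgeNorm_eq _ _ _ _ _ _ (hlub₁ _)]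
    let g : E →L[ℝ] F := LinearMap.toContinuousLinearMap f
    let g' : StrongDual ℝ F →ₗ[ℝ] StrongDual ℝ E :=
      { toFun := fun ξ => ξ.comp g
        map_add' := fun ξ η => by ext; simp
        map_smul' := fun c ξ => by ext; simp }
    have h := wedgePairing_map E F g g' (fun ξ x => rfl) b₀ a
    have hg : (g : E →ₗ[ℝ] F) = f := by ext; rfl
    rw [hg] at h
    rw [h]
    refine (hlub₁ a).1 ⟨_, ?_, rfl⟩
    refine (μ.mono _ _ (finrank_strongDual_eq F hF) (finrank_strongDual_eq E hE) g'
      (fun ξ => ?_) b₀).trans hb₀.le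
    refine ContinuousLinearMap.opNorm_le_bound _ (norm_nonneg _) fun x => ?_
    exact (ξ.le_opNorm _).trans (mul_le_mul_of_nonneg_left (hf x) (norm_nonneg _))
  { norm := fun E _ _ _ hE =>
      dualWedgeNorm E hE (μ.norm (StrongDual ℝ E) (finrank_strongDual_eq E hE)) (μ.definite _ _)
    definite := by
      intro n E _ _ _ hE a ha
      obtain ⟨b₀, -, hsp, hlub⟩ := exists_unit_wedge E hE
        (μ.norm (StrongDual ℝ E) (finrank_strongDual_eq E hE)) (μ.definite _ _)
      rw [dualWedgeNorm_eq _ _ _ _ _ _ (hlub _), abs_eq_zero] at ha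
      refine eq_zero_of_wedgePairing E hE a fun b => ?_
      obtain ⟨c, rfl⟩ := hsp b
      simp [ha]
    euclidean := by
      intro n E _ _ _ hE b
      obtain ⟨b₀, hb₀, hsp, hlub⟩ := exists_unit_wedge E hE
        (μ.norm (StrongDual ℝ E) (finrank_strongDual_eq E hE)) (μ.definite _ _)
      rw [dualWedgeNorm_eq _ _ _ _ _ _ (hlub _)]
      let J := InnerProductSpace.toDual ℝ E
      let J₁ : E →ₗ[ℝ] StrongDual ℝ E :=
        { toFun := fun x => J x, map_add' := fun x y => by simp,
          map_smul' := fun c x => by simp }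
      let J₂ : StrongDual ℝ E →ₗ[ℝ] E :=
        { toFun := fun x => J.symm x, map_add' := fun x y => by simp,
          map_smul' := fun c x => by simp }
      have hD := finrank_strongDual_eq E hE
      have h1 := μ.mono E (StrongDual ℝ E) hE hD J₁ (fun x => (J.norm_map x).le)
        (exteriorPower.ιMulti ℝ n b)
      have h2 := μ.mono (StrongDual ℝ E) E hD hE J₂ (fun x => (J.symm.norm_map x).le)
        (exteriorPower.map n J₁ (exteriorPower.ιMulti ℝ n b))
      have h3 : exteriorPower.map n J₂ (exteriorPower.map n J₁ (exteriorPower.ιMulti ℝ n b))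
          = exteriorPower.ιMulti ℝ n b := by
        rw [exteriorPower.map_apply_ιMulti, exteriorPower.map_apply_ιMulti]
        congr 1
        ext i
        exact J.symm_apply_apply _
      rw [h3, μ.euclidean E hE b] at h2
      rw [μ.euclidean E hE b] at h1
      obtain ⟨c, hc⟩ := hsp (exteriorPower.map n J₁ (exteriorPower.ιMulti ℝ n b))
      have hc1 : |c| = 1 := by
        have : μ.norm (StrongDual ℝ E) hD
            (exteriorPower.map n J₁ (exteriorPower.ιMulti ℝ n b)) = |c| := by
          rw [hc, map_smul_eq_mul, hb₀, mul_one, Real.norm_eq_abs]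
        rw [← this]
        exact le_antisymm h1 h2
      have hdet : wedgePairing n E (exteriorPower.map n J₁ (exteriorPower.ιMulti ℝ n b))
          (exteriorPower.ιMulti ℝ n b) = 1 := by
        rw [exteriorPower.map_apply_ιMulti, wedgePairing_ιMulti, ← Matrix.det_one (n := Fin n)]
        congr 1
        ext i j
        have : (J (b j)) (b i) = if j = i then 1 else 0 := by
          rw [InnerProductSpace.toDual_apply_apply]
          exact orthonormal_iff_ite.mp b.orthonormal j i
        simpa [Matrix.one_apply, J₁, eq_comm] using this
      rw [hc, map_smul, LinearMap.smul_apply, smul_eq_mul] at hdet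
      have := congrArg abs hdet
      rwa [abs_mul, hc1, one_mul, abs_one] at this
    mono := hmono
    continuous := fun E _ _ _ hE ε hε => continuous_of_mono
      (fun E _ _ _ hE => dualWedgeNorm E hE
        (μ.norm (StrongDual ℝ E) (finrank_strongDual_eq E hE)) (μ.definite _ _))
      hmono E hE ε hε }

end DefinitionOfVolume

namespace DefinitionOfVolume

variable {V : Type u} [NormedAddCommGroup V] [NormedSpace ℝ V] [FiniteDimensional ℝ V]

/-- `μ_V (v₁ ∧ … ∧ vₖ)`, where `k = dim V`. (The value is `0` if `k ≠ dim V`.) -/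
def vol (μ : DefinitionOfVolume.{u}) {k : ℕ} (v : Fin k → V) : ℝ :=
  if h : finrank ℝ V = k then μ.norm V h (exteriorPower.ιMulti ℝ k v) else 0

/-- The Lebesgue measure on `V` defined by `μ`: the translation invariant measure which gives the
parallelepiped spanned by a basis `v₁, …, vₙ` the measure `μ_V (v₁ ∧ … ∧ vₙ)`. -/
def lebesgue (μ : DefinitionOfVolume.{u}) (V : Type u) [NormedAddCommGroup V] [NormedSpace ℝ V]
    [FiniteDimensional ℝ V] [MeasurableSpace V] [BorelSpace V] : Measure V :=
  ENNReal.ofReal (μ.vol (finBasis ℝ V)) • (finBasis ℝ V).addHaar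

open Classical in
/-- The induced `k`-density on `V`: `μ_k (v₁ ∧ … ∧ vₖ) = μ_W (v₁ ∧ … ∧ vₖ)` where `W` is the span
of `v₁, …, vₖ` with the induced norm if these vectors are linearly independent, and `0` if not. -/
def inducedDensity (μ : DefinitionOfVolume.{u}) {k : ℕ} (v : Fin k → V) : ℝ :=
  if LinearIndependent ℝ v then
    μ.vol (fun i => (⟨v i, Submodule.subset_span ⟨i, rfl⟩⟩ : Submodule.span ℝ (Set.range v)))
  else 0

/-- The quotient density at `p ≠ 0`: `μ_W` of the images of `v₁, …, vₖ` in `W = V/⟨p⟩`, where `W`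
carries the quotient norm and `k = dim V - 1`. -/
def quotientDensity (μ : DefinitionOfVolume.{u}) (p : V) {k : ℕ} (v : Fin k → V) : ℝ :=
  haveI : IsClosed ((Submodule.span ℝ {p} : Submodule ℝ V) : Set V) :=
    Submodule.closed_of_finiteDimensional _
  μ.vol (fun i => (Submodule.Quotient.mk (v i) : V ⧸ Submodule.span ℝ {p}))

/-- A definition of volume is convex if the induced `(n-1)`-density is a norm on `Λⁿ⁻¹ V` for every
`n`-dimensional normed space `V`. (Every `(n-1)`-vector in `V` is simple.) -/
def IsConvex (μ : DefinitionOfVolume.{u}) : Prop :=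
  ∀ (k : ℕ) (V : Type u) [NormedAddCommGroup V] [NormedSpace ℝ V] [FiniteDimensional ℝ V],
    finrank ℝ V = k + 1 → ∃ N : Seminorm ℝ (⋀[ℝ]^k V), (∀ a, N a = 0 → a = 0) ∧
      ∀ v : Fin k → V, N (exteriorPower.ιMulti ℝ k v) = μ.inducedDensity v

end DefinitionOfVolume

section Bodies

variable {V : Type u} [NormedAddCommGroup V] [NormedSpace ℝ V] [FiniteDimensional ℝ V]

/-! ### Star bodies -/

/-- The radial function `ρ_S (x) = max {t ≥ 0 : t x ∈ S}`, `x ≠ 0`. -/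
def radialFun (S : Set V) (x : V) : ℝ := sSup {t : ℝ | 0 ≤ t ∧ t • x ∈ S}

/-- Star bodies: compact sets, star-shaped with respect to the origin, with the origin in the
interior and with continuous radial function. -/
structure StarBody (V : Type u) [NormedAddCommGroup V] [NormedSpace ℝ V]
    [FiniteDimensional ℝ V] where
  /-- the underlying set -/
  carrier : Set V
  isCompact : IsCompact carrier
  starConvex : StarConvex ℝ 0 carrier
  zero_mem_interior : (0 : V) ∈ interior carrier
  continuousOn_radialFun : ContinuousOn (radialFun carrier) {0}ᶜ

/-- The unit sphere of Euclidean `n`-space, `n = dim V`. Through the fixed linear isomorphism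
`toEuclidean : V ≃L[ℝ] EuclideanSpace ℝ (Fin n)` it is a smooth hypersurface in `V`. -/
abbrev RefSphere (V : Type u) [NormedAddCommGroup V] [NormedSpace ℝ V] [FiniteDimensional ℝ V] :
    Type := Metric.sphere (0 : EuclideanSpace ℝ (Fin (finrank ℝ V))) 1

namespace StarBody

/-- A star body is smooth if its radial function is smooth away from the origin. -/
def IsSmooth (S : StarBody V) : Prop := ContDiffOn ℝ ∞ (radialFun S.carrier) {0}ᶜ

/-- The radial function restricted to a sphere. -/
def radialOnSphere (S : StarBody V) : C(RefSphere V, ℝ) where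
  toFun u := radialFun S.carrier (toEuclidean.symm (u : EuclideanSpace ℝ (Fin (finrank ℝ V))))
  continuous_toFun := by
    refine S.continuousOn_radialFun.comp_continuous (by fun_prop) fun u => ?_
    have hu : (u : EuclideanSpace ℝ (Fin (finrank ℝ V))) ≠ 0 :=
      ne_zero_of_mem_unit_sphere u
    simpa using hu

/-- The radial topology: uniform convergence of the radial functions on a sphere. -/
instance : TopologicalSpace (StarBody V) :=
  TopologicalSpace.induced radialOnSphere inferInstance

end StarBody

/-- The dual mixed volume `Ṽ(S₁, …, Sₙ) = (1/n) ∫_Σ ρ_{S₁} ⋯ ρ_{Sₙ} i_vΩ`, where `Ω` is a volume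
form with Lebesgue measure `lam`. The hypersurface `Σ` around the origin is the reference sphere,
on which `i_vΩ` induces the measure `A ↦ n · lam (cone over A)`. -/
def dualMixedVolume [MeasurableSpace V] [BorelSpace V] (lam : Measure V)
    (S : Fin (finrank ℝ V) → StarBody V) : ℝ :=
  (1 / (finrank ℝ V : ℝ)) *
    ∫ u : RefSphere V, ∏ i, radialFun (S i).carrier
        (toEuclidean.symm (u : EuclideanSpace ℝ (Fin (finrank ℝ V))))
      ∂(lam.map (toEuclidean : V ≃L[ℝ] EuclideanSpace ℝ (Fin (finrank ℝ V)))).toSphere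

/-- `Ṽ(S[n-1], T)`: the body `T` occurs once and `S` occurs `n - 1` times. -/
def dualMixedVolumeOne [MeasurableSpace V] [BorelSpace V] (lam : Measure V)
    (S T : StarBody V) : ℝ :=
  dualMixedVolume lam fun i => if (i : ℕ) = 0 then T else S

/-! ### Integration of densities over boundaries -/

/-- The radial parametrization of `∂K` by the reference sphere, extended to a map on
`EuclideanSpace ℝ (Fin n)` minus the origin that is constant on open half-lines. -/
def radialParam (K : Set V) (x : EuclideanSpace ℝ (Fin (finrank ℝ V))) : V :=
  radialFun K (toEuclidean.symm x) • (toEuclidean.symm x : V)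

/-- For a set `K` star-shaped about the origin, the integral over `∂K` of the `(n-1)`-density
which takes the value `D p w` on tangent vectors `w₁, …, wₙ₋₁` at `p`. It is computed in the radial
parametrization `φ` of `∂K` by the Euclidean unit sphere: the integrand at `u` is the value of the
density on `dφ_u e₁, …, dφ_u eₙ₋₁`, where the `eᵢ` are an orthonormal basis of the tangent space
`u^⊥` of the sphere, and the measure is the surface measure of the sphere. -/
def boundaryIntegral (D : V → ∀ {k : ℕ}, (Fin k → V) → ℝ) (K : Set V) : ℝ :=
  ∫ u : RefSphere V,
      D (radialParam K (u : EuclideanSpace ℝ (Fin (finrank ℝ V))))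
        (fun i => fderiv ℝ (radialParam K) (u : EuclideanSpace ℝ (Fin (finrank ℝ V)))
          (stdOrthonormalBasis ℝ
            (Submodule.span ℝ {(u : EuclideanSpace ℝ (Fin (finrank ℝ V)))})ᗮ i :
            EuclideanSpace ℝ (Fin (finrank ℝ V))))
    ∂(volume : Measure (EuclideanSpace ℝ (Fin (finrank ℝ V)))).toSphere

/-- The mixed volume `V(K[n-1], L) = (1/n) d/dε vol(K + εL)` at `ε = 0⁺` of compact convex sets,
with respect to the Lebesgue measure `lam`. -/
def mixedVolumeOne [MeasurableSpace V] (lam : Measure V) (K L : Set V) : ℝ :=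
  (1 / (finrank ℝ V : ℝ)) *
    derivWithin (fun ε : ℝ => lam.real (K + ε • L)) (Set.Ici 0) 0

/-- The polar body in `V` of a set in the dual space `V*`. -/
def polarOfDual (I : Set (StrongDual ℝ V)) : Set V := {x | ∀ ξ ∈ I, ξ x ≤ 1}

namespace DefinitionOfVolume

/-- The dual surface area of a smooth star body: the integral of the quotient density over the
boundary. -/
def smoothDualSurfaceArea (μ : DefinitionOfVolume.{u}) (S : StarBody V) : ℝ :=
  boundaryIntegral (fun p _ v => μ.quotientDensity p v) S.carrier

/-- The dual surface area of a star body: the extension by continuity, in the radial topology, of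
the dual surface area of smooth star bodies. -/
def dualSurfaceArea (μ : DefinitionOfVolume.{u}) (S : StarBody V) : ℝ :=
  extendFrom {S : StarBody V | S.IsSmooth} μ.smoothDualSurfaceArea S

open Classical in
/-- The surface area of a compact convex set with non-empty interior: the integral of the induced
`(n-1)`-density over the boundary. The boundary is parametrized radially from an interior point
(the result does not depend on this point); this parametrization is Lipschitz, hence differentiable
almost everywhere. -/
def surfaceArea (μ : DefinitionOfVolume.{u}) (K : Set V) : ℝ :=
  boundaryIntegral (fun _ _ v => μ.inducedDensity v)
    (-(if h : (interior K).Nonempty then h.some else 0) +ᵥ K)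

/-- `I` is the isoperimetrix of the normed space `V`: it is a centrally symmetric compact convex
body with `A_μ(K) = n V(K[n-1], I)` for all compact convex bodies `K`. -/
structure IsIsoperimetrix (μ : DefinitionOfVolume.{u}) [MeasurableSpace V] [BorelSpace V]
    (I : Set V) : Prop where
  nonempty : I.Nonempty
  isCompact : IsCompact I
  convex : Convex ℝ I
  symmetric : -I = I
  surfaceArea_eq : ∀ K : Set V, IsCompact K → Convex ℝ K → (interior K).Nonempty →
    μ.surfaceArea K = (finrank ℝ V : ℝ) * mixedVolumeOne (μ.lebesgue V) K I

end DefinitionOfVolume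

end Bodies

end

/-! For `p ≠ 0` two densities of degree `n - 1` vanish as soon as one argument is a multiple of `p`:
the quotient density `μ_{V/⟨p⟩}(v)` and `v ↦ μ_V(p ∧ v)`. Both come from the line `Λⁿ⁻¹(V/⟨p⟩)`, so
they differ by a factor `F(p) > 0` (`exists_quotientDensity_eq`). Since `F(tp) = |t|⁻¹ F(p)` and `F`
is continuous, `F` is the radial function of a star body `T`, the dual isoperimetrix.

In the radial parametrization `u ↦ ρ(u)u` of `∂S` the tangent vectors are `ρ e_i` plus multiples of
`u`, and the multiples die in the quotient. The integrand becomes `F ρⁿ⁻¹ μ_V(u ∧ e)`, that is, the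
integrand of `n Ṽ(S[n-1], T)` (`smoothDualSurfaceArea_eq`). This expression is continuous in the
radial topology, and smooth star bodies are dense, so it is the continuous extension. The maximum
property is the dual Minkowski inequality, derived by integrating a pointwise Young inequality
between two bodies of equal volume.

For the last part, `V/⟨x⟩` is isometric to the dual of the annihilator `x^⊥ ⊂ V*`. Hence for `ξ` in
`x^⊥` the density `μ*_{n-1}(ξ)` times `|ξ₀(x)| F(x)` is `μ*(ξ₀ ∧ ξ)` (`dual_inducedDensity_eq`):
under `Λⁿ⁻¹V* ≅ V` the density `μ*_{n-1}` becomes `G = 1/F` up to a constant. Convexity of `μ*`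
makes `G` a norm, with unit ball `T`. Let `I ⊂ V*` be the polar of `T`; its support function is `G`.

For a convex body `K ⊂ V*` with gauge `g`, both the surface area and the first variation of the
volume of `K + εI` equal `∫ g⁻ⁿ G(dg)` over the sphere, so `I` is an isoperimetrix. It is the only
one because mixed volumes with thin parallelepipeds determine the support function of a symmetric
body. The bipolar theorem, in the form of Hahn–Banach for `G`, gives `T = I°`. -/

noncomputable section

/-! ### Volumes as determinants, and the two densities at a point -/

section Algebra

/-- An alternating map is determined by its values on injective families of basis vectors. In top
degree these are permutations of the basis, where both sides produce the sign. -/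
theorem ιMulti_eq_det_smul {n : ℕ} {E : Type u} [AddCommGroup E] [Module ℝ E]
    (b : Basis (Fin n) ℝ E) (v : Fin n → E) :
    exteriorPower.ιMulti ℝ n v = b.det v • exteriorPower.ιMulti ℝ n b := by
  have h : exteriorPower.ιMulti ℝ n =
      (LinearMap.toSpanSingleton ℝ (⋀[ℝ]^n E) (exteriorPower.ιMulti ℝ n b)).compAlternatingMap
        b.det := by
    refine Basis.ext_alternating b fun i hi => ?_
    have hbij : Function.Bijective i := Finite.injective_iff_bijective.mp hi
    let σ : Equiv.Perm (Fin n) := Equiv.ofBijective i hbij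
    change exteriorPower.ιMulti ℝ n (fun j => b (σ j)) =
      b.det (fun j => b (σ j)) • exteriorPower.ιMulti ℝ n b
    have h1 := (exteriorPower.ιMulti ℝ n).map_perm b σ
    have h2 := b.det.map_perm b σ
    rw [Function.comp_def] at h1 h2
    rw [h1, h2, b.det_self]
    rw [Units.smul_def, Units.smul_def, zsmul_one]
    exact (Int.cast_smul_eq_zsmul ℝ _ _).symm
  exact congrArg (fun f => f v) h

namespace DefinitionOfVolume

variable (μ : DefinitionOfVolume.{u}) {V W : Type u}
  [NormedAddCommGroup V] [NormedSpace ℝ V] [FiniteDimensional ℝ V]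
  [NormedAddCommGroup W] [NormedSpace ℝ W] [FiniteDimensional ℝ W] {k : ℕ}

theorem vol_nonneg (v : Fin k → V) : 0 ≤ μ.vol v := by
  unfold vol
  split_ifs
  · exact apply_nonneg _ _
  · exact le_rfl

theorem vol_eq_det (b : Basis (Fin k) ℝ V) (v : Fin k → V) :
    μ.vol v = |b.det v| * μ.vol b := by
  have h : finrank ℝ V = k := by simpa using finrank_eq_card_basis b
  unfold vol
  rw [dif_pos h, dif_pos h, ιMulti_eq_det_smul b v, map_smul_eq_mul, Real.norm_eq_abs]

theorem vol_basis_pos (b : Basis (Fin k) ℝ V) : 0 < μ.vol b := by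
  have h : finrank ℝ V = k := by simpa using finrank_eq_card_basis b
  refine lt_of_le_of_ne (μ.vol_nonneg _) fun h0 => ?_
  unfold vol at h0
  rw [dif_pos h] at h0
  have h1 := μ.definite V h _ h0.symm
  have h2 : ∀ a : ⋀[ℝ]^k V, a = 0 := by
    have hs := exteriorPower.ιMulti_span ℝ k V
    intro a
    have ha : a ∈ Submodule.span ℝ (Set.range (exteriorPower.ιMulti ℝ k (M := V))) := by
      rw [hs]; trivial
    have : Set.range (exteriorPower.ιMulti ℝ k (M := V)) ⊆ {0} := by
      rintro _ ⟨v, rfl⟩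
      rw [ιMulti_eq_det_smul b v, h1, smul_zero]; rfl
    simpa using Submodule.span_mono this ha
  have h3 := finrank_exteriorPower_top V h
  have h4 : Subsingleton (⋀[ℝ]^k V) := ⟨fun a a' => (h2 a).trans (h2 a').symm⟩
  rw [finrank_zero_of_subsingleton] at h3
  exact zero_ne_one h3

theorem vol_comp_le {C : ℝ} (hC : 0 ≤ C) (hV : finrank ℝ V = k) (hW : finrank ℝ W = k)
    (f : V →ₗ[ℝ] W) (hf : ∀ x, ‖f x‖ ≤ C * ‖x‖) (v : Fin k → V) :
    μ.vol (fun i => f (v i)) ≤ C ^ k * μ.vol v := by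
  -- Monotonicity is applied to `C'⁻¹ • f`. As `C` may vanish, larger constants are used and then
  -- tend to `C`.
  have key : ∀ C' : ℝ, 0 < C' → C ≤ C' → μ.vol (fun i => f (v i)) ≤ C' ^ k * μ.vol v := by
    intro C' hC' hCC'
    have h1 := μ.mono V W hV hW (C'⁻¹ • f) (fun x => by
      rw [LinearMap.smul_apply, norm_smul, Real.norm_of_nonneg (inv_nonneg.2 hC'.le),
        inv_mul_le_iff₀ hC']
      exact (hf x).trans (by gcongr)) (exteriorPower.ιMulti ℝ k v)
    rw [exteriorPower_map_smul, map_smul_eq_mul, Real.norm_of_nonneg (by positivity),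
      inv_pow, inv_mul_le_iff₀ (by positivity), exteriorPower.map_apply_ιMulti] at h1
    unfold vol
    rw [dif_pos hV, dif_pos hW]
    exact h1
  have hc : Tendsto (fun C' : ℝ => C' ^ k * μ.vol v) (𝓝[>] C) (𝓝 (C ^ k * μ.vol v)) :=
    ((by fun_prop : Continuous fun C' : ℝ => C' ^ k * μ.vol v).tendsto C).mono_left
      nhdsWithin_le_nhds
  refine ge_of_tendsto hc ?_
  filter_upwards [self_mem_nhdsWithin] with C' hC'
  exact key C' (lt_of_le_of_lt hC hC') (le_of_lt hC')

/-- Volumes are invariant under isometries. -/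
theorem vol_comp_isometry (f : V →ₗ[ℝ] W) (hf : ∀ x, ‖f x‖ = ‖x‖)
    (hVW : finrank ℝ V = finrank ℝ W) (v : Fin k → V) :
    μ.vol (fun i => f (v i)) = μ.vol v := by
  by_cases hV : finrank ℝ V = k
  · have hW : finrank ℝ W = k := hVW.symm.trans hV
    have hinj : Function.Injective f := by
      rw [injective_iff_map_eq_zero]
      intro x hx
      rw [← norm_eq_zero, ← hf, hx, norm_zero]
    let e : V ≃ₗ[ℝ] W := LinearEquiv.ofInjectiveOfFinrankEq f hinj hVW
    have he : ∀ x, e x = f x := fun x => rfl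
    refine le_antisymm ?_ ?_
    · simpa using μ.vol_comp_le zero_le_one hV hW f (fun x => by rw [hf, one_mul]) v
    · have := μ.vol_comp_le zero_le_one hW hV (e.symm : W →ₗ[ℝ] V)
        (fun x => by
          have := hf (e.symm x)
          rw [← he, e.apply_symm_apply] at this
          rw [one_mul, this]; rfl) (fun i => f (v i))
      have h2 : (fun i => (e.symm : W →ₗ[ℝ] V) (f (v i))) = v := by
        ext i
        exact e.symm_apply_apply (v i)
      rw [h2] at this
      simpa using this
  · unfold vol
    rw [dif_neg hV, dif_neg (hVW ▸ hV)]

theorem vol_eq_zero_of_not_linearIndependent {v : Fin k → V} (hv : ¬ LinearIndependent ℝ v) :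
    μ.vol v = 0 := by
  unfold vol
  split_ifs with h
  · rw [(exteriorPower.ιMulti ℝ k).map_linearDependent v hv, map_zero]
  · rfl

theorem vol_pos {v : Fin k → V} (hV : finrank ℝ V = k) (hv : LinearIndependent ℝ v) :
    0 < μ.vol v := by
  rcases k.eq_zero_or_pos with rfl | hk
  · have b : Basis (Fin 0) ℝ V := (finBasis ℝ V).reindex (finCongr hV)
    have : v = b := Subsingleton.elim _ _
    rw [this]
    exact μ.vol_basis_pos b
  · have : Nonempty (Fin k) := ⟨⟨0, hk⟩⟩
    have := μ.vol_basis_pos (basisOfLinearIndependentOfCardEqFinrank hv (by simp [hV]))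
    rwa [coe_basisOfLinearIndependentOfCardEqFinrank] at this

/-- A change of basis multiplies the volume of the basis by the modulus of a determinant and divides
the normalized Haar measure by the same number. -/
theorem lebesgue_eq [MeasurableSpace V] [BorelSpace V] (b : Basis (Fin k) ℝ V) :
    μ.lebesgue V = ENNReal.ofReal (μ.vol b) • b.addHaar := by
  have h : finrank ℝ V = k := by simpa using finrank_eq_card_basis b
  subst h
  have h1 := Measure.addHaarMeasure_unique (finBasis ℝ V).addHaar b.parallelepiped
  rw [← Basis.addHaar, Basis.coe_parallelepiped, Measure.addHaar_parallelepiped] at h1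
  have h2 := μ.vol_eq_det (finBasis ℝ V) b
  rw [lebesgue, h1, h2, smul_smul, mul_comm, ENNReal.ofReal_mul (abs_nonneg _)]

instance [MeasurableSpace V] [BorelSpace V] : (μ.lebesgue V).IsAddHaarMeasure := by
  unfold lebesgue
  exact Measure.IsAddHaarMeasure.smul _ (by simpa using μ.vol_basis_pos _) ENNReal.ofReal_ne_top

instance isClosed_span_singleton (p : V) :
    IsClosed ((Submodule.span ℝ {p} : Submodule ℝ V) : Set V) :=
  Submodule.closed_of_finiteDimensional _

theorem finrank_quotient_span_singleton (hV : finrank ℝ V = k + 1) {p : V} (hp : p ≠ 0) :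
    finrank ℝ (V ⧸ Submodule.span ℝ {p}) = k := by
  have := (Submodule.span ℝ {p}).finrank_quotient_add_finrank
  rw [finrank_span_singleton hp, hV] at this
  omega

omit [FiniteDimensional ℝ V] [FiniteDimensional ℝ W] in
theorem norm_mapQ_le {C : ℝ} (hC : 0 ≤ C) (p : Submodule ℝ V) (q : Submodule ℝ W)
    [IsClosed (p : Set V)] [IsClosed (q : Set W)] (f : V →ₗ[ℝ] W)
    (h : p ≤ q.comap f) (hf : ∀ x, ‖f x‖ ≤ C * ‖x‖) (x : V ⧸ p) :
    ‖p.mapQ q f h x‖ ≤ C * ‖x‖ := by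
  refine le_of_forall_pos_le_add fun ε hε => ?_
  -- A nearly optimal representative; `C + 1` instead of `C` avoids division by zero.
  obtain ⟨y, rfl, hy⟩ := Submodule.Quotient.norm_mk_lt x
    (show 0 < ε / (C + 1) by positivity)
  rw [Submodule.mapQ_apply]
  calc ‖(Submodule.Quotient.mk (f y) : W ⧸ q)‖ ≤ ‖f y‖ := Submodule.Quotient.norm_mk_le _ _
    _ ≤ C * ‖y‖ := hf y
    _ ≤ C * (‖(Submodule.Quotient.mk y : V ⧸ p)‖ + ε / (C + 1)) := by gcongr
    _ ≤ C * ‖(Submodule.Quotient.mk y : V ⧸ p)‖ + ε := by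
      rw [mul_add]
      gcongr
      rw [mul_div_assoc', div_le_iff₀ (by positivity)]
      nlinarith

/-- The map descends to `V/⟨p⟩ → V/⟨p'⟩` with the same norm bound, so monotonicity of `μ` applies.
Homogeneity and continuity of the dual radial function both rest on this estimate. -/
theorem quotientDensity_comp_le {C : ℝ} (hC : 0 ≤ C) (hV : finrank ℝ V = k + 1)
    {p p' : V} (hp : p ≠ 0) (hp' : p' ≠ 0) (f : V →ₗ[ℝ] V)
    (hfp : f p ∈ Submodule.span ℝ {p'}) (hf : ∀ x, ‖f x‖ ≤ C * ‖x‖) (v : Fin k → V) :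
    μ.quotientDensity p' (fun i => f (v i)) ≤ C ^ k * μ.quotientDensity p v := by
  have hle : Submodule.span ℝ {p} ≤ (Submodule.span ℝ {p'}).comap f := by
    rw [Submodule.span_singleton_le_iff_mem]
    exact hfp
  exact μ.vol_comp_le hC (finrank_quotient_span_singleton hV hp)
    (finrank_quotient_span_singleton hV hp')
    ((Submodule.span ℝ {p}).mapQ (Submodule.span ℝ {p'}) f hle)
    (norm_mapQ_le hC _ _ f hle hf) (fun i => Submodule.Quotient.mk (v i))

omit [FiniteDimensional ℝ V] in
theorem linearIndependent_cons_of_quotient {p : V} (hp : p ≠ 0) {v : Fin k → V}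
    (hv : LinearIndependent ℝ
      (fun i => (Submodule.Quotient.mk (v i) : V ⧸ Submodule.span ℝ {p}))) :
    LinearIndependent ℝ (Fin.cons p v : Fin (k + 1) → V) := by
  refine linearIndependent_finCons.2
    ⟨LinearIndependent.of_comp (Submodule.mkQ (Submodule.span ℝ {p})) hv, fun hmem => ?_⟩
  obtain ⟨a, ha⟩ := (Submodule.mem_span_range_iff_exists_fun ℝ).1 hmem
  have h1 : ∑ i, a i • (Submodule.Quotient.mk (v i) : V ⧸ Submodule.span ℝ {p}) = 0 := by
    have := congrArg (Submodule.mkQ (Submodule.span ℝ {p})) ha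
    rw [map_sum] at this
    simp only [map_smul, Submodule.mkQ_apply] at this
    rw [this, Submodule.Quotient.mk_eq_zero]
    exact Submodule.mem_span_singleton_self p
  have h2 := Fintype.linearIndependent_iff.1 hv a h1
  apply hp
  rw [← ha]
  simp [h2]

/-- Lifts of a basis of the quotient, together with `p`, are linearly independent and have the right
number. -/
theorem exists_basis_cons (hV : finrank ℝ V = k + 1) {p : V} (hp : p ≠ 0) :
    ∃ (v : Fin k → V) (b : Basis (Fin (k + 1)) ℝ V) (c : Basis (Fin k) ℝ (V ⧸ Submodule.span ℝ {p})),
      ⇑b = Fin.cons p v ∧ ∀ i, c i = Submodule.Quotient.mk (v i) := by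
  let c : Basis (Fin k) ℝ (V ⧸ Submodule.span ℝ {p}) :=
    (finBasis ℝ _).reindex (finCongr (finrank_quotient_span_singleton hV hp))
  choose v hv using fun i => Submodule.Quotient.mk_surjective _ (c i)
  have hli : LinearIndependent ℝ (Fin.cons p v : Fin (k + 1) → V) := by
    refine linearIndependent_cons_of_quotient hp ?_
    rw [funext hv]
    exact c.linearIndependent
  refine ⟨v, basisOfLinearIndependentOfCardEqFinrank hli (by simp [hV]), c, ?_, fun i => (hv i).symm⟩
  simp

/-- The ratio of the quotient density at `p` and the density `v ↦ μ (p ∧ v)`. -/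
theorem exists_quotientDensity_eq (hV : finrank ℝ V = k + 1) {p : V} (hp : p ≠ 0) :
    ∃ F : ℝ, 0 < F ∧ ∀ v : Fin k → V,
      μ.quotientDensity p v = F * μ.vol (Fin.cons p v : Fin (k + 1) → V) := by
  obtain ⟨w, b, c, hb, hc⟩ := exists_basis_cons hV hp
  -- Both sides are alternating `k`-forms, compared on injective families from `b`. If `p = b 0`
  -- occurs, both vanish; otherwise the family is a permutation of the lifts and both give its sign.
  have key : b.det.curryLeft p = c.det.compLinearMap (Submodule.mkQ (Submodule.span ℝ {p})) := by
    refine Basis.ext_alternating b fun i hi => ?_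
    rw [AlternatingMap.curryLeft_apply_apply, AlternatingMap.compLinearMap_apply]
    by_cases h0 : ∃ j, i j = 0
    · obtain ⟨j, hj⟩ := h0
      have hbj : b (i j) = p := by rw [hj, hb]; rfl
      rw [b.det.map_eq_zero_of_eq _ (i := 0) (j := j.succ)
        (by simp [hbj]) (Fin.succ_ne_zero j).symm]
      symm
      refine c.det.map_coord_zero j ?_
      rw [hbj, Submodule.mkQ_apply, Submodule.Quotient.mk_eq_zero]
      exact Submodule.mem_span_singleton_self p
    · push Not at h0
      choose s hs using fun j => Fin.exists_succ_eq.2 (h0 j)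
      have hsinj : Function.Injective s := fun a a' haa => hi (by rw [← hs, ← hs, haa])
      let σ : Equiv.Perm (Fin k) :=
        Equiv.ofBijective s (Finite.injective_iff_bijective.mp hsinj)
      have h1 : (fun j => b (i j)) = fun j => w (σ j) := by
        ext j
        rw [← hs, hb]
        rfl
      have h2 : (fun j => Submodule.mkQ (Submodule.span ℝ {p}) (b (i j))) = c ∘ σ := by
        ext j
        have := congrFun h1 j
        rw [this]
        exact (hc _).symm
      have h3 : (b.det.curryLeft p) w = 1 := by
        rw [AlternatingMap.curryLeft_apply_apply, ← b.det_self, hb]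
        rfl
      have h4 := (b.det.curryLeft p).map_perm w σ
      rw [h3] at h4
      rw [h2, c.det.map_perm, c.det_self, ← h4, AlternatingMap.curryLeft_apply_apply, h1]
      rfl
  refine ⟨μ.vol c / μ.vol b, div_pos (μ.vol_basis_pos c) (μ.vol_basis_pos b), fun v => ?_⟩
  have h1 : μ.quotientDensity p v =
      μ.vol (fun i => (Submodule.Quotient.mk (v i) : V ⧸ Submodule.span ℝ {p})) := rfl
  have h2 : c.det (fun i => (Submodule.Quotient.mk (v i) : V ⧸ Submodule.span ℝ {p})) =
      b.det (Fin.cons p v : Fin (k + 1) → V) :=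
    (congrArg (fun f => f v) key).symm
  rw [h1, μ.vol_eq_det c, h2, μ.vol_eq_det b (Fin.cons p v)]
  have := (μ.vol_basis_pos b).ne'
  field_simp

end DefinitionOfVolume
end Algebra

namespace DefinitionOfVolume

/-! ### The radial function of the dual isoperimetrix -/

section DualRadial

variable (μ : DefinitionOfVolume.{u}) {V : Type u}
  [NormedAddCommGroup V] [NormedSpace ℝ V] [FiniteDimensional ℝ V] {k : ℕ}

theorem vol_comp (hV : finrank ℝ V = k) (f : V →ₗ[ℝ] V) (v : Fin k → V) :
    μ.vol (fun i => f (v i)) = |LinearMap.det f| * μ.vol v := by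
  let b : Basis (Fin k) ℝ V := (finBasis ℝ V).reindex (finCongr hV)
  have h := b.det_comp f v
  rw [Function.comp_def] at h
  rw [μ.vol_eq_det b, h, abs_mul, mul_assoc, ← μ.vol_eq_det b]

theorem vol_update_smul (v : Fin k → V) (i : Fin k) (t : ℝ) (x : V) :
    μ.vol (Function.update v i (t • x)) = |t| * μ.vol (Function.update v i x) := by
  unfold vol
  split_ifs
  · rw [AlternatingMap.map_update_smul, map_smul_eq_mul, Real.norm_eq_abs]
  · simp

theorem vol_cons_smul (t : ℝ) (p : V) (v : Fin k → V) :
    μ.vol (Fin.cons (t • p) v : Fin (k + 1) → V) =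
      |t| * μ.vol (Fin.cons p v : Fin (k + 1) → V) := by
  have := μ.vol_update_smul (Fin.cons p v : Fin (k + 1) → V) 0 t p
  rwa [Fin.update_cons_zero, Fin.update_cons_zero] at this

/-- The radial function of the dual isoperimetrix: the ratio of the quotient density at `p` and
the density `v ↦ μ (p ∧ v)`. -/
def dualRadial (hV : finrank ℝ V = k + 1) (p : V) : ℝ :=
  -- With the value `0` at the origin, the inverse, which serves as a gauge, also vanishes there.
  open Classical in if hp : p ≠ 0 then (μ.exists_quotientDensity_eq hV hp).choose else 0

variable (hV : finrank ℝ V = k + 1)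

theorem dualRadial_zero : μ.dualRadial hV 0 = 0 := by simp [dualRadial]

theorem dualRadial_pos {p : V} (hp : p ≠ 0) : 0 < μ.dualRadial hV p := by
  rw [dualRadial, dif_pos hp]
  exact (μ.exists_quotientDensity_eq hV hp).choose_spec.1

theorem quotientDensity_eq {p : V} (hp : p ≠ 0) (v : Fin k → V) :
    μ.quotientDensity p v = μ.dualRadial hV p * μ.vol (Fin.cons p v : Fin (k + 1) → V) := by
  rw [dualRadial, dif_pos hp]
  exact (μ.exists_quotientDensity_eq hV hp).choose_spec.2 v

include hV in
theorem exists_vol_cons_pos {p : V} (hp : p ≠ 0) :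
    ∃ v : Fin k → V, 0 < μ.vol (Fin.cons p v : Fin (k + 1) → V) := by
  obtain ⟨v, b, -, hb, -⟩ := exists_basis_cons hV hp
  exact ⟨v, hb ▸ μ.vol_basis_pos b⟩

/-- Applying `f` multiplies `μ(p ∧ v)` by `|det f|` and the quotient density by at most `C ^ k`; a
`v` with `μ(p ∧ v) > 0` can be cancelled. -/
theorem dualRadial_mul_det_le {C : ℝ} (hC : 0 ≤ C) {p p' : V} (hp : p ≠ 0) (hp' : p' ≠ 0)
    (f : V →ₗ[ℝ] V) (hfp : f p = p') (hf : ∀ x, ‖f x‖ ≤ C * ‖x‖) :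
    μ.dualRadial hV p' * |LinearMap.det f| ≤ C ^ k * μ.dualRadial hV p := by
  obtain ⟨v, hv⟩ := μ.exists_vol_cons_pos hV hp
  have h1 := μ.quotientDensity_comp_le hC hV hp hp' f
    (hfp ▸ Submodule.mem_span_singleton_self _) hf v
  have h2 : (Fin.cons p' (fun i => f (v i)) : Fin (k + 1) → V) =
      fun i => f ((Fin.cons p v : Fin (k + 1) → V) i) := by
    ext i
    refine Fin.cases ?_ (fun j => ?_) i
    · simp [hfp]
    · simp
  rw [μ.quotientDensity_eq hV hp, μ.quotientDensity_eq hV hp', h2, μ.vol_comp hV,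
    ← mul_assoc, ← mul_assoc] at h1
  exact le_of_mul_le_mul_right h1 hv

/-- The quotient density depends only on the line through `p`, whereas `μ(p ∧ v)` is homogeneous of
degree one in `p`. -/
theorem dualRadial_smul {t : ℝ} (ht : t ≠ 0) (p : V) :
    μ.dualRadial hV (t • p) = |t|⁻¹ * μ.dualRadial hV p := by
  rcases eq_or_ne p 0 with rfl | hp
  · simp [dualRadial_zero]
  have htp : t • p ≠ 0 := smul_ne_zero ht hp
  obtain ⟨v, hv⟩ := μ.exists_vol_cons_pos hV hp
  have h1 := μ.quotientDensity_comp_le zero_le_one hV hp htp LinearMap.id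
    (Submodule.mem_span_singleton.2 ⟨t⁻¹, by simp [ht]⟩) (fun x => by simp) v
  have h2 := μ.quotientDensity_comp_le zero_le_one hV htp hp LinearMap.id
    (Submodule.mem_span_singleton.2 ⟨t, by simp⟩) (fun x => by simp) v
  have h3 : μ.quotientDensity (t • p) v = μ.quotientDensity p v :=
    le_antisymm (by simpa using h1) (by simpa using h2)
  rw [μ.quotientDensity_eq hV hp, μ.quotientDensity_eq hV htp, μ.vol_cons_smul, ← mul_assoc] at h3
  have h4 := mul_right_cancel₀ hv.ne' h3
  have : |t| ≠ 0 := abs_ne_zero.2 ht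
  field_simp
  exact h4

omit [FiniteDimensional ℝ V] in
theorem norm_transvection_le (ξ : StrongDual ℝ V) (w x : V) :
    ‖LinearMap.transvection (ξ : V →ₗ[ℝ] ℝ) w x‖ ≤ (1 + ‖ξ‖ * ‖w‖) * ‖x‖ := by
  rw [LinearMap.transvection.apply]
  calc _ ≤ ‖x‖ + ‖ξ x • w‖ := norm_add_le _ _
    _ ≤ ‖x‖ + ‖ξ‖ * ‖x‖ * ‖w‖ := by
      rw [norm_smul]
      gcongr
      exact ξ.le_opNorm x
    _ = _ := by ring

/-- If `ξ p = 1`, the transvection `x ↦ x + ξ(x)(q - p)` carries `p` to `q`, has norm at most `1 +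
‖ξ‖‖q - p‖` and determinant `ξ q`. It and a transvection back from `q` to `p` squeeze the value at
`q` between bounds that tend to the value at `p`. -/
theorem continuousAt_dualRadial {p : V} (hp : p ≠ 0) :
    ContinuousAt (μ.dualRadial hV) p := by
  obtain ⟨ξ, hξ⟩ := SeparatingDual.exists_eq_one (R := ℝ) hp
  have hne : ∀ᶠ q in 𝓝 p, 0 < ξ q :=
    ξ.continuous.continuousAt.eventually (lt_mem_nhds (by rw [hξ]; exact one_pos))
  have hne0 : ∀ᶠ q in 𝓝 p, q ≠ 0 := isOpen_ne.mem_nhds hp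
  have hF := μ.dualRadial_pos hV hp
  have hup : ∀ᶠ q in 𝓝 p, μ.dualRadial hV q ≤
      (1 + ‖ξ‖ * ‖q - p‖) ^ k * μ.dualRadial hV p / ξ q := by
    filter_upwards [hne, hne0] with q hq hq0
    have := μ.dualRadial_mul_det_le hV (C := 1 + ‖ξ‖ * ‖q - p‖) (by positivity) hp hq0
      (LinearMap.transvection (ξ : V →ₗ[ℝ] ℝ) (q - p))
      (by simp [LinearMap.transvection.apply, hξ]) (norm_transvection_le ξ _)
    rw [LinearMap.transvection.det] at this
    simp only [ContinuousLinearMap.coe_coe, map_sub, hξ, add_sub_cancel] at this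
    rw [le_div_iff₀ hq]
    rwa [abs_of_pos hq] at this
  -- The transvection from `q` to `p` uses `ξ / ξ(q)`, which is `1` at `q`; its determinant is `(ξ
  -- q)⁻¹`.
  have hlow : ∀ᶠ q in 𝓝 p, μ.dualRadial hV p * (ξ q)⁻¹ /
      (1 + ‖(ξ q)⁻¹ • ξ‖ * ‖p - q‖) ^ k ≤ μ.dualRadial hV q := by
    filter_upwards [hne, hne0] with q hq hq0
    have := μ.dualRadial_mul_det_le hV (C := 1 + ‖(ξ q)⁻¹ • ξ‖ * ‖p - q‖) (by positivity) hq0 hp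
      (LinearMap.transvection (((ξ q)⁻¹ • ξ : StrongDual ℝ V) : V →ₗ[ℝ] ℝ) (p - q))
      (by simp [LinearMap.transvection.apply, hq.ne']) (norm_transvection_le _ _)
    rw [LinearMap.transvection.det] at this
    have h2 : 1 + (((ξ q)⁻¹ • ξ : StrongDual ℝ V) : V →ₗ[ℝ] ℝ) (p - q) = (ξ q)⁻¹ := by
      simp only [ContinuousLinearMap.coe_coe, smul_apply, map_sub, hξ,
        smul_eq_mul]
      field_simp
      ring
    rw [h2, abs_of_pos (inv_pos.2 hq)] at this
    rw [div_le_iff₀ (by positivity), mul_comm (μ.dualRadial hV q)]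
    exact this
  refine tendsto_of_tendsto_of_tendsto_of_le_of_le' ?_ ?_ hlow hup
  · have : ContinuousAt (fun q => μ.dualRadial hV p * (ξ q)⁻¹ /
      (1 + ‖(ξ q)⁻¹ • ξ‖ * ‖p - q‖) ^ k) p := by
      refine ContinuousAt.div ?_ ?_ (by positivity)
      · exact continuousAt_const.mul (ξ.continuous.continuousAt.inv₀ (by simp [hξ]))
      · have : ContinuousAt (fun q => (ξ q)⁻¹) p :=
          ξ.continuous.continuousAt.inv₀ (by simp [hξ])
        fun_prop
    simpa [ContinuousAt, hξ] using this
  · have : ContinuousAt (fun q => (1 + ‖ξ‖ * ‖q - p‖) ^ k * μ.dualRadial hV p / ξ q) p := by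
      refine ContinuousAt.div (by fun_prop) ξ.continuous.continuousAt (by simp [hξ])
    simpa [ContinuousAt, hξ] using this

end DualRadial

/-! ### Duality between quotients of `V` and annihilators in `V*` -/

section Duality

variable (μ : DefinitionOfVolume.{u}) {V : Type u}
  [NormedAddCommGroup V] [NormedSpace ℝ V] [FiniteDimensional ℝ V] {k : ℕ}

/-- The dual volume computed from a family of linear functionals. -/
theorem dual_vol_eq (hV : finrank ℝ V = k) (v : Fin k → V) (ξ : Fin k → StrongDual ℝ V)
    (hξ : μ.vol ξ ≠ 0) :
    μ.dual.vol v = |Matrix.det (Matrix.of fun i j => ξ j (v i))| / μ.vol ξ := by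
  have hD := finrank_strongDual_eq V hV
  obtain ⟨b₀, hb₀, hsp, hlub⟩ := exists_unit_wedge V hV (μ.norm (StrongDual ℝ V) hD)
    (μ.definite _ _)
  -- On the line `Λᵏ V*` the wedge of the `ξ i` is a multiple of the unit vector that computes the
  -- dual norm; the factor has modulus `μ.vol ξ`.
  obtain ⟨c, hc⟩ := hsp (exteriorPower.ιMulti ℝ k ξ)
  have h1 : μ.vol ξ = |c| := by
    rw [vol, dif_pos hD, hc, map_smul_eq_mul, hb₀, mul_one, Real.norm_eq_abs]
  have h2 : μ.dual.vol v = |wedgePairing k V b₀ (exteriorPower.ιMulti ℝ k v)| := by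
    rw [vol, dif_pos hV]
    exact dualWedgeNorm_eq V hV (μ.norm (StrongDual ℝ V) hD) (μ.definite _ _) b₀ _ (hlub _)
  rw [h1] at hξ ⊢
  rw [h2, eq_div_iff hξ, ← wedgePairing_ιMulti, hc, map_smul, LinearMap.smul_apply, smul_eq_mul,
    abs_mul, mul_comm]

/-- The quotient `V/⟨x⟩` is isometric to the dual of the annihilator of `x`. -/
theorem exists_quotient_isometry (hV : finrank ℝ V = k + 1) {x : V} (hx : x ≠ 0)
    {W : Type u} [NormedAddCommGroup W] [NormedSpace ℝ W] (hW : finrank ℝ W = k)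
    (e : W →ₗᵢ[ℝ] StrongDual ℝ V) (hWx : ∀ ξ, e ξ x = 0) :
    ∃ f : (V ⧸ Submodule.span ℝ {x}) →ₗ[ℝ] StrongDual ℝ W,
      (∀ z, ‖f z‖ = ‖z‖) ∧ ∀ (y : V) (ξ : W), f (Submodule.Quotient.mk y) ξ = e ξ y := by
  let L : V →ₗ[ℝ] StrongDual ℝ W :=
    { toFun := fun y => (NormedSpace.inclusionInDoubleDual ℝ V y).comp e.toContinuousLinearMap
      map_add' := fun y z => by ext; simp
      map_smul' := fun c y => by ext; simp }
  have hL : ∀ (y : V) (ξ : W), L y ξ = e ξ y := fun y ξ => rfl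
  have hker : Submodule.span ℝ {x} ≤ LinearMap.ker L := by
    rw [Submodule.span_singleton_le_iff_mem, LinearMap.mem_ker]
    ext ξ
    exact hWx ξ
  have hLn : ∀ y, ‖L y‖ ≤ ‖y‖ := fun y =>
    ContinuousLinearMap.opNorm_le_bound _ (norm_nonneg _) fun ξ => by
      rw [hL, mul_comm, ← e.norm_map ξ]
      exact (e ξ).le_opNorm y
  let ev : StrongDual ℝ V →ₗ[ℝ] ℝ := (NormedSpace.inclusionInDoubleDual ℝ V x : _ →L[ℝ] ℝ)
  have hev : ∀ ξ, ev ξ = ξ x := fun ξ => rfl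
  -- By dimension count, the image of `e` is the whole annihilator of `x`.
  have hWmem : ∀ ξ : StrongDual ℝ V, ξ x = 0 → ξ ∈ LinearMap.range e.toLinearMap := by
    have hle : LinearMap.range e.toLinearMap ≤ LinearMap.ker ev := by
      rintro _ ⟨ξ, rfl⟩
      exact hWx ξ
    have hsurj : LinearMap.range ev = ⊤ := by
      rw [LinearMap.range_eq_top]
      refine LinearMap.surjective_of_ne_zero fun h0 => ?_
      obtain ⟨ξ, hξ⟩ := SeparatingDual.exists_eq_one (R := ℝ) hx
      have := hev ξ
      rw [h0, hξ] at this
      exact zero_ne_one this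
    have h1 := LinearMap.finrank_range_add_finrank_ker ev
    rw [hsurj, finrank_top, finrank_self, finrank_strongDual_eq V hV] at h1
    have h2 := LinearMap.finrank_range_of_inj e.injective
    have := Submodule.eq_of_le_of_finrank_eq hle (by rw [h2]; omega)
    intro ξ hξ
    rw [this]
    exact hξ
  refine ⟨(Submodule.span ℝ {x}).liftQ L hker, fun z => le_antisymm ?_ ?_, fun y ξ => rfl⟩
  · refine le_of_forall_pos_le_add fun ε hε => ?_
    obtain ⟨y, rfl, hy⟩ := Submodule.Quotient.norm_mk_lt z hε
    exact (hLn y).trans hy.le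
  -- A norming functional of `z` pulls back to a functional on `V` of norm at most `1` that kills
  -- `x`. It therefore comes from `W`, where it witnesses the lower bound for `‖f z‖`.
  · obtain ⟨g, hg, hgz⟩ := exists_dual_vector'' ℝ z
    obtain ⟨y, rfl⟩ := Submodule.Quotient.mk_surjective _ z
    let ζ : StrongDual ℝ V := LinearMap.mkContinuous
      ((g : _ →ₗ[ℝ] ℝ) ∘ₗ Submodule.mkQ (Submodule.span ℝ {x})) 1 (fun v => by
        have h1 := g.le_opNorm (Submodule.Quotient.mk v)
        have h2 := Submodule.Quotient.norm_mk_le (Submodule.span ℝ {x}) v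
        have h3 := mul_le_mul hg h2 (norm_nonneg _) zero_le_one
        exact h1.trans h3)
    have hζ : ∀ v, ζ v = g (Submodule.Quotient.mk v) := fun v => rfl
    have hζn : ‖ζ‖ ≤ 1 := LinearMap.mkContinuous_norm_le _ zero_le_one _
    obtain ⟨w, hw⟩ := hWmem ζ (by
      rw [hζ, (Submodule.Quotient.mk_eq_zero _).2 (Submodule.mem_span_singleton_self x), map_zero])
    have hw' : e w = ζ := hw
    have h1 : L y w = ‖(Submodule.Quotient.mk y : V ⧸ Submodule.span ℝ {x})‖ := by
      rw [hL, hw']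
      exact hgz
    have h2 := (L y).le_opNorm w
    rw [h1, Real.norm_of_nonneg (norm_nonneg _)] at h2
    refine h2.trans ?_
    refine mul_le_of_le_one_right (norm_nonneg _) ?_
    rwa [← e.norm_map w, hw']

omit [FiniteDimensional ℝ V] in
theorem norm_inclusionInDoubleDual (x : V) : ‖NormedSpace.inclusionInDoubleDual ℝ V x‖ = ‖x‖ :=
  (NormedSpace.inclusionInDoubleDualLi ℝ (E := V)).norm_map x

theorem vol_doubleDual (v : Fin k → V) :
    μ.vol (fun i => NormedSpace.inclusionInDoubleDual ℝ V (v i)) = μ.vol v := by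
  let f : V →ₗ[ℝ] StrongDual ℝ (StrongDual ℝ V) :=
    { toFun := fun x => NormedSpace.inclusionInDoubleDual ℝ V x
      map_add' := fun x y => map_add _ x y
      map_smul' := fun c x => map_smul _ c x }
  have hf : ∀ x, f x = NormedSpace.inclusionInDoubleDual ℝ V x := fun x => rfl
  have h : finrank ℝ V = finrank ℝ (StrongDual ℝ (StrongDual ℝ V)) :=
    (finrank_strongDual_eq (StrongDual ℝ V) (finrank_strongDual_eq V rfl)).symm
  have := μ.vol_comp_isometry (W := StrongDual ℝ (StrongDual ℝ V)) f
    (fun x => norm_inclusionInDoubleDual x) h v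
  simpa only [hf] using this

/-- The density induced by the dual definition of volume on the annihilator of `x`. -/
theorem dual_inducedDensity_eq (hV : finrank ℝ V = k + 1) {x : V} (hx : x ≠ 0)
    (ξ₀ : StrongDual ℝ V) (ξ : Fin k → StrongDual ℝ V) (hξ : ∀ i, ξ i x = 0) :
    μ.dual.inducedDensity ξ * |ξ₀ x| * μ.dualRadial hV x =
      μ.dual.vol (Fin.cons ξ₀ ξ : Fin (k + 1) → StrongDual ℝ V) := by
  by_cases hli : LinearIndependent ℝ ξ
  · obtain ⟨v, hv⟩ := μ.exists_vol_cons_pos hV hx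
    have hF := μ.dualRadial_pos hV hx
    let W := Submodule.span ℝ (Set.range ξ)
    have hW : finrank ℝ W = k := by simpa using finrank_span_eq_card hli
    have hWx : ∀ η ∈ W, η x = 0 := by
      intro η hη
      induction hη using Submodule.span_induction with
      | mem η h => obtain ⟨i, rfl⟩ := h; exact hξ i
      | zero => simp
      | add a b _ _ ha hb => simp [ha, hb]
      | smul c a _ ha => simp [ha]
    -- The dual volume on `W` is computed with the functionals `f(v_i)`, that on `V*` with the
    -- evaluations at `x, v_1, …, v_k`.
    obtain ⟨f, hf, hfξ⟩ := exists_quotient_isometry hV hx hW W.subtypeₗᵢ (fun ξ : W => hWx _ (Subtype.prop ξ))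
    have h1 : μ.vol (fun i => f (Submodule.Quotient.mk (v i))) =
        μ.dualRadial hV x * μ.vol (Fin.cons x v : Fin (k + 1) → V) := by
      rw [← μ.quotientDensity_eq hV hx]
      refine μ.vol_comp_isometry f hf ?_ (fun i => Submodule.Quotient.mk (v i))
      rw [finrank_quotient_span_singleton hV hx, finrank_strongDual_eq W hW]
    rw [inducedDensity, if_pos hli, μ.dual_vol_eq hW _ _ (by rw [h1]; positivity),
      μ.dual_vol_eq (finrank_strongDual_eq V hV) _ _
        (by rw [μ.vol_doubleDual (Fin.cons x v : Fin (k + 1) → V)]; positivity),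
      h1, μ.vol_doubleDual, Matrix.det_succ_column_zero, Fin.sum_univ_succ]
    -- Since every `ξ i` kills `x`, the first column is `(ξ₀ x, 0, …, 0)`, and the large determinant
    -- is `ξ₀ x` times the small one.
    have h2 : ∀ i : Fin k, (Matrix.of fun (i j : Fin (k + 1)) =>
        NormedSpace.inclusionInDoubleDual ℝ V ((Fin.cons x v : Fin (k + 1) → V) j)
          ((Fin.cons ξ₀ ξ : Fin (k + 1) → StrongDual ℝ V) i)) i.succ 0 = 0 := by
      intro i
      simp [hξ]
    simp only [h2, mul_zero, zero_mul, Finset.sum_const_zero, add_zero]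
    have h3 : (Matrix.of fun i j => (f (Submodule.Quotient.mk (v j)))
        (⟨ξ i, Submodule.subset_span ⟨i, rfl⟩⟩ : Submodule.span ℝ (Set.range ξ))) =
        (Matrix.of fun (i j : Fin (k + 1)) =>
        NormedSpace.inclusionInDoubleDual ℝ V ((Fin.cons x v : Fin (k + 1) → V) j)
          ((Fin.cons ξ₀ ξ : Fin (k + 1) → StrongDual ℝ V) i)).submatrix (Fin.succAbove 0)
            Fin.succ := by
      ext i j
      simp [hfξ]
    rw [h3]
    simp only [Fin.val_zero, pow_zero, one_mul, abs_mul]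
    simp only [Matrix.of_apply, Fin.cons_zero, NormedSpace.dual_def]
    field_simp
  · rw [inducedDensity, if_neg hli, zero_mul, zero_mul, vol_eq_zero_of_not_linearIndependent]
    intro h
    exact hli (linearIndependent_finCons.1 h).1

end Duality

end DefinitionOfVolume

namespace DefinitionOfVolume

/-! ### Convexity of the dual definition and the triangle inequality -/

section Subadditive

variable (μ : DefinitionOfVolume.{u}) {V : Type u}
  [NormedAddCommGroup V] [NormedSpace ℝ V] [FiniteDimensional ℝ V] {k m : ℕ}

theorem ιMulti_cons_add {E : Type u} [AddCommGroup E] [Module ℝ E] (x y : E) (c : ℝ)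
    (v : Fin k → E) :
    exteriorPower.ιMulti ℝ (k + 1) (Fin.cons (x + c • y) v : Fin (k + 1) → E) =
      exteriorPower.ιMulti ℝ (k + 1) (Fin.cons x v : Fin (k + 1) → E) +
        c • exteriorPower.ιMulti ℝ (k + 1) (Fin.cons y v : Fin (k + 1) → E) := by
  have h1 := (exteriorPower.ιMulti ℝ (k + 1) (M := E)).map_update_add
    (Fin.cons 0 v : Fin (k + 1) → E) 0 x (c • y)
  have h2 := (exteriorPower.ιMulti ℝ (k + 1) (M := E)).map_update_smul
    (Fin.cons 0 v : Fin (k + 1) → E) 0 c y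
  simp only [Fin.update_cons_zero] at h1 h2
  rw [h1, h2]

theorem vol_cons_swap (x y : V) (v : Fin k → V) :
    μ.vol (Fin.cons y (Fin.cons x v : Fin (k + 1) → V) : Fin (k + 2) → V) =
      μ.vol (Fin.cons x (Fin.cons y v : Fin (k + 1) → V) : Fin (k + 2) → V) := by
  unfold vol
  split_ifs
  · have h : (Fin.cons y (Fin.cons x v : Fin (k + 1) → V) : Fin (k + 2) → V) =
        (Fin.cons x (Fin.cons y v : Fin (k + 1) → V) : Fin (k + 2) → V) ∘ Equiv.swap 0 1 := by
      ext i
      refine Fin.cases ?_ (fun j => Fin.cases ?_ (fun j => ?_) j) i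
      · simp only [Function.comp_apply, Equiv.swap_apply_left]
        rfl
      · have : (Fin.succ 0 : Fin (k + 2)) = 1 := rfl
        simp only [Function.comp_apply, this, Equiv.swap_apply_right]
        rfl
      · rw [Function.comp_apply, Equiv.swap_apply_of_ne_of_ne (Fin.succ_ne_zero _)
          (by simp [Fin.ext_iff])]
        rfl
    rw [h, (exteriorPower.ιMulti ℝ (k + 2)).map_swap _ (by simp), map_neg_eq_map]
  · rfl

theorem vol_cons_cons_add (x y : V) (c : ℝ) (v : Fin k → V) :
    μ.vol (Fin.cons x (Fin.cons (x + c • y) v : Fin (k + 1) → V) : Fin (k + 2) → V) =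
      |c| * μ.vol (Fin.cons x (Fin.cons y v : Fin (k + 1) → V) : Fin (k + 2) → V) := by
  rw [vol_cons_swap, μ.vol_cons_swap y x]
  unfold vol
  split_ifs
  · rw [ιMulti_cons_add, (exteriorPower.ιMulti ℝ (k + 2)).map_eq_zero_of_eq
      (Fin.cons x (Fin.cons x v : Fin (k + 1) → V) : Fin (k + 2) → V) (i := 0) (j := 1) rfl
      (by simp), zero_add, map_smul_eq_mul, Real.norm_eq_abs]
  · simp

/-- The lifting argument of `exists_basis_cons` is applied in `V/⟨x⟩` to the class of `y`, then
repeated from `V/⟨x⟩` to `V`. -/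
theorem exists_basis_cons_cons (hV : finrank ℝ V = m + 2) {x y : V} (hx : x ≠ 0)
    (hy : y ∉ Submodule.span ℝ {x}) :
    ∃ b : Basis (Fin (m + 2)) ℝ V, b 0 = x ∧ b 1 = y := by
  have hy' : (Submodule.Quotient.mk y : V ⧸ Submodule.span ℝ {x}) ≠ 0 := by
    rwa [Ne, Submodule.Quotient.mk_eq_zero]
  obtain ⟨w, b, -, hb, -⟩ :=
    exists_basis_cons (k := m) (finrank_quotient_span_singleton (k := m + 1) hV hx) hy'
  choose v hv using fun i => Submodule.Quotient.mk_surjective _ (w i)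
  have hli : LinearIndependent ℝ (Fin.cons x (Fin.cons y v : Fin (m + 1) → V) : Fin (m + 2) → V) := by
    refine linearIndependent_cons_of_quotient hx ?_
    have : (fun i => (Submodule.Quotient.mk ((Fin.cons y v : Fin (m + 1) → V) i) :
        V ⧸ Submodule.span ℝ {x})) = b := by
      rw [hb]
      ext i
      refine Fin.cases ?_ (fun j => ?_) i
      · rfl
      · simp [hv]
    rw [this]
    exact b.linearIndependent
  refine ⟨basisOfLinearIndependentOfCardEqFinrank hli (by simp [hV]), ?_, ?_⟩
  · simp
  · simp

/-- If the dual definition of volume is convex, the gauge of the dual isoperimetrix is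
subadditive. -/
theorem inv_dualRadial_add_le (hV : finrank ℝ V = k + 1) (hμ : μ.dual.IsConvex) (x y : V) :
    (μ.dualRadial hV (x + y))⁻¹ ≤ (μ.dualRadial hV x)⁻¹ + (μ.dualRadial hV y)⁻¹ := by
  have hsmul : ∀ (t : ℝ) (z : V), (μ.dualRadial hV (t • z))⁻¹ = |t| * (μ.dualRadial hV z)⁻¹ := by
    intro t z
    rcases eq_or_ne t 0 with rfl | ht
    · simp [dualRadial_zero]
    · rw [μ.dualRadial_smul hV ht, mul_inv, inv_inv]
  have hnn : ∀ z : V, 0 ≤ (μ.dualRadial hV z)⁻¹ := by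
    intro z
    rcases eq_or_ne z 0 with rfl | hz
    · simp [dualRadial_zero]
    · exact (inv_pos.2 (μ.dualRadial_pos hV hz)).le
  rcases eq_or_ne x 0 with rfl | hx
  · simp [dualRadial_zero]
  -- For parallel vectors homogeneity suffices. Otherwise `x, y` start a basis, and `d` is its dual
  -- basis.
  by_cases hy : y ∈ Submodule.span ℝ {x}
  · obtain ⟨a, rfl⟩ := Submodule.mem_span_singleton.1 hy
    have h1 : x + a • x = (1 + a) • x := by rw [add_smul, one_smul]
    rw [h1, hsmul, hsmul]
    have := abs_add_le 1 a
    rw [abs_one] at this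
    calc _ ≤ (1 + |a|) * (μ.dualRadial hV x)⁻¹ := mul_le_mul_of_nonneg_right this (hnn x)
      _ = _ := by ring
  obtain ⟨m, rfl⟩ : ∃ m, k = m + 1 := by
    rcases k with _ | m
    · exfalso
      obtain ⟨c, hc⟩ := (finrank_eq_one_iff_of_nonzero' x hx).1 hV y
      exact hy (Submodule.mem_span_singleton.2 ⟨c, hc⟩)
    · exact ⟨m, rfl⟩
  obtain ⟨b, hbx, hby⟩ := exists_basis_cons_cons hV hx hy
  have hy0 : y ≠ 0 := by
    rintro rfl
    exact hy (Submodule.zero_mem _)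
  have hxy0 : x + y ≠ 0 := by
    intro h
    refine hy (Submodule.mem_span_singleton.2 ⟨-1, ?_⟩)
    rw [neg_one_smul]
    exact neg_eq_of_add_eq_zero_right h
  let d : Fin (m + 2) → StrongDual ℝ V := fun i => LinearMap.toContinuousLinearMap (b.coord i)
  have hd : ∀ i j, d i (b j) = if j = i then 1 else 0 := by
    intro i j
    simp [d, Finsupp.single_apply]
  have hdli : LinearIndependent ℝ d := by
    rw [Fintype.linearIndependent_iff]
    intro g hg i
    have := congrArg (fun ξ : StrongDual ℝ V => ξ (b i)) hg
    simpa [hd] using this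
  let z : Fin m → StrongDual ℝ V := fun i => d i.succ.succ
  have hzx : ∀ i, z i x = 0 := fun i => by
    rw [← hbx]
    simp only [z, hd]
    exact if_neg (Fin.succ_ne_zero _).symm
  have hzy : ∀ i, z i y = 0 := fun i => by
    rw [← hby]
    simp only [z, hd]
    exact if_neg (by simp [Fin.ext_iff])
  have hd0x : d 0 x = 1 := by rw [← hbx, hd, if_pos rfl]
  have hd0y : d 0 y = 0 := by rw [← hby, hd, if_neg (by simp)]
  have hd1x : d 1 x = 0 := by rw [← hbx, hd, if_neg (by simp)]
  have hd1y : d 1 y = 1 := by rw [← hby, hd, if_pos rfl]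
  have hdeq : d = (Fin.cons (d 0) (Fin.cons (d 1) z : Fin (m + 1) → _) : Fin (m + 2) → _) := by
    ext1 i
    refine Fin.cases rfl (fun j => Fin.cases rfl (fun j => rfl) j) i
  have hE : finrank ℝ (StrongDual ℝ V) = m + 2 := finrank_strongDual_eq V hV
  have hD : 0 < μ.dual.vol d := μ.dual.vol_pos hE hdli
  -- The families `(d 1, z)`, `(d 0, z)`, `(d 0 - d 1, z)` lie in the annihilators of `x`, `y`, `x +
  -- y`. Completed by `d 0`, `d 1`, `d 0`, they all have the volume of `d`, so each induced density
  -- is that volume over the dual radial function.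
  have e1 := μ.dual_inducedDensity_eq hV hx (d 0) (Fin.cons (d 1) z) (by
    intro i
    refine Fin.cases ?_ (fun j => ?_) i
    · simpa using hd1x
    · simpa using hzx j)
  have e2 := μ.dual_inducedDensity_eq hV hy0 (d 1) (Fin.cons (d 0) z) (by
    intro i
    refine Fin.cases ?_ (fun j => ?_) i
    · simpa using hd0y
    · simpa using hzy j)
  have e3 := μ.dual_inducedDensity_eq hV hxy0 (d 0) (Fin.cons (d 0 + (-1 : ℝ) • d 1) z) (by
    intro i
    refine Fin.cases ?_ (fun j => ?_) i
    · simp [hd0x, hd0y, hd1x, hd1y]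
    · simp [hzx j, hzy j])
  rw [← hdeq, hd0x, abs_one, mul_one] at e1
  rw [vol_cons_swap, ← hdeq, hd1y, abs_one, mul_one] at e2
  rw [vol_cons_cons_add, ← hdeq, abs_neg, abs_one, one_mul, map_add, hd0x, hd0y, add_zero,
    abs_one, mul_one] at e3
  obtain ⟨N, -, hN⟩ := hμ (m + 1) (StrongDual ℝ V) hE
  -- Convexity enters here: `(d 0 - d 1) ∧ z = d 0 ∧ z - d 1 ∧ z`, and `N` is a seminorm.
  have h1 : N (exteriorPower.ιMulti ℝ (m + 1)
      (Fin.cons (d 0 + (-1 : ℝ) • d 1) z : Fin (m + 1) → StrongDual ℝ V)) ≤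
      N (exteriorPower.ιMulti ℝ (m + 1) (Fin.cons (d 0) z : Fin (m + 1) → StrongDual ℝ V)) +
      N ((-1 : ℝ) • exteriorPower.ιMulti ℝ (m + 1)
        (Fin.cons (d 1) z : Fin (m + 1) → StrongDual ℝ V)) := by
    rw [ιMulti_cons_add]
    exact map_add_le_add N _ _
  rw [map_smul_eq_mul, hN, hN, hN, norm_neg, norm_one, one_mul] at h1
  have p1 := μ.dualRadial_pos hV hx
  have p2 := μ.dualRadial_pos hV hy0
  have p3 := μ.dualRadial_pos hV hxy0
  rw [← eq_div_iff p1.ne'] at e1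
  rw [← eq_div_iff p2.ne'] at e2
  rw [← eq_div_iff p3.ne'] at e3
  rw [e1, e2, e3, div_eq_mul_inv, div_eq_mul_inv, div_eq_mul_inv, ← mul_add] at h1
  rw [add_comm (μ.dualRadial hV x)⁻¹]
  exact le_of_mul_le_mul_left h1 hD

end Subadditive

end DefinitionOfVolume

/-! ### Star-shaped sets and their radial functions -/

section Radial

variable {V : Type u} [NormedAddCommGroup V] [NormedSpace ℝ V]

theorem starConvex_smul_mem {S : Set V} (hS : StarConvex ℝ 0 S) {s t : ℝ} (hs : 0 ≤ s)
    (hst : s ≤ t) {x : V} (hx : t • x ∈ S) : s • x ∈ S := by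
  rcases hs.eq_or_lt with rfl | hs
  · rw [zero_smul]
    exact hS.mem ⟨_, hx⟩
  · have ht : 0 < t := hs.trans_le hst
    have := hS.smul_mem hx (t := s / t) (by positivity) ((div_le_one ht).2 hst)
    rwa [smul_smul, div_mul_cancel₀ _ ht.ne'] at this

theorem bddAbove_radial {S : Set V} (hc : IsCompact S) {x : V} (hx : x ≠ 0) :
    BddAbove {t : ℝ | 0 ≤ t ∧ t • x ∈ S} := by
  obtain ⟨C, hC⟩ := hc.isBounded.exists_norm_le
  refine ⟨C / ‖x‖, ?_⟩
  rintro t ⟨ht, htx⟩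
  rw [le_div_iff₀ (norm_pos_iff.2 hx)]
  have := hC _ htx
  rwa [norm_smul, Real.norm_of_nonneg ht] at this

theorem le_radialFun_iff {S : Set V} (hc : IsCompact S) (hS : StarConvex ℝ 0 S)
    (h0 : (0 : V) ∈ S) {x : V} (hx : x ≠ 0) {t : ℝ} (ht : 0 ≤ t) :
    t ≤ radialFun S x ↔ t • x ∈ S := by
  have hne : {t : ℝ | 0 ≤ t ∧ t • x ∈ S}.Nonempty := ⟨0, le_rfl, by simpa using h0⟩
  have hcl : IsClosed {t : ℝ | 0 ≤ t ∧ t • x ∈ S} :=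
    (isClosed_Ici).inter (hc.isClosed.preimage (by fun_prop : Continuous fun t : ℝ => t • x))
  refine ⟨fun h => ?_, fun h => le_csSup (bddAbove_radial hc hx) ⟨ht, h⟩⟩
  exact starConvex_smul_mem hS ht h (hcl.csSup_mem hne (bddAbove_radial hc hx)).2

theorem radialFun_eq_of_forall {S : Set V} {x : V} {r : ℝ} (hr : 0 ≤ r)
    (h : ∀ t, 0 ≤ t → (t • x ∈ S ↔ t ≤ r)) : radialFun S x = r := by
  have : {t : ℝ | 0 ≤ t ∧ t • x ∈ S} = Set.Icc 0 r := by
    ext t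
    exact ⟨fun ht => ⟨ht.1, (h t ht.1).1 ht.2⟩, fun ht => ⟨ht.1, (h t ht.1).2 ht.2⟩⟩
  rw [radialFun, this, csSup_Icc hr]

theorem radialFun_pos {S : Set V} (hc : IsCompact S) (h0 : (0 : V) ∈ interior S)
    {x : V} (hx : x ≠ 0) : 0 < radialFun S x := by
  have h1 : ∀ᶠ t in 𝓝[>] (0 : ℝ), t • x ∈ S := by
    have : Tendsto (fun t : ℝ => t • x) (𝓝 0) (𝓝 0) := by
      have : Continuous fun t : ℝ => t • x := by fun_prop
      simpa using this.tendsto 0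
    exact (this.mono_left nhdsWithin_le_nhds).eventually (mem_interior_iff_mem_nhds.1 h0)
  obtain ⟨t, ht, ht0⟩ := (h1.and self_mem_nhdsWithin).exists
  exact lt_of_lt_of_le ht0 (le_csSup (bddAbove_radial hc hx) ⟨le_of_lt ht0, ht⟩)

theorem radialFun_smul_vec (S : Set V) (x : V) {t : ℝ} (ht : 0 < t) :
    radialFun S (t • x) = t⁻¹ * radialFun S x := by
  have : {s : ℝ | 0 ≤ s ∧ s • t • x ∈ S} = t⁻¹ • {s : ℝ | 0 ≤ s ∧ s • x ∈ S} := by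
    ext s
    rw [Set.mem_inv_smul_set_iff₀ ht.ne']
    simp only [Set.mem_ofPred_eq, smul_eq_mul, smul_smul, mul_comm s t]
    rw [mul_nonneg_iff_of_pos_left ht]
  rw [radialFun, this, Real.sSup_smul_of_nonneg (inv_nonneg.2 ht.le), smul_eq_mul, radialFun]

theorem radialFun_smul_set (S : Set V) (x : V) {c : ℝ} (hc : 0 < c) :
    radialFun (c • S) x = c * radialFun S x := by
  have h := radialFun_smul_vec S x (inv_pos.2 hc)
  rw [inv_inv] at h
  rw [← h, radialFun, radialFun]
  congr 1
  ext t
  simp only [Set.mem_ofPred_eq, Set.mem_smul_set_iff_inv_smul_mem₀ hc.ne', smul_comm t]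

/-- A star body can be prescribed by its radial function. -/
theorem exists_starBody [FiniteDimensional ℝ V] [Nontrivial V] (ρ : V → ℝ)
    (hpos : ∀ x, x ≠ 0 → 0 < ρ x) (hsmul : ∀ (t : ℝ) (x : V), 0 < t → ρ (t • x) = t⁻¹ * ρ x)
    (hcont : ContinuousOn ρ {0}ᶜ) :
    ∃ S : StarBody V, S.carrier = {x | x = 0 ∨ 1 ≤ ρ x} ∧
      ∀ x, x ≠ 0 → radialFun S.carrier x = ρ x := by
  have hsub : Metric.sphere (0 : V) 1 ⊆ {0}ᶜ := fun x hx => ne_zero_of_mem_unit_sphere ⟨x, hx⟩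
  have hne : (Metric.sphere (0 : V) 1).Nonempty := NormedSpace.sphere_nonempty.2 zero_le_one
  obtain ⟨a, ha, hamin⟩ := (isCompact_sphere (0 : V) 1).exists_isMinOn hne (hcont.mono hsub)
  obtain ⟨b, hb, hbmax⟩ := (isCompact_sphere (0 : V) 1).exists_isMaxOn hne (hcont.mono hsub)
  have ha0 := hpos a (hsub ha)
  -- By homogeneity the extrema of `ρ` on the unit sphere place the set between two balls.
  have hnorm : ∀ x, x ≠ 0 → ρ x = ‖x‖⁻¹ * ρ (‖x‖⁻¹ • x) ∧ ρ a ≤ ρ (‖x‖⁻¹ • x) ∧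
      ρ (‖x‖⁻¹ • x) ≤ ρ b := by
    intro x hx
    have hx' : 0 < ‖x‖ := norm_pos_iff.2 hx
    have hmem : ‖x‖⁻¹ • x ∈ Metric.sphere (0 : V) 1 := by
      rw [mem_sphere_zero_iff_norm, norm_smul, norm_inv, norm_norm, inv_mul_cancel₀ hx'.ne']
    refine ⟨?_, hamin hmem, hbmax hmem⟩
    rw [hsmul _ _ (inv_pos.2 hx'), inv_inv, ← mul_assoc, inv_mul_cancel₀ hx'.ne', one_mul]
  have hmem : ∀ x : V, x ≠ 0 → ∀ t : ℝ, 0 ≤ t →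
      (t • x ∈ {x | x = 0 ∨ 1 ≤ ρ x} ↔ t ≤ ρ x) := by
    intro x hx t ht
    rcases ht.eq_or_lt with rfl | ht
    · simp [(hpos x hx).le]
    · simp only [Set.mem_ofPred_eq, smul_eq_zero, ht.ne', hx, or_self, false_or, hsmul t x ht]
      rw [le_inv_mul_iff₀ ht, mul_one]
  have hrad : ∀ x, x ≠ 0 → radialFun {x | x = 0 ∨ 1 ≤ ρ x} x = ρ x := fun x hx =>
    radialFun_eq_of_forall (hpos x hx).le (hmem x hx)
  refine ⟨⟨{x | x = 0 ∨ 1 ≤ ρ x}, ?_, ?_, ?_, ?_⟩, rfl, hrad⟩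
  · refine Metric.isCompact_of_isClosed_isBounded ?_ ?_
    · have h1 := hcont.isOpen_inter_preimage isOpen_compl_singleton (isOpen_Iio (a := (1 : ℝ)))
      have h2 : {x | x = 0 ∨ 1 ≤ ρ x} = ({0}ᶜ ∩ ρ ⁻¹' Set.Iio 1)ᶜ := by
        ext x
        simp only [Set.mem_ofPred_eq, Set.mem_compl_iff, Set.mem_inter_iff, Set.mem_singleton_iff,
          Set.mem_preimage, Set.mem_Iio, not_and, not_lt]
        tauto
      rw [h2]
      exact h1.isClosed_compl
    · refine (Metric.isBounded_closedBall (x := (0 : V)) (r := ρ b)).subset ?_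
      intro x hx
      rw [mem_closedBall_zero_iff]
      rcases eq_or_ne x 0 with rfl | hx0
      · simpa using (hpos b (hsub hb)).le
      · have h1 : 1 ≤ ρ x := hx.resolve_left hx0
        obtain ⟨h2, -, h3⟩ := hnorm x hx0
        rw [h2, le_inv_mul_iff₀ (norm_pos_iff.2 hx0), mul_one] at h1
        exact h1.trans h3
  · refine starConvex_zero_iff.2 fun x hx t ht ht1 => ?_
    rcases eq_or_ne x 0 with rfl | hx0
    · left
      simp
    · rw [hmem x hx0 t ht]
      exact ht1.trans (hx.resolve_left hx0)
  · refine mem_interior.2 ⟨Metric.ball 0 (ρ a), fun x hx => ?_, Metric.isOpen_ball,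
      Metric.mem_ball_self ha0⟩
    rw [mem_ball_zero_iff] at hx
    rcases eq_or_ne x 0 with rfl | hx0
    · exact Or.inl rfl
    · right
      obtain ⟨h2, h3, -⟩ := hnorm x hx0
      rw [h2, le_inv_mul_iff₀ (norm_pos_iff.2 hx0), mul_one]
      exact hx.le.trans h3
  · exact hcont.congr fun x hx => hrad x hx

end Radial

/-! ### Volume in polar coordinates -/

section Polar

variable {X : Type*} [NormedAddCommGroup X] [NormedSpace ℝ X] [FiniteDimensional ℝ X]
  [MeasurableSpace X] [BorelSpace X]

theorem volumeIoiPow_apply_Iic (n : ℕ) (x : Set.Ioi (0 : ℝ)) :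
    Measure.volumeIoiPow n (Set.Iic x) = ENNReal.ofReal (x.1 ^ (n + 1) / (n + 1)) := by
  rw [← Measure.volumeIoiPow_apply_Iio]
  have h : Measure.volumeIoiPow n {x} = 0 := by
    refine withDensity_absolutelyContinuous _ _ ?_
    rw [Measure.comap_apply _ Subtype.val_injective
      (fun s hs => measurableSet_Ioi.subtype_image hs) _ (measurableSet_singleton x)]
    simp
  rw [← Set.Iio_union_right]
  refine le_antisymm ((measure_union_le _ _).trans ?_) (measure_mono Set.subset_union_left)
  rw [h, add_zero]

/-- The volume of a star-shaped set in polar coordinates. -/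
theorem measureReal_eq_integral_toSphere [Nontrivial X] (μ : Measure X) [μ.IsAddHaarMeasure]
    (A : Set X) (r : Metric.sphere (0 : X) 1 → ℝ) (hr : Measurable r) (hpos : ∀ u, 0 < r u)
    (hA : ∀ (u : Metric.sphere (0 : X) 1) (t : ℝ), 0 < t → (t • (u : X) ∈ A ↔ t ≤ r u)) :
    μ.real A = (1 / (finrank ℝ X : ℝ)) * ∫ u, r u ^ finrank ℝ X ∂μ.toSphere := by
  have hn : finrank ℝ X - 1 + 1 = finrank ℝ X := Nat.sub_add_cancel finrank_pos
  have hn0 : (0 : ℝ) < finrank ℝ X := by exact_mod_cast finrank_pos (R := ℝ) (M := X)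
  have hmem : ∀ x : ({0}ᶜ : Set X), (x : X) ∈ A ↔
      homeomorphUnitSphereProd X x ∈ {q : Metric.sphere (0 : X) 1 × Set.Ioi (0 : ℝ) | q.2.1 ≤ r q.1} := by
    intro x
    have hx : 0 < ‖(x : X)‖ := norm_pos_iff.2 x.2
    have := hA (homeomorphUnitSphereProd X x).1 ‖(x : X)‖ hx
    rw [homeomorphUnitSphereProd_apply_fst_coe, smul_smul, mul_inv_cancel₀ hx.ne', one_smul] at this
    rw [this]
    simp
  have hset : MeasurableSet
      {q : Metric.sphere (0 : X) 1 × Set.Ioi (0 : ℝ) | q.2.1 ≤ r q.1} :=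
    measurableSet_le (by fun_prop) (by fun_prop)
  have h1 : μ A = (μ.comap ((↑) : ({0}ᶜ : Set X) → X)) ((↑) ⁻¹' A) := by
    rw [(MeasurableEmbedding.subtype_coe (measurableSet_singleton (0 : X)).compl).comap_preimage,
      Subtype.range_coe]
    rw [← Set.sdiff_eq, measure_sdiff_null (measure_singleton _)]
  have h2 : ((↑) ⁻¹' A : Set ({0}ᶜ : Set X)) = homeomorphUnitSphereProd X ⁻¹'
      {q : Metric.sphere (0 : X) 1 × Set.Ioi (0 : ℝ) | q.2.1 ≤ r q.1} := by
    ext x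
    exact hmem x
  -- Off the origin the measure is a product of the sphere measure and `tⁿ⁻¹ dt`, and the slice over
  -- `u` is `(0, r u]`.
  have h3 : μ A = ∫⁻ u, ENNReal.ofReal (r u ^ finrank ℝ X / finrank ℝ X) ∂μ.toSphere := by
    rw [h1, h2, μ.measurePreserving_homeomorphUnitSphereProd.measure_preimage hset.nullMeasurableSet,
      Measure.prod_apply hset]
    refine lintegral_congr fun u => ?_
    have : Prod.mk u ⁻¹' {q : Metric.sphere (0 : X) 1 × Set.Ioi (0 : ℝ) | q.2.1 ≤ r q.1} =
        Set.Iic (⟨r u, hpos u⟩ : Set.Ioi (0 : ℝ)) := by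
      ext t
      rfl
    rw [this, volumeIoiPow_apply_Iic, hn]
    congr 2
    have : ((finrank ℝ X - 1 : ℕ) : ℝ) + 1 = ((finrank ℝ X - 1 + 1 : ℕ) : ℝ) := by push_cast; rfl
    rw [this, hn]
  rw [measureReal_def, h3, ← integral_eq_lintegral_of_nonneg_ae, ← integral_const_mul]
  · refine integral_congr_ae (ae_of_all _ fun u => ?_)
    simp only
    ring
  · refine ae_of_all _ fun u => ?_
    have := hpos u
    simp only [Pi.zero_apply]
    positivity
  · exact ((hr.pow_const _).div_const _).aestronglyMeasurable

omit [FiniteDimensional ℝ X] in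
theorem toSphere_smul (c : ENNReal) (μ : Measure X) : (c • μ).toSphere = c • μ.toSphere := by
  ext s hs
  rw [Measure.smul_apply, Measure.toSphere_apply' _ hs, Measure.toSphere_apply' _ hs,
    Measure.smul_apply, smul_eq_mul, smul_eq_mul]
  ring

end Polar

/-! ### The reference sphere and the radial parametrization -/

section Reference

variable {V : Type u} [NormedAddCommGroup V] [NormedSpace ℝ V] [FiniteDimensional ℝ V]

theorem toEuclidean_symm_ne_zero (u : RefSphere V) :
    (toEuclidean.symm (u : EuclideanSpace ℝ (Fin (finrank ℝ V))) : V) ≠ 0 := by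
  simpa using ne_zero_of_mem_unit_sphere u

theorem finrank_orthogonal_span (u : RefSphere V) {k : ℕ} (hV : finrank ℝ V = k + 1) :
    finrank ℝ (Submodule.span ℝ {(u : EuclideanSpace ℝ (Fin (finrank ℝ V)))})ᗮ = k := by
  have h := (Submodule.span ℝ {(u : EuclideanSpace ℝ (Fin (finrank ℝ V)))}).finrank_add_finrank_orthogonal
  rw [finrank_span_singleton (ne_zero_of_mem_unit_sphere u), finrank_euclideanSpace_fin] at h
  omega

/-- An orthonormal basis of the tangent space of the sphere at `u`, completed by `u`. -/
theorem exists_orthonormalBasis_cons (u : RefSphere V) {k : ℕ} (hV : finrank ℝ V = k + 1)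
    (e : OrthonormalBasis (Fin k) ℝ
      (Submodule.span ℝ {(u : EuclideanSpace ℝ (Fin (finrank ℝ V)))})ᗮ) :
    ∃ o : OrthonormalBasis (Fin (k + 1)) ℝ (EuclideanSpace ℝ (Fin (finrank ℝ V))),
      ⇑o = Fin.cons (u : EuclideanSpace ℝ (Fin (finrank ℝ V))) (fun i => (e i : EuclideanSpace ℝ _)) := by
  have hu : ‖(u : EuclideanSpace ℝ (Fin (finrank ℝ V)))‖ = 1 := norm_eq_of_mem_sphere u
  have hue : ∀ i, inner ℝ (u : EuclideanSpace ℝ (Fin (finrank ℝ V))) (e i : EuclideanSpace ℝ _) = 0 :=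
    fun i => (Submodule.mem_orthogonal _ _).1 (e i).2 _ (Submodule.mem_span_singleton_self _)
  have hee : ∀ i j, inner ℝ (e i : EuclideanSpace ℝ (Fin (finrank ℝ V))) (e j : EuclideanSpace ℝ _) =
      if i = j then 1 else 0 := fun i j => orthonormal_iff_ite.1 e.orthonormal i j
  have ho : Orthonormal ℝ (Fin.cons (u : EuclideanSpace ℝ (Fin (finrank ℝ V)))
      (fun i => (e i : EuclideanSpace ℝ _)) : Fin (k + 1) → EuclideanSpace ℝ (Fin (finrank ℝ V))) := by
    rw [orthonormal_iff_ite]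
    intro i j
    refine Fin.cases ?_ (fun i => ?_) i <;> refine Fin.cases ?_ (fun j => ?_) j
    · simp [hu]
    · simpa [(Fin.succ_ne_zero j).symm] using hue j
    · rw [real_inner_comm]
      simpa using hue i
    · simpa using hee i j
  let b := basisOfLinearIndependentOfCardEqFinrank ho.linearIndependent (by simp [hV])
  have hb : ⇑b = _ := coe_basisOfLinearIndependentOfCardEqFinrank ho.linearIndependent (by simp [hV])
  refine ⟨b.toOrthonormalBasis (by rw [hb]; exact ho), ?_⟩
  rw [Basis.coe_toOrthonormalBasis, hb]

namespace DefinitionOfVolume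

variable (μ : DefinitionOfVolume.{u})

/-- The ratio between the Lebesgue measure of `μ` and the Lebesgue measure carried over from
Euclidean space. -/
def euclideanFactor (V : Type u) [NormedAddCommGroup V] [NormedSpace ℝ V]
    [FiniteDimensional ℝ V] : ℝ :=
  μ.vol (fun i => (toEuclidean.symm (EuclideanSpace.basisFun (Fin (finrank ℝ V)) ℝ i) : V))

theorem map_lebesgue_eq_vol [MeasurableSpace V] [BorelSpace V] {k : ℕ}
    (o : OrthonormalBasis (Fin k) ℝ (EuclideanSpace ℝ (Fin (finrank ℝ V)))) :
    (μ.lebesgue V).map (toEuclidean : V ≃L[ℝ] EuclideanSpace ℝ (Fin (finrank ℝ V))) =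
      ENNReal.ofReal (μ.vol (fun i => (toEuclidean.symm (o i) : V))) • volume := by
  let b : Basis (Fin k) ℝ V := o.toBasis.map (toEuclidean (E := V)).symm.toLinearEquiv
  have hb : ⇑b = fun i => (toEuclidean.symm (o i) : V) := by
    ext i
    simp [b]
  rw [μ.lebesgue_eq b, Measure.map_smul, b.map_addHaar, hb, ← o.addHaar_eq_volume]
  congr 2
  ext i
  simp [b]

theorem euclideanFactor_pos : 0 < μ.euclideanFactor V := by
  let b : Basis (Fin (finrank ℝ V)) ℝ V :=
    (EuclideanSpace.basisFun (Fin (finrank ℝ V)) ℝ).toBasis.map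
      (toEuclidean (E := V)).symm.toLinearEquiv
  have hb : ⇑b = fun i => (toEuclidean.symm (EuclideanSpace.basisFun (Fin (finrank ℝ V)) ℝ i) : V) := by
    ext i
    simp [b]
  have := μ.vol_basis_pos b
  rwa [hb] at this

theorem map_lebesgue [MeasurableSpace V] [BorelSpace V] :
    (μ.lebesgue V).map (toEuclidean : V ≃L[ℝ] EuclideanSpace ℝ (Fin (finrank ℝ V))) =
      ENNReal.ofReal (μ.euclideanFactor V) • volume :=
  μ.map_lebesgue_eq_vol (EuclideanSpace.basisFun (Fin (finrank ℝ V)) ℝ)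

/-- The transported Lebesgue measure does not depend on the orthonormal basis used to express it;
evaluation on the unit ball compares the constants. -/
theorem vol_orthonormal {k : ℕ}
    (o : OrthonormalBasis (Fin k) ℝ (EuclideanSpace ℝ (Fin (finrank ℝ V)))) :
    μ.vol (fun i => (toEuclidean.symm (o i) : V)) = μ.euclideanFactor V := by
  borelize V
  have h := (μ.map_lebesgue_eq_vol o).symm.trans μ.map_lebesgue
  have h1 := congrArg (fun ν => ν (Metric.ball 0 1)) h
  simp only [Measure.smul_apply, smul_eq_mul] at h1
  rw [ENNReal.mul_left_inj (Metric.measure_ball_pos _ _ one_pos).ne' measure_ball_lt_top.ne] at h1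
  exact (ENNReal.ofReal_eq_ofReal_iff (μ.vol_nonneg _) (μ.vol_nonneg _)).1 h1

theorem vol_cons_tangent (u : RefSphere V) {k : ℕ} (hV : finrank ℝ V = k + 1)
    (e : OrthonormalBasis (Fin k) ℝ
      (Submodule.span ℝ {(u : EuclideanSpace ℝ (Fin (finrank ℝ V)))})ᗮ) :
    μ.vol (Fin.cons (toEuclidean.symm (u : EuclideanSpace ℝ (Fin (finrank ℝ V))))
      (fun i => toEuclidean.symm (e i : EuclideanSpace ℝ (Fin (finrank ℝ V)))) : Fin (k + 1) → V) =
      μ.euclideanFactor V := by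
  obtain ⟨o, ho⟩ := exists_orthonormalBasis_cons u hV e
  rw [← μ.vol_orthonormal o, ho]
  congr 1
  ext1 i
  refine Fin.cases ?_ (fun j => ?_) i <;> simp

theorem toSphere_map_lebesgue [MeasurableSpace V] [BorelSpace V] :
    ((μ.lebesgue V).map
        (toEuclidean : V ≃L[ℝ] EuclideanSpace ℝ (Fin (finrank ℝ V)))).toSphere =
      ENNReal.ofReal (μ.euclideanFactor V) •
        (volume : Measure (EuclideanSpace ℝ (Fin (finrank ℝ V)))).toSphere := by
  rw [map_lebesgue, toSphere_smul]

theorem vol_smul {k : ℕ} (r : ℝ) (v : Fin k → V) :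
    μ.vol (fun i => r • v i) = |r| ^ k * μ.vol v := by
  unfold vol
  split_ifs
  · have := (exteriorPower.ιMulti ℝ k (M := V)).map_smul_univ (fun _ => r) v
    rw [this, map_smul_eq_mul]
    simp
  · simp

/-- Multiples of `p` vanish in the quotient. This is why the derivative of the radial function drops
out of the dual surface area. -/
theorem quotientDensity_smul_add {k : ℕ} (p : V) (r : ℝ) (a : Fin k → ℝ) (v : Fin k → V) :
    μ.quotientDensity p (fun i => r • v i + a i • p) = |r| ^ k * μ.quotientDensity p v := by
  have h : ∀ i, (Submodule.Quotient.mk (r • v i + a i • p) : V ⧸ Submodule.span ℝ {p}) =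
      r • Submodule.Quotient.mk (v i) := by
    intro i
    rw [Submodule.Quotient.mk_add, Submodule.Quotient.mk_smul, (Submodule.Quotient.mk_eq_zero _).2
      (Submodule.smul_mem _ _ (Submodule.mem_span_singleton_self p)), add_zero]
  have h1 := μ.vol_smul r (fun i => (Submodule.Quotient.mk (v i) : V ⧸ Submodule.span ℝ {p}))
  simp only [quotientDensity, h]
  exact h1

/-- The corresponding identity for the quotient density, divided by the dual radial function at `p`.
-/
theorem vol_cons_smul_add {k : ℕ} (hV : finrank ℝ V = k + 1) {p : V} (hp : p ≠ 0) (r : ℝ)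
    (a : Fin k → ℝ) (v : Fin k → V) :
    μ.vol (Fin.cons p (fun i => r • v i + a i • p) : Fin (k + 1) → V) =
      |r| ^ k * μ.vol (Fin.cons p v : Fin (k + 1) → V) := by
  have h := μ.quotientDensity_smul_add p r a v
  rw [μ.quotientDensity_eq hV hp, μ.quotientDensity_eq hV hp, mul_left_comm] at h
  exact mul_left_cancel₀ (μ.dualRadial_pos hV hp).ne' h

end DefinitionOfVolume

theorem fderiv_radialParam (K : Set V) (u e : EuclideanSpace ℝ (Fin (finrank ℝ V)))
    (hd : DifferentiableAt ℝ (fun x : EuclideanSpace ℝ (Fin (finrank ℝ V)) =>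
      radialFun K (toEuclidean.symm x)) u) :
    fderiv ℝ (radialParam K) u e = radialFun K (toEuclidean.symm u) • (toEuclidean.symm e : V) +
      fderiv ℝ (fun x : EuclideanSpace ℝ (Fin (finrank ℝ V)) =>
        radialFun K (toEuclidean.symm x)) u e • (toEuclidean.symm u : V) := by
  have h1 : HasFDerivAt (fun x : EuclideanSpace ℝ (Fin (finrank ℝ V)) => (toEuclidean.symm x : V))
      ((toEuclidean (E := V)).symm : _ →L[ℝ] V) u := (toEuclidean (E := V)).symm.hasFDerivAt
  have h2 := hd.hasFDerivAt.smul h1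
  have h3 : HasFDerivAt (radialParam K) _ u := h2
  rw [h3.fderiv]
  simp

end Reference

/-! ### Volume of star bodies and density of the smooth ones -/

section StarBodies

variable {V : Type u} [NormedAddCommGroup V] [NormedSpace ℝ V] [FiniteDimensional ℝ V]

namespace StarBody

theorem zero_mem (S : StarBody V) : (0 : V) ∈ S.carrier := interior_subset S.zero_mem_interior

theorem radialFun_pos (S : StarBody V) {x : V} (hx : x ≠ 0) : 0 < radialFun S.carrier x :=
  _root_.radialFun_pos S.isCompact S.zero_mem_interior hx

theorem radialOnSphere_apply (S : StarBody V) (u : RefSphere V) :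
    S.radialOnSphere u = radialFun S.carrier
      (toEuclidean.symm (u : EuclideanSpace ℝ (Fin (finrank ℝ V)))) := rfl

theorem radialOnSphere_pos (S : StarBody V) (u : RefSphere V) : 0 < S.radialOnSphere u :=
  S.radialFun_pos (toEuclidean_symm_ne_zero u)

theorem measureReal_eq [MeasurableSpace V] [BorelSpace V] [Nontrivial V] (lam : Measure V)
    [lam.IsAddHaarMeasure] (S : StarBody V) :
    lam.real S.carrier = (1 / (finrank ℝ V : ℝ)) * ∫ u : RefSphere V,
      S.radialOnSphere u ^ finrank ℝ V
      ∂(lam.map (toEuclidean : V ≃L[ℝ] EuclideanSpace ℝ (Fin (finrank ℝ V)))).toSphere := by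
  have hn : 0 < finrank ℝ V := finrank_pos
  have : Nontrivial (EuclideanSpace ℝ (Fin (finrank ℝ V))) :=
    (toEuclidean (E := V)).symm.toEquiv.nontrivial
  have h := measureReal_eq_integral_toSphere
    (lam.map (toEuclidean : V ≃L[ℝ] EuclideanSpace ℝ (Fin (finrank ℝ V))))
    ((toEuclidean (E := V)).symm ⁻¹' S.carrier) S.radialOnSphere
    S.radialOnSphere.continuous.measurable S.radialOnSphere_pos (fun u t ht => by
      rw [radialOnSphere_apply, le_radialFun_iff S.isCompact S.starConvex S.zero_mem
        (toEuclidean_symm_ne_zero u) ht.le, Set.mem_preimage, map_smul])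
  rw [finrank_euclideanSpace_fin] at h
  have h2 := (toEuclidean (E := V)).toHomeomorph.measurableEmbedding.map_apply lam
    ((toEuclidean (E := V)).symm ⁻¹' S.carrier)
  have h3 : (toEuclidean (E := V)).toHomeomorph ⁻¹' ((toEuclidean (E := V)).symm ⁻¹' S.carrier) =
      S.carrier := by
    ext x
    simp
  rw [h3] at h2
  rw [← h, measureReal_def, measureReal_def, ← h2]
  rfl

/-- Smooth star bodies are dense in the radial topology. -/
theorem dense_isSmooth [Nontrivial V] : Dense {S : StarBody V | S.IsSmooth} := by
  intro S
  have hind : IsInducing (radialOnSphere : StarBody V → _) := ⟨rfl⟩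
  rw [hind.closure_eq_preimage_closure_image, Set.mem_preimage, Metric.mem_closure_iff]
  intro ε hε
  have hn : Nontrivial (EuclideanSpace ℝ (Fin (finrank ℝ V))) :=
    (toEuclidean (E := V)).symm.toEquiv.nontrivial
  obtain ⟨h, hh⟩ := ContinuousMap.exists_restrict_eq (Metric.isClosed_sphere
    (x := (0 : EuclideanSpace ℝ (Fin (finrank ℝ V)))) (ε := 1)) S.radialOnSphere
  have hh' : ∀ u : RefSphere V, h u = S.radialOnSphere u := fun u => congrArg (fun f => f u) hh
  obtain ⟨u₀, hu₀⟩ : ∃ u₀, ∀ u, S.radialOnSphere u₀ ≤ S.radialOnSphere u := by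
    have : Nonempty (RefSphere V) :=
      (NormedSpace.sphere_nonempty.2 zero_le_one).to_subtype
    obtain ⟨u₀, -, h⟩ := isCompact_univ.exists_isMinOn Set.univ_nonempty
      S.radialOnSphere.continuous.continuousOn
    exact ⟨u₀, fun u => h (Set.mem_univ u)⟩
  -- The Tietze extension of the radial function is smoothed. An error below its minimum on the
  -- sphere keeps `g` positive there.
  obtain ⟨g, hg, hgd, -⟩ := h.continuous.exists_contDiff_approx ⊤
    (continuous_const (y := min (ε / 2) (S.radialOnSphere u₀)))
    (fun _ => lt_min (half_pos hε) (S.radialOnSphere_pos u₀))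
  have hgpos : ∀ u : RefSphere V, 0 < g u := by
    intro u
    have h1 := (hgd u).trans_le (min_le_right _ _)
    rw [hh', Real.dist_eq] at h1
    linarith [(abs_lt.1 h1).1, hu₀ u]
  have hN : ∀ x : EuclideanSpace ℝ (Fin (finrank ℝ V)), x ≠ 0 →
      ∃ u : RefSphere V, ‖x‖⁻¹ • x = u := fun x hx => ⟨⟨‖x‖⁻¹ • x, by
        rw [mem_sphere_zero_iff_norm, norm_smul, norm_inv, norm_norm,
          inv_mul_cancel₀ (norm_ne_zero_iff.2 hx)]⟩, rfl⟩
  -- Homogeneous extension of degree `-1` from the sphere, as a radial function requires.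
  let ρ : V → ℝ := fun y => ‖toEuclidean y‖⁻¹ * g (‖toEuclidean y‖⁻¹ • toEuclidean y)
  have hsm : ContDiffOn ℝ ∞ ρ {0}ᶜ := by
    intro y hy
    have hy' : toEuclidean y ≠ 0 := by simpa using hy
    have h1 : ContDiffAt ℝ ∞ (fun y : V => toEuclidean y) y :=
      (toEuclidean (E := V)).contDiff.contDiffAt
    have h2 : ContDiffAt ℝ ∞ (fun y : V => ‖toEuclidean y‖⁻¹) y :=
      (h1.norm ℝ hy').inv (norm_ne_zero_iff.2 hy')
    exact (h2.mul (hg.contDiffAt.comp y (h2.smul h1))).contDiffWithinAt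
  obtain ⟨T, -, hT⟩ := exists_starBody ρ (fun x hx => by
      have hx' : toEuclidean x ≠ 0 := by simpa using hx
      obtain ⟨u, hu⟩ := hN _ hx'
      have := norm_pos_iff.2 hx'
      simp only [ρ, hu]
      exact mul_pos (inv_pos.2 this) (hgpos u))
    (fun t x ht => by
      simp only [ρ, map_smul, norm_smul, Real.norm_of_nonneg ht.le, mul_inv, smul_smul]
      rw [mul_assoc t⁻¹, mul_right_comm t⁻¹ _ t, inv_mul_cancel₀ ht.ne', one_mul]) hsm.continuousOn
  refine ⟨T.radialOnSphere, ⟨T, hsm.congr fun x hx => hT x hx, rfl⟩, ?_⟩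
  refine (ContinuousMap.dist_le (half_pos hε).le).2 (fun u => ?_) |>.trans_lt (half_lt_self hε)
  have h1 : T.radialOnSphere u = g u := by
    rw [radialOnSphere_apply, hT _ (toEuclidean_symm_ne_zero u)]
    simp [ρ, norm_eq_of_mem_sphere u]
  rw [h1, ← hh', dist_comm]
  exact (hgd u).le.trans (min_le_left _ _)

end StarBody

end StarBodies

/-! ### Dual surface area and the dual isoperimetric problem -/

section DualSurfaceArea

variable {V : Type u} [NormedAddCommGroup V] [NormedSpace ℝ V] [FiniteDimensional ℝ V]

instance isAddHaarMeasure_map_toEuclidean [MeasurableSpace V] [BorelSpace V] (lam : Measure V)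
    [lam.IsAddHaarMeasure] : (lam.map
      (toEuclidean : V ≃L[ℝ] EuclideanSpace ℝ (Fin (finrank ℝ V)))).IsAddHaarMeasure :=
  (toEuclidean (E := V)).isAddHaarMeasure_map lam

theorem prod_ite_eq_zero {n k : ℕ} (hn : n = k + 1) (a b : ℝ) :
    ∏ i : Fin n, (if (i : ℕ) = 0 then a else b) = a * b ^ k := by
  subst hn
  simp [Fin.prod_univ_succ]

theorem finrank_mul_dualMixedVolumeOne [MeasurableSpace V] [BorelSpace V] (lam : Measure V) {k : ℕ}
    (hV : finrank ℝ V = k + 1) (S T : StarBody V) :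
    (finrank ℝ V : ℝ) * dualMixedVolumeOne lam S T = ∫ u : RefSphere V,
      T.radialOnSphere u * S.radialOnSphere u ^ k
      ∂(lam.map (toEuclidean : V ≃L[ℝ] EuclideanSpace ℝ (Fin (finrank ℝ V)))).toSphere := by
  have hn : (finrank ℝ V : ℝ) ≠ 0 := by
    rw [hV]
    positivity
  rw [dualMixedVolumeOne, dualMixedVolume, ← mul_assoc, mul_one_div_cancel hn, one_mul]
  refine integral_congr_ae (ae_of_all _ fun u => ?_)
  refine Eq.trans ?_ (prod_ite_eq_zero hV (T.radialOnSphere u) (S.radialOnSphere u))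
  refine Finset.prod_congr rfl fun i _ => ?_
  split_ifs <;> rfl

theorem continuous_integral_continuousMap {X : Type*} [TopologicalSpace X] [CompactSpace X]
    [MeasurableSpace X] [OpensMeasurableSpace X] (ν : Measure X) [IsFiniteMeasure ν] :
    Continuous fun f : C(X, ℝ) => ∫ x, f x ∂ν := by
  have hint : ∀ f : C(X, ℝ), Integrable f ν := fun f =>
    Integrable.of_bound f.continuous.aestronglyMeasurable ‖f‖ (ae_of_all _ f.norm_coe_le_norm)
  refine (LipschitzWith.of_dist_le_mul (K := (ν.real Set.univ).toNNReal) fun f g => ?_).continuous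
  rw [Real.dist_eq, ← integral_sub (hint f) (hint g), ← Real.norm_eq_abs,
    Real.coe_toNNReal _ measureReal_nonneg, mul_comm]
  refine norm_integral_le_of_norm_le_const (ae_of_all _ fun x => ?_)
  rw [← dist_eq_norm]
  exact f.dist_apply_le_dist x

theorem continuous_dualMixedVolumeOne [MeasurableSpace V] [BorelSpace V] (lam : Measure V)
    [lam.IsAddHaarMeasure] {k : ℕ} (hV : finrank ℝ V = k + 1) (T : StarBody V) :
    Continuous fun S : StarBody V => (finrank ℝ V : ℝ) * dualMixedVolumeOne lam S T := by
  simp only [finrank_mul_dualMixedVolumeOne lam hV]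
  have h1 : Continuous fun S : StarBody V => T.radialOnSphere * S.radialOnSphere ^ k :=
    continuous_const.mul (continuous_induced_dom.pow k)
  exact (continuous_integral_continuousMap (X := RefSphere V)
    (lam.map (toEuclidean : V ≃L[ℝ] EuclideanSpace ℝ (Fin (finrank ℝ V)))).toSphere).comp h1

/-- Bernoulli's inequality for `b / a`. This Young inequality replaces Hölder's, since the bodies
compared have equal volume. -/
theorem pow_mul_le_add {k : ℕ} {a b : ℝ} (ha : 0 < a) (hb : 0 < b) :
    (k + 1) * (b * a ^ k) ≤ k * a ^ (k + 1) + b ^ (k + 1) := by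
  have h := one_add_mul_le_pow (a := b / a - 1)
    (by have : 0 < b / a := by positivity
        linarith) (k + 1)
  rw [add_sub_cancel, div_pow, le_div_iff₀ (by positivity)] at h
  push_cast at h
  have h2 : (1 + ((k : ℝ) + 1) * (b / a - 1)) * a ^ (k + 1) =
      (k + 1) * (b * a ^ k) - k * a ^ (k + 1) := by
    field_simp
    ring
  linarith

theorem integrable_continuousMap_toSphere [MeasurableSpace V] [BorelSpace V] (lam : Measure V)
    [lam.IsAddHaarMeasure] (f : C(RefSphere V, ℝ)) : Integrable f
      (lam.map (toEuclidean : V ≃L[ℝ] EuclideanSpace ℝ (Fin (finrank ℝ V)))).toSphere :=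
  Integrable.of_bound f.continuous.aestronglyMeasurable ‖f‖ (ae_of_all _ f.norm_coe_le_norm)

/-- Among star bodies of given volume, the dilate of `T` maximizes `S ↦ Ṽ(S[n-1], T)`. -/
theorem exists_dilate_isMax [Nontrivial V] [MeasurableSpace V] [BorelSpace V] (lam : Measure V)
    [lam.IsAddHaarMeasure] {k : ℕ} (hV : finrank ℝ V = k + 1) (T : StarBody V)
    {r : ℝ} (hr : 0 < r) :
    ∃ (c : ℝ) (D : StarBody V), 0 < c ∧ D.carrier = c • T.carrier ∧ lam.real D.carrier = r ∧
      ∀ S : StarBody V, lam.real S.carrier = r →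
        (finrank ℝ V : ℝ) * dualMixedVolumeOne lam S T ≤
          (finrank ℝ V : ℝ) * dualMixedVolumeOne lam D T := by
  have hT : 0 < lam.real T.carrier := by
    refine ENNReal.toReal_pos (Measure.measure_pos_of_mem_nhds _
      (mem_interior_iff_mem_nhds.1 T.zero_mem_interior)).ne' T.isCompact.measure_lt_top.ne
  -- Chosen so that `cⁿ` times the volume of `T` is `r`.
  let c : ℝ := (r / lam.real T.carrier) ^ ((finrank ℝ V : ℝ)⁻¹)
  have hc : 0 < c := Real.rpow_pos_of_pos (by positivity) _
  have hcn : c ^ finrank ℝ V = r / lam.real T.carrier :=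
    Real.rpow_inv_natCast_pow (by positivity) (by omega)
  let D : StarBody V :=
    { carrier := c • T.carrier
      isCompact := T.isCompact.smul c
      starConvex := by simpa using T.starConvex.smul c
      zero_mem_interior := by
        rw [interior_smul₀ hc.ne']
        exact ⟨0, T.zero_mem_interior, smul_zero c⟩
      continuousOn_radialFun :=
        (continuousOn_const.mul T.continuousOn_radialFun).congr
          fun x _ => radialFun_smul_set T.carrier x hc }
  have hDr : ∀ u, D.radialOnSphere u = c * T.radialOnSphere u := fun u =>
    radialFun_smul_set T.carrier _ hc
  have hDvol : lam.real D.carrier = r := by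
    have : lam.real (c • T.carrier) = r := by
      rw [measureReal_def, Measure.addHaar_smul, ENNReal.toReal_mul, ENNReal.toReal_ofReal
        (abs_nonneg _), abs_of_pos (by positivity), hcn, ← measureReal_def, div_mul_cancel₀ _ hT.ne']
    exact this
  refine ⟨c, D, hc, rfl, hDvol, fun S hS => ?_⟩
  rw [finrank_mul_dualMixedVolumeOne lam hV, finrank_mul_dualMixedVolumeOne lam hV]
  rw [S.measureReal_eq lam] at hS
  rw [D.measureReal_eq lam] at hDvol
  simp only [hV] at hS hDvol
  push_cast at hS hDvol
  set σ := (lam.map (toEuclidean : V ≃L[ℝ] EuclideanSpace ℝ (Fin (finrank ℝ V)))).toSphere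
  have hk : (0 : ℝ) < k + 1 := by positivity
  rw [one_div, inv_mul_eq_iff_eq_mul₀ hk.ne'] at hS hDvol
  -- As `T` is a dilate of `D`, it suffices to bound `∫ ρ_D ρ_S ^ k` by `∫ ρ_D ^ (k + 1)`.
  have hTD : ∀ u, T.radialOnSphere u = c⁻¹ * D.radialOnSphere u := fun u => by
    rw [hDr, inv_mul_cancel_left₀ hc.ne']
  simp only [hTD, mul_assoc]
  rw [integral_const_mul, integral_const_mul]
  refine mul_le_mul_of_nonneg_left ?_ (inv_nonneg.2 hc.le)
  have h1 : ∫ u, D.radialOnSphere u * D.radialOnSphere u ^ k ∂σ = (k + 1) * r := by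
    rw [← hDvol]
    refine integral_congr_ae (ae_of_all _ fun u => ?_)
    simp only
    ring
  -- The integrated Young inequality; the `(k + 1)`-st powers of both radial functions integrate to
  -- `(k + 1) * r`.
  have h2 : (k + 1) * ∫ u, D.radialOnSphere u * S.radialOnSphere u ^ k ∂σ ≤
      k * ((k + 1) * r) + (k + 1) * r := by
    nth_rw 1 [← hS]
    rw [← hDvol, ← integral_const_mul, ← integral_const_mul, ← integral_add]
    · refine integral_mono ?_ ?_ fun u =>
        pow_mul_le_add (S.radialOnSphere_pos u) (D.radialOnSphere_pos u)
      · exact integrable_continuousMap_toSphere lam (((k : ℝ) + 1) • (D.radialOnSphere * S.radialOnSphere ^ k))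
      · exact integrable_continuousMap_toSphere lam
          ((k : ℝ) • S.radialOnSphere ^ (k + 1) + D.radialOnSphere ^ (k + 1))
    · exact integrable_continuousMap_toSphere lam ((k : ℝ) • S.radialOnSphere ^ (k + 1))
    · exact integrable_continuousMap_toSphere lam (D.radialOnSphere ^ (k + 1))
  rw [h1]
  refine le_of_mul_le_mul_left (h2.trans_eq ?_) hk
  ring

namespace DefinitionOfVolume

variable (μ : DefinitionOfVolume.{u})

theorem exists_dualIsoperimetrix [Nontrivial V] {k : ℕ} (hV : finrank ℝ V = k + 1) :
    ∃ T : StarBody V, T.carrier = {x | (μ.dualRadial hV x)⁻¹ ≤ 1} ∧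
      ∀ x, x ≠ 0 → radialFun T.carrier x = μ.dualRadial hV x := by
  obtain ⟨T, hT, hTr⟩ := exists_starBody (μ.dualRadial hV) (fun x hx => μ.dualRadial_pos hV hx)
    (fun t x ht => by rw [μ.dualRadial_smul hV ht.ne', abs_of_pos ht])
    (fun x hx => (μ.continuousAt_dualRadial hV hx).continuousWithinAt)
  refine ⟨T, ?_, hTr⟩
  rw [hT]
  ext x
  rcases eq_or_ne x 0 with rfl | hx
  · simp [dualRadial_zero]
  · simp only [Set.mem_ofPred_eq, hx, false_or]
    rw [inv_le_one₀ (μ.dualRadial_pos hV hx)]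

/-- At `p = ρu` the tangent vectors are `ρ e_i` modulo `u`. The factor `ρ` in `μ(ρu ∧ ·)` cancels
the `ρ⁻¹` of the dual radial function at `ρu`, so `ρ ^ k` and the value at `u` remain, times the
constant `euclideanFactor`. -/
theorem smoothDualSurfaceArea_eq [MeasurableSpace V] [BorelSpace V] {k : ℕ}
    (hV : finrank ℝ V = k + 1) (T : StarBody V)
    (hT : ∀ x, x ≠ 0 → radialFun T.carrier x = μ.dualRadial hV x) (S : StarBody V)
    (hS : S.IsSmooth) :
    μ.smoothDualSurfaceArea S =
      (finrank ℝ V : ℝ) * dualMixedVolumeOne (μ.lebesgue V) S T := by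
  rw [finrank_mul_dualMixedVolumeOne _ hV, toSphere_map_lebesgue, integral_smul_measure,
    ENNReal.toReal_ofReal μ.euclideanFactor_pos.le, smul_eq_mul, ← integral_const_mul,
    smoothDualSurfaceArea, boundaryIntegral]
  refine integral_congr_ae (ae_of_all _ fun u => ?_)
  have hu := toEuclidean_symm_ne_zero u
  have hd : DifferentiableAt ℝ (fun x : EuclideanSpace ℝ (Fin (finrank ℝ V)) =>
      radialFun S.carrier (toEuclidean.symm x)) u := by
    have h1 : DifferentiableAt ℝ (radialFun S.carrier)
        (toEuclidean.symm (u : EuclideanSpace ℝ (Fin (finrank ℝ V)))) :=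
      (hS.contDiffAt (isOpen_compl_singleton.mem_nhds hu)).differentiableAt (by simp)
    exact h1.comp _ (toEuclidean (E := V)).symm.differentiableAt
  simp only [fderiv_radialParam _ _ _ hd]
  have hk := finrank_orthogonal_span u hV
  -- The index type of this basis involves the dimension of `u^⊥`; generalizing allows it to be
  -- rewritten as `k`.
  generalize stdOrthonormalBasis ℝ
    (Submodule.span ℝ {(u : EuclideanSpace ℝ (Fin (finrank ℝ V)))})ᗮ = e
  revert e
  rw [hk]
  intro e
  have hρ := S.radialOnSphere_pos u
  rw [StarBody.radialOnSphere_apply] at hρ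
  rw [StarBody.radialOnSphere_apply, StarBody.radialOnSphere_apply, hT _ hu, radialParam,
    μ.quotientDensity_eq hV (smul_ne_zero hρ.ne' hu), vol_cons_smul, μ.vol_cons_smul_add hV hu,
    μ.vol_cons_tangent u hV e, μ.dualRadial_smul hV hρ.ne', abs_of_pos hρ]
  field_simp

/-- The dual mixed volume is continuous in `S` and agrees with the surface area on a dense set, so
it is the limit that defines the extension. -/
theorem dualSurfaceArea_eq [Nontrivial V] [MeasurableSpace V] [BorelSpace V] {k : ℕ}
    (hV : finrank ℝ V = k + 1) (T : StarBody V)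
    (hT : ∀ x, x ≠ 0 → radialFun T.carrier x = μ.dualRadial hV x) (S : StarBody V) :
    μ.dualSurfaceArea S = (finrank ℝ V : ℝ) * dualMixedVolumeOne (μ.lebesgue V) S T := by
  refine extendFrom_eq (StarBody.dense_isSmooth S) ?_
  refine Tendsto.congr' ?_
    ((continuous_dualMixedVolumeOne (μ.lebesgue V) hV T).continuousAt.mono_left nhdsWithin_le_nhds)
  filter_upwards [self_mem_nhdsWithin] with S' hS'
  exact (μ.smoothDualSurfaceArea_eq hV T hT S' hS').symm

end DefinitionOfVolume

end DualSurfaceArea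

/-! ### First variation of the volume of `K + εL` -/

section MixedVolume

variable {X : Type*} [NormedAddCommGroup X] [NormedSpace ℝ X]

section Gauge

variable {K L : Set X}

theorem gauge_pos_of_isCompact (hK : IsCompact K) (h0 : (0 : X) ∈ interior K) {x : X}
    (hx : x ≠ 0) : 0 < gauge K x :=
  (gauge_pos (absorbent_nhds_zero (mem_interior_iff_mem_nhds.1 h0))
    ((NormedSpace.isVonNBounded_iff ℝ).2 hK.isBounded)).2 hx

theorem gauge_le_one_iff_mem (hK : IsCompact K) (hc : Convex ℝ K) (h0 : (0 : X) ∈ interior K)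
    (x : X) : gauge K x ≤ 1 ↔ x ∈ K := by
  rw [gauge_le_one_iff_mem_closure hc (mem_interior_iff_mem_nhds.1 h0), hK.isClosed.closure_eq]

theorem smul_mem_iff_le_inv_gauge (hK : IsCompact K) (hc : Convex ℝ K)
    (h0 : (0 : X) ∈ interior K) {x : X} (hx : x ≠ 0) {t : ℝ} (ht : 0 ≤ t) :
    t • x ∈ K ↔ t ≤ (gauge K x)⁻¹ := by
  have hg := gauge_pos_of_isCompact hK h0 hx
  rw [← gauge_le_one_iff_mem hK hc h0, gauge_smul_of_nonneg ht, smul_eq_mul, ← le_div_iff₀ hg,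
    one_div]

theorem radialFun_eq_inv_gauge (hK : IsCompact K) (hc : Convex ℝ K)
    (h0 : (0 : X) ∈ interior K) {x : X} (hx : x ≠ 0) : radialFun K x = (gauge K x)⁻¹ :=
  radialFun_eq_of_forall (inv_nonneg.2 (gauge_nonneg x))
    fun _ ht => smul_mem_iff_le_inv_gauge hK hc h0 hx ht

/-- Euler's relation for a function homogeneous of degree one. -/
theorem fderiv_gauge_self {u : X} (hd : DifferentiableAt ℝ (gauge K) u) :
    fderiv ℝ (gauge K) u u = gauge K u := by
  have h1 : HasDerivAt (fun t : ℝ => gauge K (t • u)) (fderiv ℝ (gauge K) u u) 1 := by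
    have h2 : HasDerivAt (fun t : ℝ => t • u) u 1 := by
      simpa using (hasDerivAt_id (1 : ℝ)).smul_const u
    have h3 : HasFDerivAt (gauge K) (fderiv ℝ (gauge K) u) ((1 : ℝ) • u) := by
      rw [one_smul]
      exact hd.hasFDerivAt
    exact h3.comp_hasDerivAt (1 : ℝ) h2
  have h4 : HasDerivAt (fun t : ℝ => gauge K (t • u)) (gauge K u) 1 := by
    have h5 : HasDerivAt (fun t : ℝ => t * gauge K u) (gauge K u) 1 := by
      simpa using (hasDerivAt_id (1 : ℝ)).mul_const (gauge K u)
    refine h5.congr_of_eventuallyEq ?_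
    filter_upwards [lt_mem_nhds (zero_lt_one (α := ℝ))] with t ht
    rw [gauge_smul_of_nonneg ht.le, smul_eq_mul]
  exact h1.unique h4

/-- Subadditivity bounds the difference quotients in direction `x`. Thus the derivative is at most
`1` on `K`: it is the conormal of a supporting hyperplane. -/
theorem fderiv_gauge_le (hc : Convex ℝ K) (h0 : (0 : X) ∈ interior K) {u : X}
    (hd : DifferentiableAt ℝ (gauge K) u) (x : X) : fderiv ℝ (gauge K) u x ≤ gauge K x := by
  have h2 : HasDerivAt (fun t : ℝ => u + t • x) x 0 := by
    simpa using ((hasDerivAt_id (0 : ℝ)).smul_const x).const_add u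
  have h3 : HasFDerivAt (gauge K) (fderiv ℝ (gauge K) u) (u + (0 : ℝ) • x) := by
    rw [zero_smul, add_zero]
    exact hd.hasFDerivAt
  have h4 := (h3.comp_hasDerivAt (0 : ℝ) h2).hasDerivWithinAt (s := Set.Ioi 0)
  rw [hasDerivWithinAt_iff_tendsto_slope' Set.self_notMem_Ioi] at h4
  refine le_of_tendsto h4 ?_
  filter_upwards [self_mem_nhdsWithin] with t ht
  have ht' : 0 < t := ht
  rw [slope_def_field, sub_zero, div_le_iff₀ ht']
  have := gauge_add_le hc (absorbent_nhds_zero (mem_interior_iff_mem_nhds.1 h0)) u (t • x)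
  rw [gauge_smul_of_nonneg ht'.le, smul_eq_mul] at this
  simp only [Function.comp_apply, zero_smul, add_zero]
  linarith

theorem subset_add_smul (hL : (0 : X) ∈ L) (ε : ℝ) : K ⊆ K + ε • L := fun x hx =>
  Set.mem_add.2 ⟨x, hx, 0, ⟨0, hL, smul_zero ε⟩, add_zero x⟩

theorem zero_mem_interior_add_smul (h0 : (0 : X) ∈ interior K) (hL : (0 : X) ∈ L) (ε : ℝ) :
    (0 : X) ∈ interior (K + ε • L) := interior_mono (subset_add_smul hL ε) h0

theorem add_zero_smul (hL : (0 : X) ∈ L) : K + (0 : ℝ) • L = K := by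
  rw [Set.zero_smul_set ⟨0, hL⟩, add_zero]

/-- The derivative of the radial function of `K + εL`. -/
theorem hasDerivWithinAt_inv_gauge_add_smul (hK : IsCompact K) (hc : Convex ℝ K)
    (h0 : (0 : X) ∈ interior K) (hL : IsCompact L) (hLc : Convex ℝ L) (hL0 : (0 : X) ∈ L)
    {u : X} (hu : u ≠ 0) (hd : DifferentiableAt ℝ (gauge K) u) :
    HasDerivWithinAt (fun ε : ℝ => (gauge (K + ε • L) u)⁻¹)
      ((gauge K u)⁻¹ * sSup (fderiv ℝ (gauge K) u '' L)) (Set.Ioi 0) 0 := by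
  set ξ := fderiv ℝ (gauge K) u with hξ
  have hg := gauge_pos_of_isCompact hK h0 hu
  obtain ⟨l, hl, hlmax⟩ := hL.exists_isMaxOn ⟨0, hL0⟩ ξ.continuous.continuousOn
  have hlmax' : ∀ y ∈ L, ξ y ≤ ξ l := fun y hy => hlmax hy
  have hsup : sSup (ξ '' L) = ξ l :=
    IsGreatest.csSup_eq ⟨⟨l, hl, rfl⟩, by rintro _ ⟨y, hy, rfl⟩; exact hlmax' y hy⟩
  set g := gauge K u with hgdef
  -- Lower and upper barriers with the same value and derivative at `0`. The lower one is chosen so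
  -- that the gauge estimate for `a ε • u - ε • l` gives exactly `1`; the upper one comes from
  -- applying `ξ` to a boundary point of `K + εL`.
  let a : ℝ → ℝ := fun ε => g⁻¹ * (2 - g⁻¹ * gauge K (u - (ε * g) • l))
  let b : ℝ → ℝ := fun ε => g⁻¹ * (1 + ε * ξ l)
  have ha : HasDerivAt a (g⁻¹ * ξ l) 0 := by
    have h2 : HasDerivAt (fun t : ℝ => u - (t * g) • l) (-(g • l)) 0 := by
      have := ((hasDerivAt_mul_const g (x := (0 : ℝ))).smul_const l).const_sub u
      simpa using this
    have h3 : HasFDerivAt (gauge K) ξ (u - ((0 : ℝ) * g) • l) := by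
      rw [zero_mul, zero_smul, sub_zero]
      exact hd.hasFDerivAt
    have h4 := (((h3.comp_hasDerivAt (0 : ℝ) h2).const_mul g⁻¹).const_sub 2).const_mul g⁻¹
    have h5 : g⁻¹ * -(g⁻¹ * ξ (-(g • l))) = g⁻¹ * ξ l := by
      rw [map_neg, map_smul, smul_eq_mul]
      field_simp
    rw [h5] at h4
    exact h4
  have hb : HasDerivAt b (g⁻¹ * ξ l) 0 := by
    have := ((hasDerivAt_mul_const (ξ l) (x := (0 : ℝ))).const_add 1).const_mul g⁻¹
    exact this
  have ha0 : a 0 = g⁻¹ := by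
    simp only [a, zero_mul, zero_smul, sub_zero]
    rw [← hgdef, inv_mul_cancel₀ hg.ne']
    ring
  have hb0 : b 0 = g⁻¹ := by simp [b]
  have hR0 : (gauge (K + (0 : ℝ) • L) u)⁻¹ = g⁻¹ := by rw [add_zero_smul hL0]
  have hcKL : ∀ ε : ℝ, Convex ℝ (K + ε • L) := fun ε => hc.add (hLc.smul ε)
  have hKL : ∀ ε : ℝ, IsCompact (K + ε • L) := fun ε => hK.add (hL.smul ε)
  have hup : ∀ ε : ℝ, 0 < ε → (gauge (K + ε • L) u)⁻¹ ≤ b ε := by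
    intro ε hε
    have h1 := (smul_mem_iff_le_inv_gauge (hKL ε) (hcKL ε) (zero_mem_interior_add_smul h0 hL0 ε) hu
      (inv_nonneg.2 (gauge_nonneg u))).2 le_rfl
    set R := (gauge (K + ε • L) u)⁻¹
    obtain ⟨x, hx, _, ⟨y, hy, rfl⟩, hxy⟩ := Set.mem_add.1 h1
    have h2 := congrArg ξ hxy
    rw [map_add, map_smul, map_smul, hξ, fderiv_gauge_self hd, ← hgdef, ← hξ, smul_eq_mul,
      smul_eq_mul] at h2
    have h3 : ξ x ≤ 1 := (fderiv_gauge_le hc h0 hd x).trans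
      ((gauge_le_one_iff_mem hK hc h0 x).2 hx)
    have h4 : ε * ξ y ≤ ε * ξ l := mul_le_mul_of_nonneg_left (hlmax' y hy) hε.le
    simp only [b]
    rw [inv_mul_eq_div, le_div_iff₀ hg]
    linarith
  have hlow : ∀ᶠ ε : ℝ in 𝓝[>] 0, a ε ≤ (gauge (K + ε • L) u)⁻¹ := by
    have hcont : ContinuousAt a 0 := ha.continuousAt
    have hpos : ∀ᶠ ε in 𝓝 (0 : ℝ), 0 < a ε :=
      hcont.eventually (lt_mem_nhds (by rw [ha0]; exact inv_pos.2 hg))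
    filter_upwards [nhdsWithin_le_nhds hpos, self_mem_nhdsWithin] with ε hε hε0
    have hε0' : 0 < ε := hε0
    rw [← smul_mem_iff_le_inv_gauge (hKL ε) (hcKL ε) (zero_mem_interior_add_smul h0 hL0 ε) hu hε.le]
    by_cases h1 : a ε ≤ g⁻¹
    · exact subset_add_smul hL0 ε
        ((smul_mem_iff_le_inv_gauge hK hc h0 hu hε.le).2 h1)
    · push Not at h1
      refine Set.mem_add.2 ⟨a ε • u - ε • l, ?_, ε • l, ⟨l, hl, rfl⟩, sub_add_cancel _ _⟩
      rw [← gauge_le_one_iff_mem hK hc h0]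
      -- Both coefficients are nonnegative, so subadditivity of the gauge applies.
      have h2 : a ε • u - ε • l = (a ε - g⁻¹) • u + g⁻¹ • (u - (ε * g) • l) := by
        rw [sub_smul, smul_sub, smul_smul, mul_comm ε, inv_mul_cancel_left₀ hg.ne']
        abel
      rw [h2]
      refine (gauge_add_le hc (absorbent_nhds_zero (mem_interior_iff_mem_nhds.1 h0)) _ _).trans ?_
      rw [gauge_smul_of_nonneg (sub_nonneg.2 h1.le), gauge_smul_of_nonneg (inv_nonneg.2 hg.le),
        smul_eq_mul, smul_eq_mul, ← hgdef]
      simp only [a]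
      rw [sub_mul, inv_mul_cancel₀ hg.ne', mul_right_comm, inv_mul_cancel₀ hg.ne', one_mul]
      linarith
  rw [hsup, hasDerivWithinAt_iff_tendsto_slope' Set.self_notMem_Ioi]
  have hta := ha.hasDerivWithinAt (s := Set.Ioi 0)
  have htb := hb.hasDerivWithinAt (s := Set.Ioi 0)
  rw [hasDerivWithinAt_iff_tendsto_slope' Set.self_notMem_Ioi] at hta htb
  refine tendsto_of_tendsto_of_tendsto_of_le_of_le' hta htb ?_ ?_
  · filter_upwards [hlow, self_mem_nhdsWithin] with ε h1 h2
    have h2' : 0 < ε := h2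
    rw [slope_def_field, slope_def_field, hR0, ha0, sub_zero]
    gcongr
  · filter_upwards [self_mem_nhdsWithin] with ε h2
    have h2' : 0 < ε := h2
    rw [slope_def_field, slope_def_field, hR0, hb0, sub_zero]
    gcongr
    exact hup ε h2'

end Gauge

section Measure

variable [FiniteDimensional ℝ X] [MeasurableSpace X] [BorelSpace X] [Nontrivial X]
  (μ : Measure X) [μ.IsAddHaarMeasure] {K L : Set X}

theorem measureReal_eq_integral_gauge (hK : IsCompact K) (hc : Convex ℝ K)
    (h0 : (0 : X) ∈ interior K) :
    μ.real K = (1 / (finrank ℝ X : ℝ)) *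
      ∫ u : Metric.sphere (0 : X) 1, (gauge K u)⁻¹ ^ finrank ℝ X ∂μ.toSphere :=
  measureReal_eq_integral_toSphere μ K (fun u => (gauge K u)⁻¹)
    ((continuous_gauge hc (mem_interior_iff_mem_nhds.1 h0)).measurable.comp
      measurable_subtype_coe).inv
    (fun u => inv_pos.2 (gauge_pos_of_isCompact hK h0 (ne_zero_of_mem_unit_sphere u)))
    fun u _ ht => smul_mem_iff_le_inv_gauge hK hc h0 (ne_zero_of_mem_unit_sphere u) ht.le

omit [Nontrivial X] in
-- The gauge is Lipschitz, so Rademacher's theorem applies in the whole space. By homogeneity,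
-- differentiability is constant on open rays; a non-null bad set on the sphere would span a
-- non-null cone.
theorem ae_toSphere_differentiableAt_gauge (hc : Convex ℝ K) (h0 : (0 : X) ∈ interior K) :
    ∀ᵐ u : Metric.sphere (0 : X) 1 ∂μ.toSphere, DifferentiableAt ℝ (gauge K) u := by
  obtain ⟨C, hC⟩ := hc.lipschitz_gauge (mem_interior_iff_mem_nhds.1 h0)
  have h1 : μ {x | ¬ DifferentiableAt ℝ (gauge K) x} = 0 := hC.ae_differentiableAt
  have hms : MeasurableSet {u : Metric.sphere (0 : X) 1 | ¬ DifferentiableAt ℝ (gauge K) u} :=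
    (measurable_subtype_coe (measurableSet_of_differentiableAt ℝ (gauge K))).compl
  rw [ae_iff, Measure.toSphere_apply' μ hms]
  refine mul_eq_zero_of_right _ (measure_mono_null ?_ h1)
  rintro _ ⟨t, ht, _, ⟨u, hu, rfl⟩, rfl⟩ hd
  refine hu ?_
  have ht0 : 0 < t := ht.1
  have h2 : DifferentiableAt ℝ (fun x : X => t⁻¹ * gauge K (t • x)) u := by
    refine DifferentiableAt.const_mul ?_ _
    exact DifferentiableAt.comp (u : X) (g := gauge K) (f := fun x : X => t • x) hd (by fun_prop)
  have h3 : (fun x : X => t⁻¹ * gauge K (t • x)) = gauge K := by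
    ext x
    rw [gauge_smul_of_nonneg ht0.le, smul_eq_mul, inv_mul_cancel_left₀ ht0.ne']
  rwa [h3] at h2

omit [FiniteDimensional ℝ X] [MeasurableSpace X] [BorelSpace X] [Nontrivial X] in
-- With `C` the maximum of the gauge of `K` on `L`, the sum `K + εL` lies in `(1 + Cε)K`. The bound
-- serves for dominated convergence.
theorem exists_inv_gauge_add_smul_le (hK : IsCompact K) (hc : Convex ℝ K)
    (h0 : (0 : X) ∈ interior K) (hL : IsCompact L) (hLc : Convex ℝ L) (hL0 : (0 : X) ∈ L) :
    ∃ C : ℝ, 0 ≤ C ∧ ∀ ε : ℝ, 0 ≤ ε → ∀ u : X, u ≠ 0 →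
      (gauge (K + ε • L) u)⁻¹ ≤ (1 + C * ε) * (gauge K u)⁻¹ := by
  obtain ⟨l, hl, hlmax⟩ := hL.exists_isMaxOn ⟨0, hL0⟩
    (continuous_gauge hc (mem_interior_iff_mem_nhds.1 h0)).continuousOn
  refine ⟨gauge K l, gauge_nonneg _, fun ε hε u hu => ?_⟩
  have hg := gauge_pos_of_isCompact hK h0 hu
  have h1 := (smul_mem_iff_le_inv_gauge (hK.add (hL.smul ε)) (hc.add (hLc.smul ε))
    (zero_mem_interior_add_smul h0 hL0 ε) hu (inv_nonneg.2 (gauge_nonneg u))).2 le_rfl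
  obtain ⟨x, hx, _, ⟨y, hy, rfl⟩, hxy⟩ := Set.mem_add.1 h1
  have h2 := gauge_add_le hc (absorbent_nhds_zero (mem_interior_iff_mem_nhds.1 h0)) x (ε • y)
  simp only at hxy
  rw [hxy, gauge_smul_of_nonneg (inv_nonneg.2 (gauge_nonneg u)), gauge_smul_of_nonneg hε,
    smul_eq_mul, smul_eq_mul] at h2
  have h3 := (gauge_le_one_iff_mem hK hc h0 x).2 hx
  have h4 : ε * gauge K y ≤ ε * gauge K l := mul_le_mul_of_nonneg_left (hlmax hy) hε
  rw [← div_eq_mul_inv, le_div_iff₀ hg]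
  linarith

/-- The first variation of the volume of `K + εL`. -/
theorem hasDerivWithinAt_measureReal_add_smul (hK : IsCompact K) (hc : Convex ℝ K)
    (h0 : (0 : X) ∈ interior K) (hL : IsCompact L) (hLc : Convex ℝ L) (hL0 : (0 : X) ∈ L) :
    HasDerivWithinAt (fun ε : ℝ => μ.real (K + ε • L))
      (∫ u : Metric.sphere (0 : X) 1, (gauge K u)⁻¹ ^ finrank ℝ X *
        sSup (fderiv ℝ (gauge K) (u : X) '' L) ∂μ.toSphere) (Set.Ici 0) 0 := by
  rw [← hasDerivWithinAt_Ioi_iff_Ici, hasDerivWithinAt_iff_tendsto_slope' Set.self_notMem_Ioi]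
  set n := finrank ℝ X with hn
  have hn0 : (0 : ℝ) < n := by exact_mod_cast finrank_pos (R := ℝ) (M := X)
  have hcKL : ∀ ε : ℝ, Convex ℝ (K + ε • L) := fun ε => hc.add (hLc.smul ε)
  have hKL : ∀ ε : ℝ, IsCompact (K + ε • L) := fun ε => hK.add (hL.smul ε)
  have hKL0 : ∀ ε : ℝ, (0 : X) ∈ interior (K + ε • L) := zero_mem_interior_add_smul h0 hL0
  let R : ℝ → Metric.sphere (0 : X) 1 → ℝ := fun ε u => (gauge (K + ε • L) u)⁻¹
  have hRc : ∀ ε, Continuous (R ε) := fun ε =>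
    ((continuous_gauge (hcKL ε) (mem_interior_iff_mem_nhds.1 (hKL0 ε))).comp
      continuous_subtype_val).inv₀
      fun u => (gauge_pos_of_isCompact (hKL ε) (hKL0 ε) (ne_zero_of_mem_unit_sphere u)).ne'
  have hR0 : ∀ u, R 0 u = (gauge K u)⁻¹ := fun u => by simp only [R, add_zero_smul hL0]
  have hRpos : ∀ ε u, 0 < R ε u := fun ε u =>
    inv_pos.2 (gauge_pos_of_isCompact (hKL ε) (hKL0 ε) (ne_zero_of_mem_unit_sphere u))
  have hint : ∀ f : Metric.sphere (0 : X) 1 → ℝ, Continuous f → Integrable f μ.toSphere :=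
    fun f hf => by
      have := Integrable.of_bound (μ := μ.toSphere) hf.aestronglyMeasurable
        ‖(⟨f, hf⟩ : C(Metric.sphere (0 : X) 1, ℝ))‖
        (ae_of_all _ (ContinuousMap.norm_coe_le_norm ⟨f, hf⟩))
      exact this
  have hslope : ∀ ε : ℝ, slope (fun ε : ℝ => μ.real (K + ε • L)) 0 ε =
      ∫ u, (1 / (n : ℝ)) * ((R ε u ^ n - R 0 u ^ n) / ε) ∂μ.toSphere := by
    intro ε
    have h1 : ∫ u, (R ε u ^ n - R 0 u ^ n) ∂μ.toSphere = _ :=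
      integral_sub (hint _ ((hRc ε).pow n)) (hint _ ((hRc 0).pow n))
    rw [slope_def_field, sub_zero, measureReal_eq_integral_gauge μ (hKL ε) (hcKL ε) (hKL0 ε),
      measureReal_eq_integral_gauge μ (hKL 0) (hcKL 0) (hKL0 0), ← mul_sub, integral_const_mul,
      integral_div, h1, mul_div_assoc]
  simp only [funext hslope]
  obtain ⟨C, hC, hCle⟩ := exists_inv_gauge_add_smul_le hK hc h0 hL hLc hL0
  refine tendsto_integral_filter_of_dominated_convergence
    (fun u => (1 / (n : ℝ)) * (R 0 u ^ n * (1 + C) ^ n)) ?_ ?_ ?_ ?_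
  · exact Eventually.of_forall fun ε =>
      (((((hRc ε).pow n).sub ((hRc 0).pow n)).div_const ε).const_mul _).aestronglyMeasurable
  · have hlt : ∀ᶠ ε : ℝ in 𝓝[>] 0, ε < 1 := nhdsWithin_le_nhds (gt_mem_nhds one_pos)
    filter_upwards [hlt, self_mem_nhdsWithin] with ε hε1 hε
    have hε' : 0 < ε := hε
    refine ae_of_all _ fun u => ?_
    have hu := ne_zero_of_mem_unit_sphere u
    have h1 : R 0 u ≤ R ε u := by
      rw [hR0, ← smul_mem_iff_le_inv_gauge (hKL ε) (hcKL ε) (hKL0 ε) hu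
        (inv_nonneg.2 (gauge_nonneg _))]
      exact subset_add_smul hL0 ε ((smul_mem_iff_le_inv_gauge hK hc h0 hu
        (inv_nonneg.2 (gauge_nonneg _))).2 le_rfl)
    have h2 : R ε u ≤ (1 + C * ε) * R 0 u := by
      rw [hR0]
      exact hCle ε hε'.le u hu
    -- Convexity of the power between `1` and `1 + C` bounds the difference quotient independently
    -- of `ε < 1`.
    have h3 : (1 + C * ε) ^ n ≤ (1 - ε) * 1 ^ n + ε * (1 + C) ^ n := by
      have := (convexOn_pow (𝕜 := ℝ) n).2 (x := 1) (y := 1 + C) (by simp)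
        (by simp only [Set.mem_Ici]; positivity)
        (sub_nonneg.2 hε1.le) hε'.le (sub_add_cancel 1 ε)
      simp only [smul_eq_mul] at this
      have h4 : (1 - ε) * 1 + ε * (1 + C) = 1 + C * ε := by ring
      rwa [h4] at this
    have h4 : R ε u ^ n ≤ ((1 + C * ε) * R 0 u) ^ n := pow_le_pow_left₀ (hRpos ε u).le h2 n
    have h5 : R 0 u ^ n ≤ R ε u ^ n := pow_le_pow_left₀ (hRpos 0 u).le h1 n
    have h6 : 0 < R 0 u ^ n := pow_pos (hRpos 0 u) n
    rw [Real.norm_of_nonneg (mul_nonneg (by positivity) (div_nonneg (sub_nonneg.2 h5) hε'.le))]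
    refine mul_le_mul_of_nonneg_left ?_ (by positivity)
    rw [div_le_iff₀ hε']
    rw [mul_pow] at h4
    have h7 := mul_le_mul_of_nonneg_right h3 h6.le
    rw [one_pow] at h7
    nlinarith [mul_pos hε' h6]
  · exact hint _ (continuous_const.mul (((hRc 0).pow n).mul continuous_const))
  · filter_upwards [ae_toSphere_differentiableAt_gauge μ hc h0] with u hd
    have hu := ne_zero_of_mem_unit_sphere u
    have h1 := (hasDerivWithinAt_inv_gauge_add_smul hK hc h0 hL hLc hL0 hu hd).pow n
    rw [hasDerivWithinAt_iff_tendsto_slope' Set.self_notMem_Ioi] at h1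
    have h2 := h1.const_mul (1 / (n : ℝ))
    have hn1 : n = n - 1 + 1 := (Nat.sub_add_cancel (finrank_pos (R := ℝ) (M := X))).symm
    have h3 : 1 / (n : ℝ) * (n * (gauge (K + (0 : ℝ) • L) (u : X))⁻¹ ^ (n - 1) *
        ((gauge K (u : X))⁻¹ * sSup (fderiv ℝ (gauge K) (u : X) '' L))) =
        (gauge K (u : X))⁻¹ ^ n * sSup (fderiv ℝ (gauge K) (u : X) '' L) := by
      rw [add_zero_smul hL0]
      nth_rw 4 [hn1]
      rw [pow_succ]
      field_simp
    rw [h3] at h2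
    refine h2.congr fun ε => ?_
    rw [slope_def_field, sub_zero]
    rfl

end Measure

end MixedVolume

/-! ### First variation in a general normed space -/

section FirstVariation

variable {E : Type u} [NormedAddCommGroup E] [NormedSpace ℝ E] [FiniteDimensional ℝ E]

theorem gauge_image_toEuclidean (K : Set E) (x : EuclideanSpace ℝ (Fin (finrank ℝ E))) :
    gauge (toEuclidean '' K) x = gauge K (toEuclidean.symm x) := by
  rw [gauge_def', gauge_def']
  congr 1
  ext r
  have : (toEuclidean : E ≃L[ℝ] EuclideanSpace ℝ (Fin (finrank ℝ E))) '' K =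
      (toEuclidean (E := E)).symm ⁻¹' K := (toEuclidean (E := E)).image_eq_preimage_symm K
  simp only [this, Set.mem_preimage, map_smul]

omit [NormedSpace ℝ E] [FiniteDimensional ℝ E] in
theorem zero_mem_interior_vadd {K : Set E} {x₀ : E} (hx₀ : x₀ ∈ interior K) :
    (0 : E) ∈ interior (-x₀ +ᵥ K) := by
  rw [interior_vadd]
  exact ⟨x₀, hx₀, by simp⟩

theorem zero_mem_interior_image {K : Set E} (h0 : (0 : E) ∈ interior K) :
    (0 : EuclideanSpace ℝ (Fin (finrank ℝ E))) ∈
      interior ((toEuclidean : E ≃L[ℝ] EuclideanSpace ℝ (Fin (finrank ℝ E))) '' K) := by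
  have h := (toEuclidean (E := E)).toHomeomorph.image_interior K
  have h2 : (0 : EuclideanSpace ℝ (Fin (finrank ℝ E))) ∈
      (toEuclidean (E := E)).toHomeomorph '' interior K := ⟨0, h0, map_zero (toEuclidean (E := E))⟩
  rw [h] at h2
  exact h2

/-- Translating `K` so that the origin becomes interior does not change the volume of `K + εL`, and
`toEuclidean` carries the integral to the reference sphere. -/
theorem hasDerivWithinAt_add_smul [Nontrivial E] [MeasurableSpace E] [BorelSpace E]
    (lam : Measure E) [lam.IsAddHaarMeasure] {K L : Set E} (hK : IsCompact K) (hc : Convex ℝ K)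
    {x₀ : E} (hx₀ : x₀ ∈ interior K) (hL : IsCompact L) (hLc : Convex ℝ L) (hL0 : (0 : E) ∈ L) :
    HasDerivWithinAt (fun ε : ℝ => lam.real (K + ε • L))
      (∫ u : RefSphere E,
        (gauge ((toEuclidean : E ≃L[ℝ] EuclideanSpace ℝ (Fin (finrank ℝ E))) '' (-x₀ +ᵥ K))
          u)⁻¹ ^ finrank ℝ E *
        sSup (fderiv ℝ (gauge (toEuclidean '' (-x₀ +ᵥ K)))
          (u : EuclideanSpace ℝ (Fin (finrank ℝ E))) '' (toEuclidean '' L))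
        ∂(lam.map (toEuclidean : E ≃L[ℝ] EuclideanSpace ℝ (Fin (finrank ℝ E)))).toSphere)
      (Set.Ici 0) 0 := by
  have : Nontrivial (EuclideanSpace ℝ (Fin (finrank ℝ E))) :=
    (toEuclidean (E := E)).symm.toEquiv.nontrivial
  have h := hasDerivWithinAt_measureReal_add_smul
    (lam.map (toEuclidean : E ≃L[ℝ] EuclideanSpace ℝ (Fin (finrank ℝ E))))
    (K := toEuclidean '' (-x₀ +ᵥ K)) (L := toEuclidean '' L)
    ((hK.vadd (-x₀)).image (toEuclidean (E := E)).continuous)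
    ((hc.vadd (-x₀)).linear_image (toEuclidean (E := E)).toLinearEquiv.toLinearMap)
    (zero_mem_interior_image (zero_mem_interior_vadd hx₀))
    (hL.image (toEuclidean (E := E)).continuous)
    (hLc.linear_image (toEuclidean (E := E)).toLinearEquiv.toLinearMap)
    ⟨0, hL0, map_zero _⟩
  have hfun : ∀ ε : ℝ, (lam.map (toEuclidean : E ≃L[ℝ] EuclideanSpace ℝ (Fin (finrank ℝ E)))).real
      (toEuclidean '' (-x₀ +ᵥ K) + ε • toEuclidean '' L) = lam.real (K + ε • L) := by
    intro ε
    have h1 : (toEuclidean : E ≃L[ℝ] EuclideanSpace ℝ (Fin (finrank ℝ E))) '' (-x₀ +ᵥ K) +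
        ε • (toEuclidean : E ≃L[ℝ] EuclideanSpace ℝ (Fin (finrank ℝ E))) '' L =
        (toEuclidean : E ≃L[ℝ] EuclideanSpace ℝ (Fin (finrank ℝ E))) '' (-x₀ +ᵥ (K + ε • L)) := by
      rw [← vadd_add_assoc, Set.image_add, image_smul_set]
    have h2 := (toEuclidean (E := E)).toHomeomorph.measurableEmbedding.map_apply lam
      ((toEuclidean : E ≃L[ℝ] EuclideanSpace ℝ (Fin (finrank ℝ E))) '' (-x₀ +ᵥ (K + ε • L)))
    have h3 : (toEuclidean (E := E)).toHomeomorph ⁻¹'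
        ((toEuclidean : E ≃L[ℝ] EuclideanSpace ℝ (Fin (finrank ℝ E))) '' (-x₀ +ᵥ (K + ε • L))) =
        -x₀ +ᵥ (K + ε • L) := Set.preimage_image_eq _ (toEuclidean (E := E)).injective
    rw [h3, measure_vadd] at h2
    rw [h1, measureReal_def, measureReal_def, ← h2]
    rfl
  simp only [hfun, finrank_euclideanSpace_fin] at h
  exact h

omit [FiniteDimensional ℝ E] in
theorem finrank_mul_mixedVolumeOne [MeasurableSpace E] {lam : Measure E} {K L : Set E} {d : ℝ}
    (hn : 0 < finrank ℝ E)
    (h : HasDerivWithinAt (fun ε : ℝ => lam.real (K + ε • L)) d (Set.Ici 0) 0) :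
    (finrank ℝ E : ℝ) * mixedVolumeOne lam K L = d := by
  have hn' : (finrank ℝ E : ℝ) ≠ 0 := by positivity
  rw [mixedVolumeOne, h.derivWithin (uniqueDiffWithinAt_Ici 0), ← mul_assoc,
    mul_one_div_cancel hn', one_mul]

theorem le_of_hasDerivWithinAt_Ici {f g : ℝ → ℝ} {a b : ℝ}
    (hf : HasDerivWithinAt f a (Set.Ici 0) 0) (hg : HasDerivWithinAt g b (Set.Ici 0) 0)
    (h0 : f 0 = g 0) (hfg : ∀ t, 0 < t → f t ≤ g t) : a ≤ b := by
  rw [← hasDerivWithinAt_Ioi_iff_Ici, hasDerivWithinAt_iff_tendsto_slope' Set.self_notMem_Ioi]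
    at hf hg
  refine le_of_tendsto_of_tendsto hf hg ?_
  filter_upwards [self_mem_nhdsWithin] with t ht
  have ht' : 0 < t := ht
  rw [slope_def_field, slope_def_field, sub_zero, h0]
  gcongr
  exact hfg t ht'

end FirstVariation

/-! ### Thin parallelepipeds determine a symmetric convex body -/

section Box

variable {E : Type u} [NormedAddCommGroup E] [NormedSpace ℝ E] [FiniteDimensional ℝ E] {k : ℕ}

/-- The parallelepiped of the points whose coordinates are bounded by `w`. -/
def coordBox {n : ℕ} (b : Basis (Fin n) ℝ E) (w : Fin n → ℝ) : Set E :=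
  b.equivFun.toContinuousLinearEquiv ⁻¹' Set.Icc (-w) w

theorem mem_coordBox {n : ℕ} (b : Basis (Fin n) ℝ E) (w : Fin n → ℝ) (x : E) :
    x ∈ coordBox b w ↔ ∀ i, |b.repr x i| ≤ w i := by
  simp only [coordBox, Set.mem_preimage, Set.mem_Icc, Pi.le_def, abs_le, ← forall_and]
  rfl

theorem isCompact_coordBox {n : ℕ} (b : Basis (Fin n) ℝ E) (w : Fin n → ℝ) :
    IsCompact (coordBox b w) :=
  b.equivFun.toContinuousLinearEquiv.toHomeomorph.isCompact_preimage.2 isCompact_Icc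

theorem convex_coordBox {n : ℕ} (b : Basis (Fin n) ℝ E) (w : Fin n → ℝ) :
    Convex ℝ (coordBox b w) :=
  (convex_Icc (-w) w).linear_preimage b.equivFun.toLinearMap

theorem zero_mem_interior_coordBox {n : ℕ} (b : Basis (Fin n) ℝ E) {w : Fin n → ℝ}
    (hw : ∀ i, 0 < w i) : (0 : E) ∈ interior (coordBox b w) := by
  rw [mem_interior_iff_mem_nhds]
  refine b.equivFun.toContinuousLinearEquiv.continuous.continuousAt.preimage_mem_nhds ?_
  rw [map_zero]
  exact pi_Icc_mem_nhds (fun i => by simpa using hw i) hw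

theorem exists_measureReal_coordBox [MeasurableSpace E] [BorelSpace E] (lam : Measure E)
    [lam.IsAddHaarMeasure] {n : ℕ} (b : Basis (Fin n) ℝ E) :
    ∃ C : ℝ, 0 < C ∧ ∀ w : Fin n → ℝ, (∀ i, 0 < w i) → lam.real (coordBox b w) = C * ∏ i, w i := by
  let e : E ≃L[ℝ] (Fin n → ℝ) := b.equivFun.toContinuousLinearEquiv
  have : (lam.map e).IsAddHaarMeasure := e.isAddHaarMeasure_map lam
  have h := Measure.isAddLeftInvariant_eq_smul (lam.map e) (volume : Measure (Fin n → ℝ))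
  set c := Measure.addHaarScalarFactor (lam.map e) (volume : Measure (Fin n → ℝ))
  have hw' : ∀ w : Fin n → ℝ, (∀ i, 0 < w i) →
      lam.real (coordBox b w) = (c * 2 ^ n) * ∏ i, w i := by
    intro w hw
    have h1 : (lam.map e) (Set.Icc (-w) w) = lam (coordBox b w) :=
      e.toHomeomorph.measurableEmbedding.map_apply lam _
    rw [measureReal_def, ← h1, h, Measure.smul_apply, Real.volume_Icc_pi]
    simp only [Pi.neg_apply, sub_neg_eq_add, ← two_mul]
    rw [← ENNReal.ofReal_prod_of_nonneg (fun i _ => by have := hw i; positivity),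
      Finset.prod_mul_distrib]
    have hp : 0 ≤ ∏ i, w i := Finset.prod_nonneg fun i _ => (hw i).le
    simp only [Finset.prod_const, Finset.card_univ, Fintype.card_fin]
    rw [ENNReal.smul_def, smul_eq_mul, ENNReal.toReal_mul, ENNReal.toReal_ofReal (by positivity),
      ENNReal.coe_toReal]
    ring
  refine ⟨c * 2 ^ n, ?_, hw'⟩
  have h1 := hw' 1 (fun _ => one_pos)
  have h2 : 0 < lam.real (coordBox b 1) :=
    ENNReal.toReal_pos (Measure.measure_pos_of_mem_nhds _ (mem_interior_iff_mem_nhds.1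
      (zero_mem_interior_coordBox b fun _ => one_pos))).ne'
      (isCompact_coordBox b 1).measure_lt_top.ne
  simp only [Pi.one_apply, Finset.prod_const_one, mul_one] at h1
  rwa [← h1]

/-- Completing `l` by a basis of the kernel of `φ` turns `φ` into a multiple of the zeroth
coordinate. -/
theorem exists_basis_of_functional (hE : finrank ℝ E = k + 1) (φ : StrongDual ℝ E) {l : E}
    (hl : φ l ≠ 0) : ∃ b : Basis (Fin (k + 1)) ℝ E, b 0 = l ∧ ∀ x, φ x = φ l * b.repr x 0 := by
  have hsurj : LinearMap.range (φ : E →ₗ[ℝ] ℝ) = ⊤ := by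
    rw [LinearMap.range_eq_top]
    refine LinearMap.surjective_of_ne_zero fun h0 => hl ?_
    exact LinearMap.congr_fun h0 l
  have h1 := LinearMap.finrank_range_add_finrank_ker (φ : E →ₗ[ℝ] ℝ)
  rw [hsurj, finrank_top, finrank_self, hE] at h1
  let w : Basis (Fin k) ℝ (LinearMap.ker (φ : E →ₗ[ℝ] ℝ)) :=
    (finBasis ℝ _).reindex (finCongr (by omega))
  have hw : ∀ i, φ (w i) = 0 := fun i => (w i).2
  have hli : LinearIndependent ℝ (Fin.cons l (fun i => (w i : E)) : Fin (k + 1) → E) := by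
    refine linearIndependent_finCons.2 ⟨?_, fun hmem => hl ?_⟩
    · exact w.linearIndependent.map' (Submodule.subtype _) (Submodule.ker_subtype _)
    · have : Submodule.span ℝ (Set.range fun i => (w i : E)) ≤ LinearMap.ker (φ : E →ₗ[ℝ] ℝ) := by
        rw [Submodule.span_le]
        rintro _ ⟨i, rfl⟩
        exact (w i).2
      exact this hmem
  let b := basisOfLinearIndependentOfCardEqFinrank hli (by simp [hE])
  have hb : ⇑b = Fin.cons l (fun i => (w i : E)) :=
    coe_basisOfLinearIndependentOfCardEqFinrank hli (by simp [hE])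
  have hb0 : b 0 = l := by rw [hb]; rfl
  refine ⟨b, hb0, fun x => ?_⟩
  have h2 : (φ : E →ₗ[ℝ] ℝ) = φ l • b.coord 0 := by
    refine b.ext fun i => ?_
    refine Fin.cases ?_ (fun j => ?_) i
    · have hr : b.repr l 0 = 1 := by rw [← hb0, b.repr_self, Finsupp.single_eq_same]
      simp [hb0, hr]
    · have h3 : b j.succ = w j := by rw [hb]; rfl
      have h4 : b.repr (b j.succ) 0 = 0 := by simp
      simp only [LinearMap.smul_apply, Basis.coord_apply, h4, smul_zero]
      rw [h3]
      exact hw j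
  exact LinearMap.congr_fun h2 x

/-- Mixed volumes with thin parallelepipeds determine the support function. -/
theorem exists_le_of_mixedVolumeOne_le [MeasurableSpace E] [BorelSpace E]
    (lam : Measure E) [lam.IsAddHaarMeasure] (hE : finrank ℝ E = k + 1) {L L' : Set E}
    (hL : IsCompact L) (hLc : Convex ℝ L) (hLs : -L = L) (hL0 : (0 : E) ∈ L)
    (hL' : IsCompact L') (hLc' : Convex ℝ L') (hLs' : -L' = L') (hL0' : (0 : E) ∈ L')
    (h : ∀ K : Set E, IsCompact K → Convex ℝ K → (interior K).Nonempty →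
      mixedVolumeOne lam K L ≤ mixedVolumeOne lam K L')
    (φ : StrongDual ℝ E) {l : E} (hl : l ∈ L) : ∃ l' ∈ L', φ l ≤ φ l' := by
  have hnt : Nontrivial E := nontrivial_of_finrank_pos (R := ℝ) (by omega)
  rcases le_or_gt (φ l) 0 with hle | hpos
  · exact ⟨0, hL0', by simpa using hle⟩
  obtain ⟨b, hb0, hbφ⟩ := exists_basis_of_functional hE φ hpos.ne'
  have hcont : ∀ i, Continuous fun x : E => b.repr x i := fun i =>
    (LinearMap.toContinuousLinearMap (b.coord i)).continuous
  obtain ⟨l', hl', hmax⟩ := hL'.exists_isMaxOn ⟨0, hL0'⟩ (hcont 0).continuousOn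
  refine ⟨l', hl', ?_⟩
  rw [hbφ l, hbφ l', ← hb0, b.repr_self, Finsupp.single_eq_same, hb0]
  refine mul_le_mul_of_nonneg_left ?_ hpos.le
  -- Here `a` is the maximum of the zeroth coordinate on `L'`, and `l` has zeroth coordinate `1`;
  -- the claim is now `1 ≤ a`.
  set a := b.repr l' 0 with ha
  have hneg : ∀ y ∈ L', -y ∈ L' := fun y hy => by
    rw [← hLs'] at hy
    exact hy
  have habs : ∀ y ∈ L', |b.repr y 0| ≤ a := fun y hy => by
    rw [abs_le]
    refine ⟨?_, hmax hy⟩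
    have h1 : b.repr (-y) 0 ≤ a := hmax (hneg y hy)
    rw [map_neg, Finsupp.neg_apply] at h1
    linarith
  have ha0 : 0 ≤ a := (abs_nonneg _).trans (habs 0 hL0')
  obtain ⟨M, hM⟩ : ∃ M : ℝ, ∀ y ∈ L', ∀ i, |b.repr y i| ≤ M := by
    have : ∀ i, ∃ M : ℝ, ∀ y ∈ L', |b.repr y i| ≤ M := fun i => by
      obtain ⟨M, hM⟩ := hL'.exists_bound_of_continuousOn (hcont i).continuousOn
      exact ⟨M, hM⟩
    choose M hM using this
    exact ⟨∑ i, |M i|, fun y hy i => (hM i y hy).trans ((le_abs_self _).trans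
      (Finset.single_le_sum (f := fun i => |M i|) (fun j _ => abs_nonneg _) (Finset.mem_univ i)))⟩
  have hM0 : 0 ≤ M := (abs_nonneg _).trans (hM 0 hL0' 0)
  obtain ⟨C, hC, hbox⟩ := exists_measureReal_coordBox lam b
  -- The box `K` has half-width `s` along `l` and `1` in the other directions. `K + εL` contains the
  -- box of half-widths `s + ε, 1`, and `K + εL'` lies in that of half-widths `s + εa, 1 + εM`.
  -- Comparing derivatives of volumes at `0` gives the claim; then `s → 0`.
  have key : ∀ s : ℝ, 0 < s → 1 ≤ a + s * (k * M) := by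
    intro s hs
    let w : ℝ → ℝ → Fin (k + 1) → ℝ := fun p q => Fin.cons p fun _ => q
    have hw : ∀ p q : ℝ, 0 < p → 0 < q → ∀ i, 0 < w p q i := fun p q hp hq i =>
      Fin.cases hp (fun _ => hq) i
    have hvol : ∀ p q : ℝ, 0 < p → 0 < q → lam.real (coordBox b (w p q)) = C * (p * q ^ k) :=
      fun p q hp hq => by
        rw [hbox _ (hw p q hp hq), Fin.prod_univ_succ]
        simp [w]
    let K := coordBox b (w s 1)
    have hKc : IsCompact K := isCompact_coordBox b _
    have hKv : Convex ℝ K := convex_coordBox b _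
    have hK0 : (0 : E) ∈ interior K := zero_mem_interior_coordBox b (hw s 1 hs one_pos)
    have d1 := hasDerivWithinAt_add_smul lam hKc hKv hK0 hL hLc hL0
    have d2 := hasDerivWithinAt_add_smul lam hKc hKv hK0 hL' hLc' hL0'
    have hn : 0 < finrank ℝ E := by omega
    have h12 := mul_le_mul_of_nonneg_left (h K hKc hKv ⟨0, hK0⟩)
      (Nat.cast_nonneg (α := ℝ) (finrank ℝ E))
    rw [finrank_mul_mixedVolumeOne hn d1, finrank_mul_mixedVolumeOne hn d2] at h12
    have e1 : HasDerivWithinAt (fun ε : ℝ => C * (s + ε)) C (Set.Ici 0) 0 := by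
      have := (((hasDerivAt_id (0 : ℝ)).const_add s).const_mul C).hasDerivWithinAt (s := Set.Ici 0)
      simpa using this
    have e2 : HasDerivWithinAt (fun ε : ℝ => C * ((s + ε * a) * (1 + ε * M) ^ k))
        (C * (a + s * (k * M))) (Set.Ici 0) 0 := by
      have h1 := (hasDerivAt_mul_const a (x := (0 : ℝ))).const_add s
      have h2 := ((hasDerivAt_mul_const M (x := (0 : ℝ))).const_add 1).pow k
      have h3 := ((h1.mul h2).const_mul C).hasDerivWithinAt (s := Set.Ici 0)
      simpa using h3
    have hK0' : lam.real K = C * s := by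
      rw [hvol s 1 hs one_pos, one_pow, mul_one]
    have g1 := le_of_hasDerivWithinAt_Ici e1 d1 (by
        rw [add_zero_smul hL0, hK0', add_zero]) (fun ε hε => by
      have h1 : coordBox b (w (s + ε) 1) ⊆ K + ε • L := by
        intro x hx
        rw [mem_coordBox] at hx
        have hx0 : |b.repr x 0| ≤ s + ε := hx 0
        have hsε : 0 < s + ε := by linarith
        -- The shift along `l` is proportional to the zeroth coordinate, so the remainder has
        -- coordinate `t * s`, of modulus at most `s`.
        let t : ℝ := b.repr x 0 / (s + ε)
        have ht : |t| ≤ 1 := by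
          rw [abs_div, abs_of_pos hsε]
          exact (div_le_one hsε).2 hx0
        have htl : t • l ∈ L := by
          have hln : -l ∈ L := by
            rw [← hLs]
            simpa using hl
          have := hLc hln hl (a := (1 - t) / 2) (b := (1 + t) / 2)
            (by linarith [(abs_le.1 ht).2]) (by linarith [(abs_le.1 ht).1]) (by ring)
          have h3 : ((1 - t) / 2) • -l + ((1 + t) / 2) • l = t • l := by
            rw [smul_neg, ← neg_smul, ← add_smul]
            congr 1
            ring
          rwa [h3] at this
        refine Set.mem_add.2 ⟨x - ε • t • l, ?_, ε • t • l, ⟨t • l, htl, rfl⟩, sub_add_cancel _ _⟩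
        rw [mem_coordBox]
        intro i
        refine Fin.cases ?_ (fun j => ?_) i
        · have h3 : b.repr (x - ε • t • l) 0 = t * s := by
            rw [map_sub, map_smul, map_smul, ← hb0, b.repr_self]
            simp only [Finsupp.sub_apply, Finsupp.smul_apply, Finsupp.single_eq_same, smul_eq_mul,
              mul_one]
            have : b.repr x 0 = t * (s + ε) := (div_mul_cancel₀ _ hsε.ne').symm
            rw [this]
            ring
          rw [h3, abs_mul, abs_of_pos hs]
          exact mul_le_of_le_one_left hs.le ht
        · have h3 : b.repr (x - ε • t • l) j.succ = b.repr x j.succ := by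
            rw [map_sub, map_smul, map_smul, ← hb0, b.repr_self]
            simp
          rw [h3]
          exact hx j.succ
      have h2 := measureReal_mono (μ := lam) h1
        (hKc.add (hL.smul ε)).measure_lt_top.ne
      rw [hvol _ _ (by linarith) one_pos, one_pow, mul_one] at h2
      exact h2)
    have g2 := le_of_hasDerivWithinAt_Ici d2 e2 (by
        rw [add_zero_smul hL0', hK0']
        simp) (fun ε hε => by
      have h1 : K + ε • L' ⊆ coordBox b (w (s + ε * a) (1 + ε * M)) := by
        intro x hx
        obtain ⟨y, hy, _, ⟨z, hz, rfl⟩, rfl⟩ := Set.mem_add.1 hx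
        rw [mem_coordBox] at hy ⊢
        have h3 : ∀ i, |b.repr (y + ε • z) i| ≤ |b.repr y i| + ε * |b.repr z i| := by
          intro i
          rw [map_add, map_smul, Finsupp.add_apply, Finsupp.smul_apply, smul_eq_mul]
          refine (abs_add_le _ _).trans ?_
          rw [abs_mul, abs_of_pos hε]
        intro i
        refine Fin.cases ?_ (fun j => ?_) i
        · exact (h3 0).trans (add_le_add (hy 0) (mul_le_mul_of_nonneg_left (habs z hz) hε.le))
        · exact (h3 j.succ).trans
            (add_le_add (hy j.succ) (mul_le_mul_of_nonneg_left (hM z hz _) hε.le))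
      have h2 := measureReal_mono (μ := lam) h1 (isCompact_coordBox b _).measure_lt_top.ne
      rwa [hvol _ _ (by positivity) (by positivity)] at h2)
    exact le_of_mul_le_mul_left ((mul_one C).le.trans (g1.trans (h12.trans g2))) hC
  have ht : Tendsto (fun s : ℝ => a + s * (k * M)) (𝓝[>] 0) (𝓝 a) := by
    have : Continuous fun s : ℝ => a + s * (k * M) := by fun_prop
    have h1 := (this.tendsto 0).mono_left (nhdsWithin_le_nhds (s := Set.Ioi 0))
    simpa using h1
  refine ge_of_tendsto ht ?_
  filter_upwards [self_mem_nhdsWithin] with s hs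
  exact key s hs

omit [FiniteDimensional ℝ E] in
theorem subset_of_forall_functional {L L' : Set E} (hL' : IsCompact L') (hLc' : Convex ℝ L')
    (h : ∀ (φ : StrongDual ℝ E), ∀ l ∈ L, ∃ l' ∈ L', φ l ≤ φ l') : L ⊆ L' := by
  intro l hl
  by_contra hl'
  obtain ⟨φ, c, hφ, hc⟩ := geometric_hahn_banach_closed_point hLc' hL'.isClosed hl'
  obtain ⟨l', hl', hle⟩ := h φ l hl
  linarith [hφ l' hl']

end Box

/-! ### Surface area of convex bodies in terms of the conormal -/

section SurfaceArea

variable {E : Type u} [NormedAddCommGroup E] [NormedSpace ℝ E] [FiniteDimensional ℝ E] {k : ℕ}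

/-- The boundary integral over a convex body of a density that is a function of the conormal. -/
theorem boundaryIntegral_inducedDensity [MeasurableSpace E] [BorelSpace E]
    (ν : DefinitionOfVolume.{u}) (hE : finrank ℝ E = k + 1) (G : StrongDual ℝ E → ℝ)
    (hG : ∀ φ : StrongDual ℝ E, φ ≠ 0 → ∀ (ξ₀ : E) (ξ : Fin k → E), (∀ i, φ (ξ i) = 0) →
      ν.inducedDensity ξ * |φ ξ₀| = G φ * ν.vol (Fin.cons ξ₀ ξ : Fin (k + 1) → E))
    {K : Set E} (hK : IsCompact K) (hc : Convex ℝ K) (h0 : (0 : E) ∈ interior K) :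
    boundaryIntegral (fun _ _ v => ν.inducedDensity v) K =
      ∫ u : RefSphere E,
        (gauge ((toEuclidean : E ≃L[ℝ] EuclideanSpace ℝ (Fin (finrank ℝ E))) '' K)
          u)⁻¹ ^ finrank ℝ E *
        G ((fderiv ℝ (gauge (toEuclidean '' K)) (u : EuclideanSpace ℝ (Fin (finrank ℝ E)))).comp
          ((toEuclidean : E ≃L[ℝ] EuclideanSpace ℝ (Fin (finrank ℝ E))) : E →L[ℝ] _))
        ∂((ν.lebesgue E).map
          (toEuclidean : E ≃L[ℝ] EuclideanSpace ℝ (Fin (finrank ℝ E)))).toSphere := by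
  rw [ν.toSphere_map_lebesgue, integral_smul_measure, ENNReal.toReal_ofReal
    ν.euclideanFactor_pos.le, smul_eq_mul, ← integral_const_mul, boundaryIntegral]
  set K' := (toEuclidean : E ≃L[ℝ] EuclideanSpace ℝ (Fin (finrank ℝ E))) '' K with hK'
  have hK'c : IsCompact K' := hK.image (toEuclidean (E := E)).continuous
  have hK'v : Convex ℝ K' := hc.linear_image (toEuclidean (E := E)).toLinearEquiv.toLinearMap
  have hK'0 : (0 : EuclideanSpace ℝ (Fin (finrank ℝ E))) ∈ interior K' := zero_mem_interior_image h0
  refine integral_congr_ae ?_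
  filter_upwards [ae_toSphere_differentiableAt_gauge
    (volume : Measure (EuclideanSpace ℝ (Fin (finrank ℝ E)))) hK'v hK'0] with u hd
  have hu0 := ne_zero_of_mem_unit_sphere u
  have hu := toEuclidean_symm_ne_zero u
  have hg := gauge_pos_of_isCompact hK'c hK'0 hu0
  have hrad : ∀ x : EuclideanSpace ℝ (Fin (finrank ℝ E)), x ≠ 0 →
      radialFun K (toEuclidean.symm x) = (gauge K' x)⁻¹ := by
    intro x hx
    rw [radialFun_eq_inv_gauge hK hc h0 (by simpa using hx), gauge_image_toEuclidean]
  have hdr : HasFDerivAt (fun x : EuclideanSpace ℝ (Fin (finrank ℝ E)) =>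
      radialFun K (toEuclidean.symm x))
      (-(gauge K' (u : EuclideanSpace ℝ (Fin (finrank ℝ E))) ^ 2)⁻¹ •
        fderiv ℝ (gauge K') (u : EuclideanSpace ℝ (Fin (finrank ℝ E)))) u := by
    refine ((hasDerivAt_inv hg.ne').comp_hasFDerivAt _ hd.hasFDerivAt).congr_of_eventuallyEq ?_
    filter_upwards [isOpen_ne.mem_nhds hu0] with x hx
    exact hrad x hx
  simp only [fderiv_radialParam _ _ _ hdr.differentiableAt, hdr.fderiv, hrad _ hu0]
  have hk := finrank_orthogonal_span u hE
  generalize stdOrthonormalBasis ℝ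
    (Submodule.span ℝ {(u : EuclideanSpace ℝ (Fin (finrank ℝ E)))})ᗮ = e
  revert e
  rw [hk]
  intro e
  set g := gauge K' (u : EuclideanSpace ℝ (Fin (finrank ℝ E))) with hgdef
  set D := fderiv ℝ (gauge K') (u : EuclideanSpace ℝ (Fin (finrank ℝ E))) with hD
  have hDu : D u = g := fderiv_gauge_self hd
  let φ : StrongDual ℝ E := D.comp
    ((toEuclidean : E ≃L[ℝ] EuclideanSpace ℝ (Fin (finrank ℝ E))) : E →L[ℝ] _)
  have hφu : φ (toEuclidean.symm (u : EuclideanSpace ℝ (Fin (finrank ℝ E)))) = g := by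
    simp [φ, hDu]
  have hφ : φ ≠ 0 := by
    intro h
    rw [h] at hφu
    exact hg.ne hφu
  -- The tangent vectors `g⁻¹ e_i - g⁻² D(e_i) u` are killed by `D` because `D u = g`. With `u` as
  -- transversal vector, the density is `G φ` times `g⁻ᵏ g⁻¹`, up to the constant `euclideanFactor`.
  have h1 := hG φ hφ (toEuclidean.symm (u : EuclideanSpace ℝ (Fin (finrank ℝ E))))
    (fun i => g⁻¹ • toEuclidean.symm (e i : EuclideanSpace ℝ (Fin (finrank ℝ E))) +
      ((-(g ^ 2)⁻¹ • D) (e i : EuclideanSpace ℝ (Fin (finrank ℝ E)))) •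
        toEuclidean.symm (u : EuclideanSpace ℝ (Fin (finrank ℝ E)))) (by
      intro i
      rw [map_add, map_smul, map_smul, hφu]
      simp only [φ, ContinuousLinearMap.comp_apply, ContinuousLinearEquiv.coe_coe,
        ContinuousLinearEquiv.apply_symm_apply, smul_apply, smul_eq_mul]
      field_simp
      ring)
  rw [hφu, ν.vol_cons_smul_add hE hu, ν.vol_cons_tangent u hE e, abs_of_pos hg,
    abs_of_pos (inv_pos.2 hg), ← eq_div_iff hg.ne'] at h1
  have hpow : g⁻¹ ^ finrank ℝ E = g⁻¹ ^ k * g⁻¹ := by rw [hE, pow_succ]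
  rw [h1, hpow, div_eq_mul_inv]
  ring

end SurfaceArea

/-! ### Existence and uniqueness of the isoperimetrix of the dual space -/

section Isoperimetrix

variable {V : Type u} [NormedAddCommGroup V] [NormedSpace ℝ V] [FiniteDimensional ℝ V] {k : ℕ}

theorem exists_evaluation (φ : StrongDual ℝ (StrongDual ℝ V)) :
    ∃ x : V, ∀ ξ : StrongDual ℝ V, φ ξ = ξ x := by
  let J : V →ₗ[ℝ] StrongDual ℝ (StrongDual ℝ V) :=
    { toFun := fun x => NormedSpace.inclusionInDoubleDual ℝ V x
      map_add' := fun x y => map_add _ x y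
      map_smul' := fun c x => map_smul _ c x }
  have hinj : Function.Injective J := (NormedSpace.inclusionInDoubleDualLi ℝ (E := V)).injective
  have h : finrank ℝ V = finrank ℝ (StrongDual ℝ (StrongDual ℝ V)) :=
    (finrank_strongDual_eq (StrongDual ℝ V) (finrank_strongDual_eq V rfl)).symm
  obtain ⟨x, hx⟩ := (LinearMap.injective_iff_surjective_of_finrank_eq_finrank h).1 hinj φ
  exact ⟨x, fun ξ => by rw [← hx]; rfl⟩

/-- The unit ball of the norm dual to a sublinear function. -/
def dualBall (G : V → ℝ) : Set (StrongDual ℝ V) := {ξ | ∀ x, ξ x ≤ G x}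

/-- Hahn–Banach: the functional with value `G x` at `x` is dominated by `G` on the line through `x`
and extends. Hence `G` is the support function of `dualBall G`. -/
theorem exists_mem_dualBall_eq {G : V → ℝ} (hadd : ∀ x y, G (x + y) ≤ G x + G y)
    (hsmul : ∀ (t : ℝ) (x : V), G (t • x) = |t| * G x) (hnn : ∀ x, 0 ≤ G x) {x : V} (hx : x ≠ 0) :
    ∃ ξ ∈ dualBall G, ξ x = G x := by
  obtain ⟨g, hg, hgG⟩ := exists_extension_of_le_sublinear
    (LinearPMap.mkSpanSingleton (K := ℝ) x (G x) hx) G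
    (fun c hc y => by rw [hsmul, abs_of_pos hc]) hadd (by
      rintro ⟨y, hy⟩
      obtain ⟨t, rfl⟩ := Submodule.mem_span_singleton.1 hy
      refine (LinearPMap.mkSpanSingleton'_apply _ _ _ t hy).trans_le ?_
      rw [RingHom.id_apply, hsmul, smul_eq_mul]
      exact mul_le_mul_of_nonneg_right (le_abs_self t) (hnn x))
  refine ⟨LinearMap.toContinuousLinearMap g, fun y => hgG y, ?_⟩
  have h1 := hg ⟨x, Submodule.mem_span_singleton_self x⟩
  rw [LinearPMap.mkSpanSingleton_apply] at h1
  exact h1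

theorem isCompact_dualBall {G : V → ℝ} {M : ℝ} (hM : ∀ x, G x ≤ M * ‖x‖) :
    IsCompact (dualBall G) := by
  refine Metric.isCompact_of_isClosed_isBounded ?_ ?_
  · have : dualBall G = ⋂ x, {ξ : StrongDual ℝ V | ξ x ≤ G x} := by
      ext ξ
      simp [dualBall]
    rw [this]
    refine isClosed_iInter fun x => isClosed_le ?_ continuous_const
    exact (NormedSpace.inclusionInDoubleDual ℝ V x).continuous
  · refine (Metric.isBounded_closedBall (x := (0 : StrongDual ℝ V)) (r := |M|)).subset fun ξ hξ => ?_
    rw [mem_closedBall_zero_iff]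
    refine ContinuousLinearMap.opNorm_le_bound _ (abs_nonneg M) fun x => ?_
    have h1 : ∀ y, G y ≤ |M| * ‖y‖ := fun y =>
      (hM y).trans (mul_le_mul_of_nonneg_right (le_abs_self M) (norm_nonneg y))
    rw [Real.norm_eq_abs, abs_le]
    have h2 := (hξ (-x)).trans (h1 (-x))
    rw [map_neg, norm_neg] at h2
    exact ⟨by linarith, (hξ x).trans (h1 x)⟩

omit [FiniteDimensional ℝ V] in
theorem convex_dualBall (G : V → ℝ) : Convex ℝ (dualBall G) := by
  intro ξ hξ η hη a b ha hb hab x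
  have h1 := mul_le_mul_of_nonneg_left (hξ x) ha
  have h2 := mul_le_mul_of_nonneg_left (hη x) hb
  have h3 : (a • ξ + b • η) x = a * ξ x + b * η x := rfl
  rw [h3]
  calc _ ≤ a * G x + b * G x := add_le_add h1 h2
    _ = G x := by rw [← add_mul, hab, one_mul]

omit [FiniteDimensional ℝ V] in
theorem neg_dualBall {G : V → ℝ} (hneg : ∀ x, G (-x) = G x) : -dualBall G = dualBall G := by
  ext ξ
  simp only [Set.mem_neg, dualBall, Set.mem_ofPred_eq]
  constructor
  · intro h x
    have := h (-x)
    rwa [hneg, map_neg, neg_apply, neg_neg] at this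
  · intro h x
    have := h (-x)
    rwa [hneg, map_neg] at this

/-- The bipolar theorem for the unit ball of `G`: the bound `1` is tested on a functional that
attains `G x`. -/
theorem polarOfDual_dualBall {G : V → ℝ} (hadd : ∀ x y, G (x + y) ≤ G x + G y)
    (hsmul : ∀ (t : ℝ) (x : V), G (t • x) = |t| * G x) (hnn : ∀ x, 0 ≤ G x) :
    polarOfDual (dualBall G) = {x | G x ≤ 1} := by
  ext x
  refine ⟨fun h => ?_, fun h ξ hξ => (hξ x).trans h⟩
  rcases eq_or_ne x 0 with rfl | hx
  · have := hsmul 0 0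
    rw [smul_zero, abs_zero, zero_mul] at this
    simp [this]
  · obtain ⟨ξ, hξ, hξx⟩ := exists_mem_dualBall_eq hadd hsmul hnn hx
    rw [Set.mem_ofPred_eq, ← hξx]
    exact h ξ hξ

namespace DefinitionOfVolume

variable (μ : DefinitionOfVolume.{u})

/-- The gauge of the dual isoperimetrix. -/
def dualGauge (hV : finrank ℝ V = k + 1) (x : V) : ℝ := (μ.dualRadial hV x)⁻¹

theorem dualGauge_smul (hV : finrank ℝ V = k + 1) (t : ℝ) (x : V) :
    μ.dualGauge hV (t • x) = |t| * μ.dualGauge hV x := by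
  rcases eq_or_ne t 0 with rfl | ht
  · simp [dualGauge, dualRadial_zero]
  · rw [dualGauge, μ.dualRadial_smul hV ht, mul_inv, inv_inv, dualGauge]

theorem dualGauge_nonneg (hV : finrank ℝ V = k + 1) (x : V) : 0 ≤ μ.dualGauge hV x := by
  rcases eq_or_ne x 0 with rfl | hx
  · simp [dualGauge, dualRadial_zero]
  · exact (inv_pos.2 (μ.dualRadial_pos hV hx)).le

theorem exists_dualGauge_le (hV : finrank ℝ V = k + 1) :
    ∃ M : ℝ, ∀ x : V, μ.dualGauge hV x ≤ M * ‖x‖ := by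
  have hsub : ∀ x ∈ Metric.sphere (0 : V) 1, x ≠ 0 := fun x hx =>
    ne_zero_of_mem_unit_sphere ⟨x, hx⟩
  have hcont : ContinuousOn (μ.dualGauge hV) (Metric.sphere (0 : V) 1) := fun x hx =>
    ((μ.continuousAt_dualRadial hV (hsub x hx)).inv₀
      (μ.dualRadial_pos hV (hsub x hx)).ne').continuousWithinAt
  obtain ⟨M, hM⟩ := (isCompact_sphere (0 : V) 1).exists_bound_of_continuousOn hcont
  refine ⟨M, fun x => ?_⟩
  rcases eq_or_ne x 0 with rfl | hx
  · simp [dualGauge, dualRadial_zero]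
  · have hx' : 0 < ‖x‖ := norm_pos_iff.2 hx
    have h1 := (le_abs_self _).trans (hM (‖x‖⁻¹ • x) (by
      rw [mem_sphere_zero_iff_norm, norm_smul, norm_inv, norm_norm, inv_mul_cancel₀ hx'.ne']))
    rw [dualGauge_smul, abs_of_pos (inv_pos.2 hx'), inv_mul_le_iff₀ hx'] at h1
    rwa [mul_comm]

/-- Surface area and mixed volume are integrals of `g⁻ⁿ` times a function of the conormal. A nonzero
conormal is evaluation at some `x ∈ V`; both functions take the value `dualGauge x` there, one by
`dual_inducedDensity_eq`, the other as support function of the dual ball. Convexity enters through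
that support function. -/
theorem isIsoperimetrix_dualBall (hV : finrank ℝ V = k + 1) (hμ : μ.dual.IsConvex) :
    μ.dual.IsIsoperimetrix (dualBall (μ.dualGauge hV)) := by
  have hE : finrank ℝ (StrongDual ℝ V) = k + 1 := finrank_strongDual_eq V hV
  have hnt : Nontrivial (StrongDual ℝ V) := nontrivial_of_finrank_pos (R := ℝ) (by omega)
  obtain ⟨M, hM⟩ := μ.exists_dualGauge_le hV
  have hzero : (0 : StrongDual ℝ V) ∈ dualBall (μ.dualGauge hV) := fun x =>
    μ.dualGauge_nonneg hV x
  have hsymm : -dualBall (μ.dualGauge hV) = dualBall (μ.dualGauge hV) := neg_dualBall fun x => by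
    have := μ.dualGauge_smul hV (-1) x
    simpa using this
  refine ⟨⟨0, hzero⟩, isCompact_dualBall hM, convex_dualBall _, hsymm, fun K hK hKc hKi => ?_⟩
  let G : StrongDual ℝ (StrongDual ℝ V) → ℝ := fun φ => sSup (φ '' dualBall (μ.dualGauge hV))
  have hGeq : ∀ (φ : StrongDual ℝ (StrongDual ℝ V)) (x : V), x ≠ 0 → (∀ ξ, φ ξ = ξ x) →
      G φ = μ.dualGauge hV x := by
    intro φ x hx hφ
    obtain ⟨ξ, hξ, hξx⟩ := exists_mem_dualBall_eq (μ.inv_dualRadial_add_le hV hμ)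
      (μ.dualGauge_smul hV) (μ.dualGauge_nonneg hV) hx
    refine IsGreatest.csSup_eq ⟨⟨ξ, hξ, (hφ ξ).trans hξx⟩, ?_⟩
    rintro _ ⟨η, hη, rfl⟩
    rw [hφ]
    exact hη x
  have hG : ∀ φ : StrongDual ℝ (StrongDual ℝ V), φ ≠ 0 →
      ∀ (ξ₀ : StrongDual ℝ V) (ξ : Fin k → StrongDual ℝ V), (∀ i, φ (ξ i) = 0) →
      μ.dual.inducedDensity ξ * |φ ξ₀| =
        G φ * μ.dual.vol (Fin.cons ξ₀ ξ : Fin (k + 1) → StrongDual ℝ V) := by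
    intro φ hφ ξ₀ ξ hξ
    obtain ⟨x, hx⟩ := exists_evaluation φ
    have hx0 : x ≠ 0 := by
      rintro rfl
      refine hφ ?_
      ext η
      simp [hx]
    have h1 := μ.dual_inducedDensity_eq hV hx0 ξ₀ ξ (fun i => by rw [← hx, hξ])
    rw [hGeq φ x hx0 hx, ← h1, hx, dualGauge]
    have := (μ.dualRadial_pos hV hx0).ne'
    field_simp
  have hx₀ : hKi.some ∈ interior K := hKi.some_mem
  have hd := hasDerivWithinAt_add_smul (μ.dual.lebesgue (StrongDual ℝ V)) hK hKc hx₀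
    (isCompact_dualBall hM) (convex_dualBall _) hzero
  rw [finrank_mul_mixedVolumeOne (by omega) hd, surfaceArea, dif_pos hKi,
    boundaryIntegral_inducedDensity μ.dual hE G hG (hK.vadd _) (hKc.vadd _)
      (zero_mem_interior_vadd hx₀)]
  refine integral_congr_ae (ae_of_all _ fun u => ?_)
  simp only [G, Set.image_image]
  rfl

theorem IsIsoperimetrix.zero_mem {ν : DefinitionOfVolume.{u}} [MeasurableSpace V] [BorelSpace V]
    {I : Set V} (hI : ν.IsIsoperimetrix I) : (0 : V) ∈ I := by
  obtain ⟨x, hx⟩ := hI.nonempty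
  have hnx : -x ∈ I := by
    rw [← hI.symmetric]
    simpa using hx
  have := hI.convex hx hnx (a := 1 / 2) (b := 1 / 2) (by norm_num) (by norm_num) (by norm_num)
  simpa using this

/-- Two isoperimetrices have the same mixed volumes with every convex body, so thin boxes compare
their support functions and Hahn–Banach separation gives the inclusion. -/
theorem IsIsoperimetrix.subset {ν : DefinitionOfVolume.{u}} [MeasurableSpace V] [BorelSpace V]
    (hV : finrank ℝ V = k + 1) {I J : Set V} (hI : ν.IsIsoperimetrix I)
    (hJ : ν.IsIsoperimetrix J) : I ⊆ J := by
  refine subset_of_forall_functional hJ.isCompact hJ.convex fun φ l hl =>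
    exists_le_of_mixedVolumeOne_le (ν.lebesgue V) hV hI.isCompact hI.convex hI.symmetric
      hI.zero_mem hJ.isCompact hJ.convex hJ.symmetric hJ.zero_mem (fun K hK hc hi => ?_) φ hl
  have h := (hI.surfaceArea_eq K hK hc hi).symm.trans (hJ.surfaceArea_eq K hK hc hi)
  refine (mul_left_cancel₀ ?_ h).le
  rw [hV]
  positivity

end DefinitionOfVolume

end Isoperimetrix

end

/-! ### The theorem on the dual isoperimetrix -/

theorem theorem1 (μ : DefinitionOfVolume.{u}) {V : Type u} [NormedAddCommGroup V]
    [NormedSpace ℝ V] [FiniteDimensional ℝ V] [MeasurableSpace V] [BorelSpace V]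
    (n : ℕ) (hn : finrank ℝ V = n) (hpos : 1 ≤ n) :
    ∃ T : StarBody V,
      -- surface area of smooth star bodies as a dual mixed volume
      (∀ S : StarBody V, S.IsSmooth →
        μ.smoothDualSurfaceArea S = n * dualMixedVolumeOne (μ.lebesgue V) S T) ∧
      -- the extension of the surface area to all star bodies
      (Continuous (μ.dualSurfaceArea : StarBody V → ℝ) ∧
        ∀ S : StarBody V, S.IsSmooth → μ.dualSurfaceArea S = μ.smoothDualSurfaceArea S) ∧
      -- dual isoperimetric problem
      (∀ r : ℝ, 0 < r → ∃ (c : ℝ) (D : StarBody V), 0 < c ∧ D.carrier = c • T.carrier ∧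
        (μ.lebesgue V).real D.carrier = r ∧
        ∀ S : StarBody V, (μ.lebesgue V).real S.carrier = r →
          μ.dualSurfaceArea S ≤ μ.dualSurfaceArea D) ∧
      -- relation with the isoperimetrix of the dual definition of volume in the dual space
      (μ.dual.IsConvex → ∃ I : Set (StrongDual ℝ V), μ.dual.IsIsoperimetrix I ∧
        (∀ J : Set (StrongDual ℝ V), μ.dual.IsIsoperimetrix J → J = I) ∧
        T.carrier = polarOfDual I) := by
  obtain ⟨k, rfl⟩ : ∃ k, n = k + 1 := ⟨n - 1, by omega⟩
  have hnt : Nontrivial V := nontrivial_of_finrank_pos (R := ℝ) (by omega)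
  obtain ⟨T, hTc, hT⟩ := μ.exists_dualIsoperimetrix hn
  have harea := μ.dualSurfaceArea_eq hn T hT
  refine ⟨T, fun S hS => ?_, ⟨?_, fun S hS => ?_⟩, fun r hr => ?_, fun hμ => ?_⟩
  · rw [μ.smoothDualSurfaceArea_eq hn T hT S hS, hn]
  · rw [funext harea]
    exact continuous_dualMixedVolumeOne (μ.lebesgue V) hn T
  · rw [harea, μ.smoothDualSurfaceArea_eq hn T hT S hS]
  · obtain ⟨c, D, hc, hD, hDr, hmax⟩ := exists_dilate_isMax (μ.lebesgue V) hn T hr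
    refine ⟨c, D, hc, hD, hDr, fun S hS => ?_⟩
    rw [harea, harea]
    exact hmax S hS
  · have hI := μ.isIsoperimetrix_dualBall hn hμ
    have hE : finrank ℝ (StrongDual ℝ V) = k + 1 := finrank_strongDual_eq V hn
    refine ⟨_, hI, fun J hJ => (hJ.subset hE hI).antisymm (hI.subset hE hJ), ?_⟩
    -- Both sides are now the unit ball of the dual gauge.
    rw [hTc, polarOfDual_dualBall (μ.inv_dualRadial_add_le hn hμ) (μ.dualGauge_smul hn)
      (μ.dualGauge_nonneg hn)]
    rfl
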